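/- Theorem 3.2. Let $\pi:E\to B$ be a smooth real vector bundle of finite rank over a connected finite-dimensional smooth manifold $B$ (without boundary) with a symplectic form $\omega$; identify $B$ with the zero section of $E$ and let $\mathbb{V}=\ker d\pi\subset TE$ be the vertical subbundle. For a bivector field $\Pi$ let $\Pi^\natural:T^*E\to TE$, $\langle\beta,\Pi^\natural\alpha\rangle=\Pi(\alpha,\beta)$. Let $\Pi$ and $\tilde\Pi$ be smooth Poisson tensors defined in neighborhoods of $B$ in $E$, both having $(B,\omega)$ as a symplectic leaf; that is, along $B$ the image of $\Pi^\natural$ is $TB$ and $\omega(\Pi^\natural\alpha,\Pi^\natural\beta)=\Pi(\alpha,\beta)$, and likewise for $\tilde\Pi$. Let $\mathfrak{Diff}^0_B(E)$ be the set of germs at $B$ of diffeomorphisms $\phi$ between neighborhoods of $B$, with $\phi|_B=\mathrm{id}_B$, for which there is a smooth time-dependent vector field $Z_t$, $t\in[0,1]$, on a neighborhood of $B$ such that $Z_t|_B=0$ and the flow $\Phi_t$ of $Z_t$ ($\Phi_0=\mathrm{id}$) is defined near $B$ for all $t\in[0,1]$ and satisfies $\Phi_1=\phi$. Let $\mathfrak{End}^0_B(E)\subset\mathfrak{Diff}^0_B(E)$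 be the set of those germs for which this vector field can be chosen vertical, i.e. tangent to $\mathbb{V}$. Suppose that $\phi^*\tilde\Pi=\Pi$ near $B$ for some $\phi\in\mathfrak{Diff}^0_B(E)$. Then: (a) near $B$, $\Pi$ and $\tilde\Pi$ are horizontally nondegenerate, that is, $TE=\mathbb{H}\oplus\mathbb{V}$ with $\mathbb{H}=\Pi^\natural(\mathrm{Ann}\,\mathbb{V})$, and $TE=\tilde{\mathbb{H}}\oplus\mathbb{V}$ with $\tilde{\mathbb{H}}=\tilde\Pi^\natural(\mathrm{Ann}\,\mathbb{V})$. Hence, near $B$, their vertical parts are defined: $\Pi_V(\alpha,\beta)=\Pi(\alpha\circ\Gamma,\beta\circ\Gamma)$, where $\Gamma$ is the projection of $TE$ onto $\mathbb{V}$ along $\mathbb{H}$, and similarly $\tilde\Pi_V$ with $\tilde{\mathbb{H}}$; (b) there exists $g\in\mathfrak{End}^0_B(E)$ with $$g^*\tilde\Pi_V=\Pi_V\quad\text{near }B,$$ and $\pi\circ g=\pi$ near $B$. -/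

import Mathlib

open Set Topology Bundle
open scoped Manifold ContDiff

noncomputable section

namespace PoissonCoupling

section Manifold

variable {E : Type*} [NormedAddCommGroup E] [NormedSpace ℝ E]
  {H : Type*} [TopologicalSpace H] (I : ModelWithCorners ℝ E H)
  {M : Type*} [TopologicalSpace M] [ChartedSpace H M]

/-- The cotangent space at `m` (all tangent spaces in use are finite-dimensional, so that the
algebraic dual is the cotangent space). -/
abbrev Cotangent (m : M) : Type _ := Module.Dual ℝ (TangentSpace I m)

/-- The differential of a function `f : M → ℝ` at `m`, as a covector. -/
def differential (f : M → ℝ) (m : M) : Cotangent I m :=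
  (mfderiv I 𝓘(ℝ, ℝ) f m).toLinearMap

variable (M) in
/-- A (not necessarily smooth) bivector field `Π`, given by the maps `Π♮ : T*M → TM`,
`⟨β, Π♮ α⟩ = Π(α, β)`; antisymmetry of `Π` is the condition `⟨α, Π♮ α⟩ = 0`. -/
structure BivectorField where
  sharp : ∀ m : M, Cotangent I m →ₗ[ℝ] TangentSpace I m
  apply_sharp_self : ∀ (m : M) (α : Cotangent I m), α (sharp m α) = 0

namespace BivectorField

variable {I}

/-- The value `Π(α, β)` of a bivector field on two covectors. -/
def eval (P : BivectorField I M) (m : M) (α β : Cotangent I m) : ℝ := β (P.sharp m α)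

/-- The bracket `{f, g} = Π(df, dg)` of two functions. -/
def bracket (P : BivectorField I M) (f g : M → ℝ) (m : M) : ℝ :=
  P.eval m (differential I f m) (differential I g m)

/-- `P` is a (smooth) Poisson tensor on the open set `N`: the bracket of (locally defined) smooth
functions is smooth, and it satisfies the Jacobi identity. -/
structure IsPoissonOn (P : BivectorField I M) (N : Set M) : Prop where
  smooth : ∀ U : Set M, IsOpen U → U ⊆ N → ∀ f g : M → ℝ,
    ContMDiffOn I 𝓘(ℝ, ℝ) ∞ f U → ContMDiffOn I 𝓘(ℝ, ℝ) ∞ g U →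
    ContMDiffOn I 𝓘(ℝ, ℝ) ∞ (P.bracket f g) U
  jacobi : ∀ U : Set M, IsOpen U → U ⊆ N → ∀ f g h : M → ℝ,
    ContMDiffOn I 𝓘(ℝ, ℝ) ∞ f U → ContMDiffOn I 𝓘(ℝ, ℝ) ∞ g U →
    ContMDiffOn I 𝓘(ℝ, ℝ) ∞ h U → ∀ m ∈ U,
    P.bracket f (P.bracket g h) m + P.bracket g (P.bracket h f) m +
      P.bracket h (P.bracket f g) m = 0

/-- `φ^* Q = P` at the point `m`, for a local diffeomorphism `φ`:
`Q(α, β) = P(α ∘ dφ, β ∘ dφ)` for all covectors `α, β` at `φ m`. -/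
def PullbackEqAt (φ : M → M) (Q P : BivectorField I M) (m : M) : Prop :=
  ∀ α β : Cotangent I (φ m),
    Q.eval (φ m) α β =
      P.eval m (α ∘ₗ (mfderiv I I φ m).toLinearMap) (β ∘ₗ (mfderiv I I φ m).toLinearMap)

end BivectorField

/-- `φ` restricts to a diffeomorphism between two open neighbourhoods of `S` which is the identity
on `S`. Only the germ of `φ` at `S` matters. -/
def IsDiffeoGerm (S : Set M) (φ : M → M) : Prop :=
  (∃ e : PartialDiffeomorph I I M M ∞, S ⊆ e.source ∧ EqOn φ e e.source) ∧ EqOn φ id S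

/-- The time-dependent vector field `Z t` (`t ∈ [0,1]`) on the open neighbourhood `W` of `S` is
smooth, vanishes on `S`, and its flow `Φ t` is defined for all `t ∈ [0,1]` on some neighbourhood of
`S` and joins the identity `Φ 0` with `Φ 1 = φ` there. -/
def FlowJoinsIdTo [IsManifold I ∞ M] (S W : Set M) (Z : ℝ → ∀ m : M, TangentSpace I m) (φ : M → M) : Prop :=
  ContMDiffOn (𝓘(ℝ, ℝ).prod I) I.tangent ∞
      (fun p : ℝ × M => (⟨p.2, Z p.1 p.2⟩ : TangentBundle I M)) (Icc (0 : ℝ) 1 ×ˢ W) ∧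
    (∀ t ∈ Icc (0 : ℝ) 1, ∀ m ∈ S, Z t m = 0) ∧
    ∃ (N : Set M) (Φ : ℝ → M → M), IsOpen N ∧ S ⊆ N ∧
      ContMDiffOn (𝓘(ℝ, ℝ).prod I) I ∞ (fun p : ℝ × M => Φ p.1 p.2) (Icc (0 : ℝ) 1 ×ˢ N) ∧
      ∀ m ∈ N, Φ 0 m = m ∧ Φ 1 m = φ m ∧
        ∀ t ∈ Icc (0 : ℝ) 1, Φ t m ∈ W ∧
          HasMFDerivWithinAt 𝓘(ℝ, ℝ) I (fun s => Φ s m) (Icc (0 : ℝ) 1) t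
            ((1 : ℝ →L[ℝ] ℝ).smulRight (Z t (Φ t m)))

/-- The germ at `S` of `φ` belongs to `𝔇𝔦𝔣𝔣⁰_S(M)`: `φ` is a diffeomorphism between neighbourhoods
of `S`, joined with the identity by the flow of a time-dependent vector field vanishing on `S`. -/
def IsDiffZero [IsManifold I ∞ M] (S : Set M) (φ : M → M) : Prop :=
  IsDiffeoGerm I S φ ∧
    ∃ (W : Set M) (Z : ℝ → ∀ m : M, TangentSpace I m), IsOpen W ∧ S ⊆ W ∧ FlowJoinsIdTo I S W Z φ

end Manifold

section Symplectic

variable {EB : Type*} [NormedAddCommGroup EB] [NormedSpace ℝ EB]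
  {B : Type*} [TopologicalSpace B] [ChartedSpace EB B]

/-- The expression of a 2-form in the chart at `b₀`, i.e. its pullback by the inverse chart. -/
def formInChart (σ : ∀ b : B, TangentSpace 𝓘(ℝ, EB) b [⋀^Fin 2]→L[ℝ] ℝ) (b₀ : B) (x : EB) :
    EB [⋀^Fin 2]→L[ℝ] ℝ :=
  (σ ((extChartAt 𝓘(ℝ, EB) b₀).symm x)).compContinuousLinearMap
    (mfderiv 𝓘(ℝ, EB) 𝓘(ℝ, EB) (extChartAt 𝓘(ℝ, EB) b₀).symm x)

/-- A symplectic form: a smooth closed nondegenerate 2-form. -/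
structure IsSymplecticForm (σ : ∀ b : B, TangentSpace 𝓘(ℝ, EB) b [⋀^Fin 2]→L[ℝ] ℝ) : Prop where
  smooth : ∀ b₀ : B, ContDiffOn ℝ ∞ (formInChart σ b₀) (extChartAt 𝓘(ℝ, EB) b₀).target
  closed : ∀ b₀ : B, ∀ x ∈ (extChartAt 𝓘(ℝ, EB) b₀).target, extDeriv (formInChart σ b₀) x = 0
  nondegenerate : ∀ (b : B) (u : TangentSpace 𝓘(ℝ, EB) b),
    (∀ v : TangentSpace 𝓘(ℝ, EB) b, σ b ![u, v] = 0) → u = 0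

end Symplectic

section VectorBundle

variable {EB : Type*} [NormedAddCommGroup EB] [NormedSpace ℝ EB]
  {B : Type*} [TopologicalSpace B] [ChartedSpace EB B]
  {F : Type*} [NormedAddCommGroup F] [NormedSpace ℝ F]
  {V : B → Type*} [TopologicalSpace (TotalSpace F V)] [∀ b, TopologicalSpace (V b)]
  [FiberBundle F V]

/-- The vertical subspace `𝕍_m = ker d_m π` of the tangent space of the total space. -/
def vertical (m : TotalSpace F V) : Submodule ℝ (TangentSpace (𝓘(ℝ, EB).prod 𝓘(ℝ, F)) m) :=
  LinearMap.ker (mfderiv (𝓘(ℝ, EB).prod 𝓘(ℝ, F)) 𝓘(ℝ, EB) (π F V) m).toLinearMap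

/-- The subspace `ℍ_m = Π♮(𝕍_m⁰)`, the image of the annihilator of the vertical subspace. -/
def horizontal (P : BivectorField (𝓘(ℝ, EB).prod 𝓘(ℝ, F)) (TotalSpace F V))
    (m : TotalSpace F V) : Submodule ℝ (TangentSpace (𝓘(ℝ, EB).prod 𝓘(ℝ, F)) m) :=
  (vertical m).dualAnnihilator.map (P.sharp m)

/-- `Π` is horizontally nondegenerate at `m`: `T_m = 𝕍_m ⊕ ℍ_m`. -/
def IsHorizontallyNondegenerateAt
    (P : BivectorField (𝓘(ℝ, EB).prod 𝓘(ℝ, F)) (TotalSpace F V)) (m : TotalSpace F V) : Prop :=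
  IsCompl (vertical m) (horizontal P m)

open Classical in
/-- The connection form `Γ` of `Π`: the projection of `T_m` onto `𝕍_m` along `ℍ_m`
(with the value `0` at points where `Π` is horizontally degenerate). -/
def connectionForm (P : BivectorField (𝓘(ℝ, EB).prod 𝓘(ℝ, F)) (TotalSpace F V))
    (m : TotalSpace F V) :
    TangentSpace (𝓘(ℝ, EB).prod 𝓘(ℝ, F)) m →ₗ[ℝ] TangentSpace (𝓘(ℝ, EB).prod 𝓘(ℝ, F)) m :=
  if h : IsCompl (vertical m) (horizontal P m) then
    (vertical m).projection (horizontal P m) h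
  else 0

/-- The vertical part `Π_V` of `Π`, its component of degree `(0, 2)` with respect to
`T = ℍ ⊕ 𝕍`: `Π_V(α, β) = Π(α ∘ Γ, β ∘ Γ)`. -/
def verticalPart (P : BivectorField (𝓘(ℝ, EB).prod 𝓘(ℝ, F)) (TotalSpace F V)) :
    BivectorField (𝓘(ℝ, EB).prod 𝓘(ℝ, F)) (TotalSpace F V) where
  sharp m := connectionForm P m ∘ₗ P.sharp m ∘ₗ (connectionForm P m).dualMap
  apply_sharp_self m α := P.apply_sharp_self m (α ∘ₗ connectionForm P m)

variable [∀ b, AddCommGroup (V b)]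

variable (F V) in
/-- The base `B`, embedded in the total space as the zero section. -/
def zeroSet : Set (TotalSpace F V) := range (zeroSection F V)

variable (F V) in
/-- The differential of the zero section, i.e. the inclusion `T_b B ⊆ T_b E`. -/
def inclTangent (b : B) : TangentSpace 𝓘(ℝ, EB) b →ₗ[ℝ]
    TangentSpace (𝓘(ℝ, EB).prod 𝓘(ℝ, F)) (zeroSection F V b) :=
  (mfderiv 𝓘(ℝ, EB) (𝓘(ℝ, EB).prod 𝓘(ℝ, F)) (zeroSection F V) b).toLinearMap

/-- `(B, σ)` is a symplectic leaf of `Π`: the zero section is an integral manifold of the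
characteristic distribution `Im Π♮`, and the induced symplectic form,
`(Π♮ α, Π♮ β) ↦ Π(α, β)`, is `σ`. (The base is connected and the zero section is closed, so an
integral manifold of this kind is automatically maximal, i.e. an entire leaf.) -/
structure HasZeroSectionAsLeaf (P : BivectorField (𝓘(ℝ, EB).prod 𝓘(ℝ, F)) (TotalSpace F V))
    (σ : ∀ b : B, TangentSpace 𝓘(ℝ, EB) b [⋀^Fin 2]→L[ℝ] ℝ) : Prop where
  range_sharp : ∀ b : B,
    LinearMap.range (P.sharp (zeroSection F V b)) = LinearMap.range (inclTangent (EB := EB) F V b)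
  form_eq : ∀ (b : B) (α β : Cotangent (𝓘(ℝ, EB).prod 𝓘(ℝ, F)) (zeroSection F V b))
    (u v : TangentSpace 𝓘(ℝ, EB) b),
    inclTangent F V b u = P.sharp (zeroSection F V b) α →
    inclTangent F V b v = P.sharp (zeroSection F V b) β →
    σ b ![u, v] = P.eval (zeroSection F V b) α β

/-- The germ of `Π` at `B` belongs to `ℭ𝔬𝔲𝔭_B(E)`: `Π` is a Poisson tensor on a neighbourhood of
the zero section and has `(B, σ)` as a symplectic leaf. -/
def IsCoup (σ : ∀ b : B, TangentSpace 𝓘(ℝ, EB) b [⋀^Fin 2]→L[ℝ] ℝ)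
    (P : BivectorField (𝓘(ℝ, EB).prod 𝓘(ℝ, F)) (TotalSpace F V)) : Prop :=
  (∃ N : Set (TotalSpace F V), IsOpen N ∧ zeroSet F V ⊆ N ∧ P.IsPoissonOn N) ∧
    HasZeroSectionAsLeaf P σ

variable (EB) in
/-- The germ at `B` of `g` belongs to `𝔈𝔫𝔡⁰_B(E)`: `g` is a diffeomorphism between neighbourhoods
of the zero section, joined with the identity by the flow of a vertical time-dependent vector field
vanishing on the zero section. -/
def IsEndZero [IsManifold 𝓘(ℝ, EB) ∞ B] [∀ b, Module ℝ (V b)] [VectorBundle ℝ F V]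
    [ContMDiffVectorBundle ∞ F V 𝓘(ℝ, EB)] (g : TotalSpace F V → TotalSpace F V) : Prop :=
  IsDiffeoGerm (𝓘(ℝ, EB).prod 𝓘(ℝ, F)) (zeroSet F V) g ∧
    ∃ (W : Set (TotalSpace F V))
      (Y : ℝ → ∀ m : TotalSpace F V, TangentSpace (𝓘(ℝ, EB).prod 𝓘(ℝ, F)) m),
      IsOpen W ∧ zeroSet F V ⊆ W ∧
      (∀ t ∈ Icc (0 : ℝ) 1, ∀ m ∈ W, Y t m ∈ vertical m) ∧
      FlowJoinsIdTo (𝓘(ℝ, EB).prod 𝓘(ℝ, F)) (zeroSet F V) W Y g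

end VectorBundle

end PoissonCoupling

end

/-!
The diffeomorphism `φ` is the time-one map of an isotopy `Φ t` fixing the zero section
(`exists_isotopy`), and `Φ 1` carries `Π` to `Π̃`, but the maps `Φ t` do not preserve the fibres of
`π`. The idea is to correct them by an isotopy `χ t` which straightens the moving family of
projections `p t = π ∘ Φ t` back to `p 0 = π`, and which is built out of `Π` itself, so that it does
not affect vertical parts.

Along the zero section, and therefore near it, `p t` is transverse to the symplectic leaves of `Π`:
the map `d(p t) ∘ Π♮ ∘ d(p t)*` is invertible (`HasZeroSectionAsLeaf.isTransverse`, which for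
`p t = π` is horizontal nondegeneracy). Hence there is a unique vector field `X t` of the form
`Π♮ (d(p t)* ξ)` with `d(p t) (X t) = -∂ₜ (p t)`, the compensating field. It vanishes on the zero
section, its flow `χ t` exists near the zero section for all times under consideration
(`exists_flow_near`), and `p t ∘ χ t` does not depend on `t`.

Given a map `p` transverse to the leaves, call a covector adapted to `p` if `Π♮` maps it into
`ker dp`, that is, if it annihilates `Π♮ (Ann (ker dp))`. Every covector on `ker dp` has exactly one
adapted extension, and the vertical part of `Π` relative to `p` is the value of `Π` on adapted
extensions (`IsAdapted`). The Jacobi identity implies that this value is constant along `χ t` when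
the restrictions of the covectors to the fibres are transported by `χ t` (`hasDerivAt_eval_zero` for
the infinitesimal computation in a vector space, `eval_flow_eq` for its integrated form,
`exists_straightening` for the statement on manifolds).

Therefore `Ψ t = Φ t ∘ χ t` satisfies `π ∘ Ψ t = π`, and `g = Ψ 1` pulls the vertical part of `Π̃`
back to that of `Π`: `Φ 1` pulls back the vertical part of `Π̃` to the vertical part of `Π` relative
to `p 1`, and `χ 1` pulls back the latter to the one relative to `p 0 = π`
(`pullbackEqAt_verticalPart`). Finally `Ψ` is the flow of its velocity field, which is vertical
because `Ψ t` preserves the fibres (`exists_generating_field`).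

Mathlib has neither the smooth dependence of flows on initial conditions nor flows of
time-dependent vector fields near a non-compact set of zeros. The former is proved by applying the
implicit function theorem to the Volterra equation on the space of continuous curves
(`exists_smooth_flow`), the latter by gluing local flows by uniqueness of integral curves.
-/

noncomputable section

namespace PoissonCoupling

/-! ### Vector fields with smooth flows -/

section Nemytskii

set_option synthInstance.maxHeartbeats 200000

universe u
variable {K : Type*} [TopologicalSpace K] [CompactSpace K]
  {E : Type u} [NormedAddCommGroup E] [NormedSpace ℝ E]
  {F : Type u} [NormedAddCommGroup F] [NormedSpace ℝ F]

/-- A continuous bilinear map `B : G × E → F`, applied pointwise to continuous functions. -/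
def pointwiseBilin (K : Type*) [TopologicalSpace K] [CompactSpace K]
    {G : Type*} [NormedAddCommGroup G] [NormedSpace ℝ G]
    {E : Type*} [NormedAddCommGroup E] [NormedSpace ℝ E]
    {F : Type*} [NormedAddCommGroup F] [NormedSpace ℝ F] (B : G →L[ℝ] E →L[ℝ] F) :
    C(K, G) →L[ℝ] C(K, E) →L[ℝ] C(K, F) :=
  LinearMap.mkContinuous₂
    (LinearMap.mk₂ ℝ
      (fun (A : C(K, G)) (h : C(K, E)) => (⟨fun s => B (A s) (h s), by fun_prop⟩ : C(K, F)))
      (fun _ _ _ => by ext; simp) (fun _ _ _ => by ext; simp)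
      (fun _ _ _ => by ext; simp) (fun _ _ _ => by ext; simp)) ‖B‖ (by
    intro A h
    refine (ContinuousMap.norm_le _ (by positivity)).2 fun s => ?_
    simp only [LinearMap.mk₂_apply, ContinuousMap.coe_mk]
    refine (B.le_opNorm₂ _ _).trans ?_
    gcongr
    · exact A.norm_coe_le_norm s
    · exact h.norm_coe_le_norm s)

/-- Pointwise application of a continuous family of operators to a continuous function, as a
continuous linear map in the family of operators. -/
def pointwiseApply (K : Type*) [TopologicalSpace K] [CompactSpace K]
    (E : Type u) [NormedAddCommGroup E] [NormedSpace ℝ E]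
    (F : Type u) [NormedAddCommGroup F] [NormedSpace ℝ F] :
    C(K, E →L[ℝ] F) →L[ℝ] C(K, E) →L[ℝ] C(K, F) :=
  pointwiseBilin K (ContinuousLinearMap.id ℝ (E →L[ℝ] F))

@[simp] lemma pointwiseApply_apply (A : C(K, E →L[ℝ] F)) (h : C(K, E)) (s : K) :
    pointwiseApply K E F A h s = A s (h s) := rfl

/-- The superposition operator `γ ↦ V ∘ γ` is differentiable; its derivative is pointwise
multiplication by `fderiv V ∘ γ`. -/
lemma hasFDerivAt_superposition (V : C(E, F)) (V' : C(E, E →L[ℝ] F))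
    (hV : ∀ x, HasFDerivAt V (V' x) x) (γ : C(K, E)) :
    HasFDerivAt (fun γ : C(K, E) => V.comp γ) (pointwiseApply K E F (V'.comp γ)) γ := by
  rw [hasFDerivAt_iff_isLittleO_nhds_zero, Asymptotics.isLittleO_iff]
  intro ε hε
  have hc : Continuous fun γ : C(K, E) => V'.comp γ := ContinuousMap.continuous_postcomp V'
  obtain ⟨δ, hδ, H⟩ := (Metric.continuous_iff (α := C(K, E)) (β := C(K, E →L[ℝ] F))).1 hc γ ε hε
  filter_upwards [Metric.ball_mem_nhds (0 : C(K, E)) hδ] with h hh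
  refine (ContinuousMap.norm_le _ (by positivity)).2 fun s => ?_
  have hh' : ‖h s‖ < δ := (h.norm_coe_le_norm s).trans_lt (by simpa using hh)
  have key : ∀ y ∈ Metric.ball (γ s) δ, ‖V' y - V' (γ s)‖ ≤ ε := by
    intro y hy
    have h1 := H (γ + ContinuousMap.const K (y - γ s)) (by
      rw [dist_eq_norm, add_sub_cancel_left]
      refine ((ContinuousMap.norm_le _ (norm_nonneg (y - γ s))).2 fun _ => le_rfl).trans_lt ?_
      rwa [← dist_eq_norm])
    have h2 := (ContinuousMap.dist_apply_le_dist
      (f := V'.comp (γ + ContinuousMap.const K (y - γ s)))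
      (g := V'.comp γ) s).trans h1.le
    simpa [dist_eq_norm] using h2
  have := (convex_ball (γ s) δ).norm_image_sub_le_of_norm_hasFDerivWithin_le'
    (fun y _ => (hV y).hasFDerivWithinAt) key (Metric.mem_ball_self hδ)
    (y := γ s + h s) (by simpa using hh')
  simp only [add_sub_cancel_left] at this
  simpa using this.trans (mul_le_mul_of_nonneg_left (h.norm_coe_le_norm s) hε.le)

/-- The superposition operator of a smooth map is smooth on the space of continuous curves. -/
lemma contDiff_superposition (n : ℕ) : ∀ {F : Type u} [NormedAddCommGroup F] [NormedSpace ℝ F]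
    (V : C(E, F)), ContDiff ℝ ∞ V → ContDiff ℝ n (fun γ : C(K, E) => V.comp γ) := by
  induction n with
  | zero => exact fun V _ => contDiff_zero.2 (ContinuousMap.continuous_postcomp V)
  | succ n ih =>
    intro F _ _ V hV
    let V' : C(E, E →L[ℝ] F) := ⟨fderiv ℝ V, hV.continuous_fderiv (by simp)⟩
    have hV' : ContDiff ℝ ∞ V' := hV.fderiv_right (m := ∞) le_rfl
    have hd : ∀ x, HasFDerivAt V (V' x) x := fun x =>
      (hV.differentiable (by simp) x).hasFDerivAt
    push_cast
    refine (contDiff_succ_iff_hasFDerivAt).2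
      ⟨fun γ => pointwiseApply K E F (V'.comp γ), ?_, hasFDerivAt_superposition V V' hd⟩
    exact (pointwiseApply K E F).contDiff.comp (ih V' hV')

end Nemytskii

section Flow

universe u
variable {E : Type u} [NormedAddCommGroup E] [NormedSpace ℝ E]

/-- The primitive vanishing at `0` of a continuous function on `[0, 1]`, as an operator. -/
def primitive (E : Type*) [NormedAddCommGroup E] [NormedSpace ℝ E] :
    C(Icc (0 : ℝ) 1, E) →L[ℝ] C(Icc (0 : ℝ) 1, E) :=
  LinearMap.mkContinuous
    { toFun := fun f => ⟨fun t => ∫ s in (0 : ℝ)..t, IccExtend zero_le_one f s, by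
        have : Continuous fun t : ℝ => ∫ s in (0 : ℝ)..t, IccExtend zero_le_one f s :=
          intervalIntegral.continuous_primitive
            (fun a b => (f.continuous.Icc_extend').intervalIntegrable a b) 0
        exact this.comp continuous_subtype_val⟩
      map_add' := fun f g => by
        ext t
        exact intervalIntegral.integral_add (f.continuous.Icc_extend'.intervalIntegrable _ _)
          (g.continuous.Icc_extend'.intervalIntegrable _ _)
      map_smul' := fun c f => by
        ext t
        exact intervalIntegral.integral_smul c _ } 1 (by
    intro f
    refine (ContinuousMap.norm_le _ (by positivity)).2 fun t => ?_
    have := intervalIntegral.norm_integral_le_of_norm_le_const (a := 0) (b := (t : ℝ)) (C := ‖f‖)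
      (f := IccExtend zero_le_one f) (fun x _ => f.norm_coe_le_norm _)
    refine this.trans ?_
    rw [one_mul, sub_zero, abs_of_nonneg t.2.1]
    exact mul_le_of_le_one_right (norm_nonneg _) t.2.2)

lemma norm_primitive_le : ‖primitive E‖ ≤ 1 := LinearMap.mkContinuous_norm_le _ zero_le_one _

lemma primitive_apply (f : C(Icc (0 : ℝ) 1, E)) (t : Icc (0 : ℝ) 1) :
    primitive E f t = ∫ s in (0 : ℝ)..t, IccExtend zero_le_one f s := rfl

/-- A bounded Lipschitz vector field is complete. -/
lemma exists_forall_hasDerivAt [CompleteSpace E] {V : E → E} {K : NNReal}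
    (hK : LipschitzWith K V) {L : NNReal} (hL : ∀ x, ‖V x‖ ≤ L) (z : E) :
    ∃ γ : ℝ → E, γ 0 = z ∧ ∀ t, HasDerivAt γ (V (γ t)) t := by
  have h1 : ∀ n : ℝ, ∃ γ : ℝ → E, γ 0 = z ∧ ∀ t ∈ Ioo (-n) n, HasDerivAt γ (V (γ t)) t := by
    intro n
    rcases le_or_gt n 0 with hn | hn
    · exact ⟨fun _ => z, rfl, fun t ht => by
        have := ht.1.trans ht.2; linarith⟩
    have hp : IsPicardLindelof (fun _ : ℝ => V) (tmin := -n) (tmax := n)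
        ⟨0, by constructor <;> linarith⟩ z (L * ⟨n, hn.le⟩) 0 L K :=
      { lipschitzOnWith := fun _ _ => hK.lipschitzOnWith
        continuousOn := fun _ _ => continuousOn_const
        norm_le := fun _ _ x _ => hL x
        mul_max_le := by simp; rfl }
    obtain ⟨γ, h0, hγ⟩ := hp.exists_eq_forall_mem_Icc_hasDerivWithinAt₀
    exact ⟨γ, h0, fun t ht => (hγ t (Ioo_subset_Icc_self ht)).hasDerivAt (Icc_mem_nhds ht.1 ht.2)⟩
  choose γ h0 hγ using h1
  have hu : ∀ m n : ℝ, 0 < m → m ≤ n → EqOn (γ m) (γ n) (Ioo (-m) m) := by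
    intro m n hm hmn
    refine ODE_solution_unique_of_mem_Ioo (v := fun _ => V) (s := fun _ => univ) (K := K)
      (t₀ := 0) (fun _ _ => hK.lipschitzOnWith) ⟨by linarith, hm⟩
      (fun t ht => ⟨hγ m t ht, trivial⟩)
      (fun t ht => ⟨hγ n t ⟨by linarith [ht.1], by linarith [ht.2]⟩, trivial⟩) (by rw [h0, h0])
  refine ⟨fun t => γ (|t| + 1) t, h0 _, fun t => ?_⟩
  have hmem : ∀ᶠ s in 𝓝 t, |s| < |t| + 1 :=
    continuous_abs.continuousAt.eventually_lt continuousAt_const (by linarith)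
  have hev : (fun s => γ (|s| + 1) s) =ᶠ[𝓝 t] γ (|t| + 2) := by
    filter_upwards [hmem] with s hs
    exact hu _ _ (by positivity) (by linarith)
      ⟨by linarith [neg_abs_le s], by linarith [le_abs_self s]⟩
  have hval : γ (|t| + 1) t = γ (|t| + 2) t := hev.self_of_nhds
  simp only [hval]
  exact (hγ (|t| + 2) t ⟨by linarith [neg_abs_le t], by linarith [le_abs_self t]⟩).congr_of_eventuallyEq
    hev

lemma eq_of_hasDerivAt_lipschitz {V : E → E} {K : NNReal} (hK : LipschitzWith K V) {γ γ' : ℝ → E}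
    (hγ : ∀ t, HasDerivAt γ (V (γ t)) t) (hγ' : ∀ t, HasDerivAt γ' (V (γ' t)) t) {t₀ : ℝ}
    (h : γ t₀ = γ' t₀) : γ = γ' :=
  ODE_solution_unique_univ (v := fun _ => V) (s := fun _ => univ) (fun _ => hK.lipschitzOnWith)
    (fun t => ⟨hγ t, trivial⟩) (fun t => ⟨hγ' t, trivial⟩) h

/-- The map whose zeros `((a, z), γ)` are the curves with `γ s = z + a ∫₀ˢ V (γ r) dr`. -/
def volterraDefect (V : C(E, E)) (p : (ℝ × E) × C(Icc (0 : ℝ) 1, E)) : C(Icc (0 : ℝ) 1, E) :=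
  p.2 - ContinuousMap.const _ p.1.2 - p.1.1 • primitive E (V.comp p.2)

/-- A zero of the Volterra map is a piece of the integral curve, with time rescaled by `a`. -/
lemma eval_one_of_volterraDefect_eq_zero [CompleteSpace E] {V : C(E, E)} {K : NNReal}
    (hK : LipschitzWith K V) {a : ℝ} {z : E} {γ : C(Icc (0 : ℝ) 1, E)} (h : volterraDefect V ((a, z), γ) = 0) {c : ℝ → E}
    (hc0 : c 0 = z) (hc : ∀ t, HasDerivAt c (V (c t)) t) : γ 1 = c a := by
  have hγ : ∀ t : Icc (0 : ℝ) 1, γ t =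
      z + a • ∫ s in (0 : ℝ)..t, V (IccExtend zero_le_one γ s) := by
    intro t
    have := congrArg (fun f => f t) h
    simp only [volterraDefect, ContinuousMap.sub_apply, ContinuousMap.const_apply,
      ContinuousMap.smul_apply, primitive_apply, ContinuousMap.zero_apply] at this
    rw [sub_eq_zero, sub_eq_iff_eq_add] at this
    rw [this, add_comm]; rfl
  have hcont : Continuous fun s => V (IccExtend zero_le_one γ s) :=
    V.continuous.comp γ.continuous.Icc_extend'
  let g : ℝ → E := fun t => z + a • ∫ s in (0 : ℝ)..t, V (IccExtend zero_le_one γ s)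
  have hg : ∀ t, HasDerivAt g (a • V (IccExtend zero_le_one γ t)) t := fun t =>
    ((intervalIntegral.integral_hasDerivAt_right (hcont.intervalIntegrable _ _)
      (hcont.stronglyMeasurableAtFilter _ _) hcont.continuousAt).const_smul a).const_add z
  have hgγ : ∀ t (ht : t ∈ Icc (0 : ℝ) 1), IccExtend zero_le_one γ t = g t := fun t ht => by
    rw [IccExtend_of_mem _ _ ht, hγ]
  have hc' : ∀ t, HasDerivAt (fun s => c (s * a)) (a • V (c (t * a))) t := fun t =>
    (hc (t * a)).scomp t (by simpa using (hasDerivAt_id t).mul_const a)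
  have := ODE_solution_unique (v := fun _ x => a • V x) (K := ‖a‖₊ * K) (a := 0) (b := 1)
    (f := g) (g := fun s => c (s * a))
    (fun _ => (lipschitzWith_smul a).comp hK)
    (fun t _ => (hg t).continuousAt.continuousWithinAt)
    (fun t ht => by
      rw [← hgγ t (Ico_subset_Icc_self ht)]; exact (hg t).hasDerivWithinAt)
    (fun t _ => (hc' t).continuousAt.continuousWithinAt)
    (fun t _ => (hc' t).hasDerivWithinAt) (by simp [g, hc0])
  have h1 := this (right_mem_Icc.2 zero_le_one)
  simp only [one_mul] at h1
  rw [← h1, hγ]; rfl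

lemma contDiff_volterraDefect {V : C(E, E)} (hV : ContDiff ℝ ∞ V) :
    ContDiff ℝ ∞ (volterraDefect V) := by
  have h1 : ContDiff ℝ ∞ (fun γ : C(Icc (0 : ℝ) 1, E) => V.comp γ) :=
    contDiff_infty.2 fun n => contDiff_superposition n V hV
  have h2 : ContDiff ℝ ∞ fun z : E => ContinuousMap.const (Icc (0 : ℝ) 1) z :=
    (ContinuousLinearMap.const ℝ (Icc (0 : ℝ) 1) (M := E)).contDiff
  unfold volterraDefect
  refine (contDiff_snd.sub (h2.comp (contDiff_snd.comp contDiff_fst))).sub ?_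
  exact (contDiff_fst.comp contDiff_fst).smul
    ((primitive E).contDiff.comp (h1.comp contDiff_snd))

/-- The flow of a smooth Lipschitz bounded vector field is smooth for small times: apply the
implicit function theorem to the integral equation in the space of continuous curves. -/
lemma contDiffAt_flow_of_small [CompleteSpace E] {V : E → E} (hV : ContDiff ℝ ∞ V) {K : NNReal}
    (hK : LipschitzWith K V) {c : ℝ → E → E} (hc0 : ∀ z, c 0 z = z)
    (hc : ∀ z t, HasDerivAt (fun s => c s z) (V (c t z)) t) {a : ℝ} (ha : |a| * K < 1) (z : E) :
    ContDiffAt ℝ ∞ (fun p : ℝ × E => c p.1 p.2) (a, z) := by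
  have hcz : Continuous fun s => c s z :=
    continuous_iff_continuousAt.2 fun t => (hc z t).continuousAt
  let Vc : C(E, E) := ⟨V, hV.continuous⟩
  let γ : C(Icc (0 : ℝ) 1, E) := ⟨fun s => c (s * a) z, by fun_prop⟩
  have hzero : volterraDefect Vc ((a, z), γ) = 0 := by
    ext t
    have hint : ∫ s in (0 : ℝ)..t, IccExtend zero_le_one (Vc.comp γ) s =
        ∫ s in (0 : ℝ)..t, V (c (s * a) z) := by
      refine intervalIntegral.integral_congr fun s hs => ?_
      rw [uIcc_of_le t.2.1] at hs
      rw [IccExtend_of_mem _ _ ⟨hs.1, hs.2.trans t.2.2⟩]; rfl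
    have hd : ∀ s, HasDerivAt (fun s => c (s * a) z) (a • V (c (s * a) z)) s := fun s =>
      HasDerivAt.scomp (h := fun s => s * a) s (hc z (s * a))
        (by simpa using (hasDerivAt_id s).mul_const a)
    have hftc := intervalIntegral.integral_eq_sub_of_hasDerivAt (a := 0) (b := (t : ℝ))
      (fun s _ => hd s) (Continuous.intervalIntegrable (by
        have := hV.continuous; fun_prop) _ _)
    rw [intervalIntegral.integral_smul] at hftc
    change c (t * a) z - z - a • (∫ s in (0 : ℝ)..t, IccExtend zero_le_one (Vc.comp γ) s) = 0
    rw [hint, hftc, zero_mul, hc0, sub_self]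
  have hT : ContDiffAt ℝ ∞ (volterraDefect Vc) ((a, z), γ) :=
    (contDiff_volterraDefect (V := Vc) hV).contDiffAt
  let V' : C(E, E →L[ℝ] E) := ⟨fderiv ℝ V, hV.continuous_fderiv (by simp)⟩
  have hd : ∀ x, HasFDerivAt V (V' x) x := fun x => (hV.differentiable (by simp) x).hasFDerivAt
  let A : C(Icc (0 : ℝ) 1, E) →L[ℝ] C(Icc (0 : ℝ) 1, E) :=
    a • (primitive E ∘L pointwiseApply (Icc (0 : ℝ) 1) E E (V'.comp γ))
  have hA : ‖A‖ < 1 := by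
    have h1 : ‖pointwiseApply (Icc (0 : ℝ) 1) E E (V'.comp γ)‖ ≤ K := by
      refine ContinuousLinearMap.opNorm_le_bound _ K.2 fun h => ?_
      refine (ContinuousMap.norm_le _ (by positivity)).2 fun s => ?_
      refine ((V' (γ s)).le_opNorm _).trans ?_
      gcongr
      · exact norm_fderiv_le_of_lipschitz ℝ hK
      · exact h.norm_coe_le_norm s
    refine lt_of_le_of_lt (ContinuousLinearMap.opNorm_le_bound A (by positivity) fun h => ?_) ha
    calc ‖A h‖ = ‖a • primitive E (pointwiseApply (Icc (0 : ℝ) 1) E E (V'.comp γ) h)‖ := rfl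
      _ ≤ |a| * (1 * (K * ‖h‖)) := by
          rw [norm_smul, Real.norm_eq_abs]
          gcongr
          exact (primitive E).le_of_opNorm_le_of_le norm_primitive_le
            (ContinuousLinearMap.le_of_opNorm_le _ h1 h)
      _ = |a| * K * ‖h‖ := by ring
  have hpart : fderiv ℝ (volterraDefect Vc) ((a, z), γ) ∘L
      .inr ℝ (ℝ × E) C(Icc (0 : ℝ) 1, E) = 1 - A := by
    have h1 : HasFDerivAt (fun γ' => volterraDefect Vc ((a, z), γ'))
        (fderiv ℝ (volterraDefect Vc) ((a, z), γ) ∘L .inr ℝ (ℝ × E) C(Icc (0 : ℝ) 1, E)) γ :=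
      (hT.differentiableAt (by simp)).hasFDerivAt.comp γ (hasFDerivAt_prodMk_right (a, z) γ)
    have h2 : HasFDerivAt (fun γ' => volterraDefect Vc ((a, z), γ')) (1 - A) γ := by
      have h3 := hasFDerivAt_superposition (K := Icc (0 : ℝ) 1) Vc V' hd γ
      exact ((hasFDerivAt_id γ).sub_const (ContinuousMap.const _ z)).sub
        (((primitive E).hasFDerivAt.comp γ h3).const_smul a)
    exact h1.unique h2
  have hinv : (fderiv ℝ (volterraDefect Vc) ((a, z), γ) ∘L
      .inr ℝ (ℝ × E) C(Icc (0 : ℝ) 1, E)).IsInvertible := by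
    rw [hpart]
    exact ⟨ContinuousLinearEquiv.unitsEquiv _ _ (Units.oneSub A hA), by ext; rfl⟩
  have h1 := hT.contDiffAt_implicitFunction (by simp) hinv
  have h2 := hT.eventually_apply_implicitFunction (by simp) hinv
  have hev : ContDiff ℝ ∞ fun f : C(Icc (0 : ℝ) 1, E) => f 1 :=
    (ContinuousMap.evalCLM (M := E) ℝ (1 : Icc (0 : ℝ) 1)).contDiff
  refine (hev.contDiffAt.comp (a, z) h1).congr_of_eventuallyEq ?_
  filter_upwards [h2] with p hp
  rw [hzero] at hp
  exact (eval_one_of_volterraDefect_eq_zero (V := Vc) hK hp (hc0 p.2) (hc p.2)).symm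

/-- A smooth, bounded, Lipschitz vector field has a smooth global flow. -/
theorem exists_smooth_flow [CompleteSpace E] {V : E → E} (hV : ContDiff ℝ ∞ V) {K : NNReal}
    (hK : LipschitzWith K V) {L : NNReal} (hL : ∀ x, ‖V x‖ ≤ L) :
    ∃ c : ℝ → E → E, ContDiff ℝ ∞ (fun p : ℝ × E => c p.1 p.2) ∧ (∀ z, c 0 z = z) ∧
      (∀ z t, HasDerivAt (fun s => c s z) (V (c t z)) t) ∧
      ∀ s t z, c (s + t) z = c s (c t z) := by
  choose c hc0 hc using exists_forall_hasDerivAt hK hL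
  have hadd : ∀ s t z, c z (s + t) = c (c z t) s := by
    intro s t z
    have := eq_of_hasDerivAt_lipschitz (γ := fun s => c z (s + t)) (γ' := c (c z t)) (t₀ := 0) hK
      (fun s => (hc z (s + t)).comp_add_const s t) (hc _) (by simp [hc0])
    exact congrFun this s
  refine ⟨fun t z => c z t, ?_, hc0, hc, hadd⟩
  obtain ⟨δ, hδ, hδK⟩ : ∃ δ : ℝ, 0 < δ ∧ δ * K < 1 :=
    ⟨1 / (K + 1), by positivity, by
      rw [div_mul_eq_mul_div, one_mul, div_lt_one (by positivity)]; linarith⟩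
  have hstep : ∀ n : ℕ, ∀ a : ℝ, |a| < 2 ^ n * δ → ∀ z,
      ContDiffAt ℝ ∞ (fun p : ℝ × E => c p.2 p.1) (a, z) := by
    intro n
    induction n with
    | zero =>
      intro a ha z
      refine contDiffAt_flow_of_small (c := fun t z => c z t) hV hK hc0 hc
        (lt_of_le_of_lt ?_ hδK) z
      gcongr
      simpa using ha.le
    | succ n ih =>
      intro a ha z
      have ha' : |a / 2| < 2 ^ n * δ := by
        rw [abs_div, abs_two, div_lt_iff₀ two_pos]; rw [pow_succ] at ha; linarith
      have h1 : ContDiffAt ℝ ∞ (fun p : ℝ × E => (p.1 / 2, p.2)) (a, z) := by fun_prop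
      have h2 : ContDiffAt ℝ ∞ (fun p : ℝ × E => c p.2 (p.1 / 2)) (a, z) :=
        ContDiffAt.comp (g := fun p : ℝ × E => c p.2 p.1) (a, z) (ih _ ha' z) h1
      have h3 : ContDiffAt ℝ ∞ (fun p : ℝ × E => (p.1 / 2, c p.2 (p.1 / 2))) (a, z) :=
        (by fun_prop : ContDiffAt ℝ ∞ (fun p : ℝ × E => p.1 / 2) (a, z)).prodMk h2
      refine (ContDiffAt.comp (g := fun p : ℝ × E => c p.2 p.1) (a, z)
        (ih _ ha' (c z (a / 2))) h3).congr_of_eventuallyEq (Filter.Eventually.of_forall fun p => ?_)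
      simp only [Function.comp_apply]
      rw [← hadd, add_halves]
  refine contDiff_iff_contDiffAt.2 fun p => ?_
  obtain ⟨n, hn⟩ := pow_unbounded_of_one_lt (|p.1| / δ) one_lt_two
  exact hstep n p.1 ((div_lt_iff₀ hδ).1 hn) p.2

end Flow

/-! ### Local flows on a vector space -/

section LocalFlow

variable {E : Type*} [NormedAddCommGroup E] [NormedSpace ℝ E] [FiniteDimensional ℝ E]

/-- A time-dependent vector field defined near `[a, b] × {x₀}` coincides there with a smooth
compactly supported one. -/
lemma exists_compactlySupported_extension {a b : ℝ} {x₀ : E} {Ω : Set (ℝ × E)} (hΩ : IsOpen Ω)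
    (hK : Icc a b ×ˢ {x₀} ⊆ Ω) {v : ℝ × E → E} (hv : ContDiffOn ℝ ∞ v Ω) :
    ∃ (w : ℝ × E → E) (O : Set (ℝ × E)), ContDiff ℝ ∞ w ∧ HasCompactSupport w ∧ IsOpen O ∧
      Icc a b ×ˢ {x₀} ⊆ O ∧ O ⊆ Ω ∧ EqOn w v O ∧ ∀ p, v p = 0 ∨ p ∉ Ω → w p = 0 := by
  have hKc : IsCompact (Icc a b ×ˢ ({x₀} : Set E)) := isCompact_Icc.prod isCompact_singleton
  obtain ⟨L, hL, hKL, hLΩ⟩ := exists_compact_between hKc hΩ hK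
  obtain ⟨ρ, hρ1, hρ0, -⟩ := exists_contMDiffMap_one_nhds_of_subset_interior 𝓘(ℝ, ℝ × E) (n := ⊤)
    hKc.isClosed hKL
  have hρ : ContDiff ℝ ∞ ρ := ρ.contMDiff.contDiff
  have hsupp : tsupport (fun p => ρ p • v p) ⊆ L := by
    refine closure_minimal (fun p hp => ?_) hL.isClosed
    by_contra h
    exact hp (by simp [hρ0 p h])
  obtain ⟨O, hKO, hO, hO1⟩ := (eventually_nhdsSet_iff_exists.1 hρ1)
  refine ⟨fun p => ρ p • v p, O ∩ Ω, ?_, HasCompactSupport.of_support_subset_isCompact hL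
    ((subset_tsupport _).trans hsupp), hKO.inter hΩ, ?_, inter_subset_right, ?_, ?_⟩
  · refine contDiff_iff_contDiffAt.2 fun p => ?_
    by_cases hp : p ∈ Ω
    · exact hρ.contDiffAt.smul (hv.contDiffAt (hΩ.mem_nhds hp))
    · have : p ∉ tsupport (fun p => ρ p • v p) := fun h => hp (hLΩ (hsupp h))
      exact contDiffAt_const.congr_of_eventuallyEq (notMem_tsupport_iff_eventuallyEq.1 this)
  · exact subset_inter hO hK
  · intro p hp
    simp [hO1 p hp.1]
  · rintro p (h | h)
    · simp [h]
    · have : p ∉ L := fun h' => h (hLΩ h')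
      simp [hρ0 p this]

/-- The flow, near a common zero `x₀`, of a time-dependent vector field on a vector space. The maps
`c t` are global diffeomorphisms with inverse `e t`, but follow `v` only near `x₀`. -/
lemma exists_local_flow {a' a b b' : ℝ} (ha' : a' < a) (hb' : b < b')
    {U : Set E} (hU : IsOpen U) {x₀ : E} (hx₀ : x₀ ∈ U) {v : ℝ × E → E}
    (hv : ContDiffOn ℝ ∞ v (Ioo a' b' ×ˢ U)) (hv0 : ∀ t ∈ Ioo a' b', v (t, x₀) = 0) :
    ∃ (U' : Set E) (c e : ℝ → E → E), IsOpen U' ∧ x₀ ∈ U' ∧ U' ⊆ U ∧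
      ContDiff ℝ ∞ (fun p : ℝ × E => c p.1 p.2) ∧ ContDiff ℝ ∞ (fun p : ℝ × E => e p.1 p.2) ∧
      (∀ x, c 0 x = x) ∧ (∀ t, c t x₀ = x₀) ∧ (∀ t x, e t (c t x) = x) ∧ (∀ t x, c t (e t x) = x) ∧
      ∀ t ∈ Icc a b, ∀ x ∈ U', c t x ∈ U ∧ HasDerivAt (fun s => c s x) (v (t, c t x)) t := by
  obtain ⟨w, O, hw, hwc, hO, hKO, hOΩ, hwv, hw0⟩ := exists_compactlySupported_extension
    (a := a) (b := b) (x₀ := x₀) (isOpen_Ioo.prod hU)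
    (by
      rintro ⟨t, x⟩ ⟨ht, hx⟩
      obtain rfl : x = x₀ := hx
      exact ⟨⟨ha'.trans_le ht.1, ht.2.trans_lt hb'⟩, hx₀⟩) hv
  -- the autonomous field `(1, w)` on space-time
  let V : ℝ × E → ℝ × E := fun p => (1, w p)
  have hV : ContDiff ℝ ∞ V := contDiff_const.prodMk hw
  obtain ⟨K, hK⟩ := ContDiff.lipschitzWith_of_hasCompactSupport hwc hw (by simp)
  obtain ⟨L, hL⟩ := hw.continuous.bounded_above_of_compact_support hwc
  have hVK : LipschitzWith (max 0 K) V := (LipschitzWith.const (1 : ℝ)).prodMk hK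
  have hVL : ∀ p, ‖V p‖ ≤ (max 1 (Real.toNNReal L) : NNReal) := by
    intro p
    rw [Prod.norm_mk, norm_one]
    exact_mod_cast max_le_max le_rfl ((hL p).trans (Real.le_coe_toNNReal L))
  obtain ⟨fl, hfl, hfl0, hfld, hadd⟩ := exists_smooth_flow hV hVK hVL
  have hfst : ∀ t p, (fl t p).1 = p.1 + t := by
    intro t p
    have h0 : ∀ t, HasDerivAt (fun s => (fl s p).1) 1 t := fun t =>
      (ContinuousLinearMap.fst ℝ ℝ E).hasFDerivAt.comp_hasDerivAt t (hfld p t)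
    have h1 : ∀ t, HasDerivAt (fun s => (fl s p).1 - s) (1 - 1) t := fun t =>
      (h0 t).sub (hasDerivAt_id t)
    have h2 := is_const_of_deriv_eq_zero (f := fun s => (fl s p).1 - s)
      (fun t => (h1 t).differentiableAt) (fun t => by rw [(h1 t).deriv, sub_self]) t 0
    simp only [hfl0, sub_zero] at h2
    linarith
  have hfix : ∀ t, fl t (0, x₀) = (t, x₀) := by
    intro t
    refine congrFun (eq_of_hasDerivAt_lipschitz hVK (γ := fun t => fl t (0, x₀))
      (γ' := fun t => (t, x₀)) (hfld _) (fun t => ?_) (t₀ := 0) (hfl0 _)) t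
    have : V (t, x₀) = (1, 0) := by
      refine Prod.ext rfl (hw0 _ ?_)
      by_cases ht : t ∈ Ioo a' b'
      · exact Or.inl (hv0 t ht)
      · exact Or.inr fun h => ht h.1
    rw [this]
    exact (hasDerivAt_id t).prodMk (hasDerivAt_const t x₀)
  have hc : ContDiff ℝ ∞ (fun p : ℝ × E => (fl p.1 (0, p.2)).2) :=
    contDiff_snd.comp (hfl.comp (contDiff_fst.prodMk (contDiff_const.prodMk contDiff_snd)))
  have hcO : IsOpen ((fun p : ℝ × E => (p.1, (fl p.1 (0, p.2)).2)) ⁻¹' O) :=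
    hO.preimage (continuous_fst.prodMk hc.continuous)
  obtain ⟨T, U', hT, hU', hTab, hxU', hTU'⟩ := generalized_tube_lemma
    (isCompact_Icc (a := a) (b := b)) (isCompact_singleton (x := x₀)) hcO (by
      rintro ⟨t, x⟩ ⟨ht, hx⟩
      obtain rfl : x = x₀ := hx
      change (t, (fl t (0, x)).2) ∈ O
      rw [hfix]
      exact hKO ⟨ht, rfl⟩)
  refine ⟨U' ∩ U, fun t x => (fl t (0, x)).2, fun t x => (fl (-t) (t, x)).2, hU'.inter hU,
    ⟨hxU' rfl, hx₀⟩, inter_subset_right, hc, ?_, fun x => by simp [hfl0], fun t => by simp [hfix],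
    ?_, ?_, ?_⟩
  · exact contDiff_snd.comp (hfl.comp (contDiff_fst.neg.prodMk
      (contDiff_fst.prodMk contDiff_snd)))
  · intro t x
    have h1 : fl t (0, x) = (t, (fl t (0, x)).2) := Prod.ext (by rw [hfst, zero_add]) rfl
    dsimp only
    rw [← h1, ← hadd, neg_add_cancel, hfl0]
  · intro t x
    have h1 : fl (-t) (t, x) = (0, (fl (-t) (t, x)).2) := Prod.ext (by rw [hfst]; simp) rfl
    dsimp only
    rw [← h1, ← hadd, add_neg_cancel, hfl0]
  · intro t ht x hx
    have h1 : fl t (0, x) = (t, (fl t (0, x)).2) := Prod.ext (by rw [hfst, zero_add]) rfl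
    have h2 : (t, (fl t (0, x)).2) ∈ O :=
      hTU' (show (t, x) ∈ T ×ˢ U' from ⟨hTab ht, hx.1⟩)
    refine ⟨(hOΩ h2).2, ?_⟩
    rw [← hwv h2, ← h1]
    exact hasFDerivAt_snd.comp_hasDerivAt t (hfld (0, x) t)

end LocalFlow

/-! ### Flows on manifolds near a set of zeros -/

section Charts

variable {E : Type*} [NormedAddCommGroup E] [NormedSpace ℝ E]
  {H : Type*} [TopologicalSpace H] {I : ModelWithCorners ℝ E H}
  {M : Type*} [TopologicalSpace M] [ChartedSpace H M] [IsManifold I ∞ M]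

lemma contMDiffOn_chart (s : M) :
    ContMDiffOn I 𝓘(ℝ, E) ∞ (extChartAt I s) (extChartAt I s).source := by
  rw [extChartAt_source]; exact contMDiffOn_extChartAt

lemma contMDiffOn_chart_symm (s : M) :
    ContMDiffOn 𝓘(ℝ, E) I ∞ (extChartAt I s).symm (extChartAt I s).target :=
  contMDiffOn_extChartAt_symm s

lemma contMDiffAt_chart {s m : M} (hm : m ∈ (extChartAt I s).source) :
    ContMDiffAt I 𝓘(ℝ, E) ∞ (extChartAt I s) m :=
  (contMDiffOn_chart s).contMDiffAt ((isOpen_extChartAt_source s).mem_nhds hm)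

variable [I.Boundaryless]

lemma contMDiffAt_chart_symm {s : M} {x : E} (hx : x ∈ (extChartAt I s).target) :
    ContMDiffAt 𝓘(ℝ, E) I ∞ (extChartAt I s).symm x :=
  (contMDiffOn_chart_symm s).contMDiffAt ((isOpen_extChartAt_target s).mem_nhds hx)

lemma mfderiv_chart_comp_symm {s : M} {x : E} (hx : x ∈ (extChartAt I s).target) :
    (mfderiv I 𝓘(ℝ, E) (extChartAt I s) ((extChartAt I s).symm x)).comp
      (mfderiv 𝓘(ℝ, E) I (extChartAt I s).symm x) = ContinuousLinearMap.id ℝ E := by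
  have h := mfderiv_extChartAt_comp_mfderivWithin_extChartAt_symm (I := I) hx
  rwa [I.range_eq_univ, mfderivWithin_univ] at h

lemma mfderiv_chart_symm_comp {s m : M} (hm : m ∈ (extChartAt I s).source) :
    (mfderiv 𝓘(ℝ, E) I (extChartAt I s).symm (extChartAt I s m)).comp
      (mfderiv I 𝓘(ℝ, E) (extChartAt I s) m) = ContinuousLinearMap.id ℝ (TangentSpace I m) := by
  have h := mfderivWithin_extChartAt_symm_comp_mfderiv_extChartAt' (I := I) hm
  rwa [I.range_eq_univ, mfderivWithin_univ] at h

/-- The differential of a chart, as a linear equivalence. -/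
def chartEquiv {s m : M} (hm : m ∈ (extChartAt I s).source) : TangentSpace I m ≃ₗ[ℝ] E :=
  LinearEquiv.ofLinearMap (mfderiv I 𝓘(ℝ, E) (extChartAt I s) m).toLinearMap
    (mfderiv 𝓘(ℝ, E) I (extChartAt I s).symm (extChartAt I s m)).toLinearMap
    (by
      have h := mfderiv_chart_comp_symm (I := I) ((extChartAt I s).map_source hm)
      rw [(extChartAt I s).left_inv hm] at h
      exact congrArg ContinuousLinearMap.toLinearMap h)
    (congrArg ContinuousLinearMap.toLinearMap (mfderiv_chart_symm_comp hm))

/-- `v` represents the time-dependent vector field `X` in the chart at `s`, over the open part `U`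
of that chart and for times in `J`. -/
structure IsChartField (X : ℝ → ∀ m : M, TangentSpace I m) (J : Set ℝ) (s : M) (U : Set E)
    (v : ℝ × E → E) : Prop where
  isOpen : IsOpen U
  subset_target : U ⊆ (extChartAt I s).target
  contDiffOn : ContDiffOn ℝ ∞ v (J ×ˢ U)
  eq_mfderiv : ∀ t ∈ J, ∀ x ∈ U, X t ((extChartAt I s).symm x) =
    mfderiv 𝓘(ℝ, E) I (extChartAt I s).symm x (v (t, x))

/-- `γ` is an integral curve of `X` at time `t`. -/
def IsCurveAt (X : ℝ → ∀ m : M, TangentSpace I m) (γ : ℝ → M) (t : ℝ) : Prop :=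
  HasMFDerivAt 𝓘(ℝ, ℝ) I γ t ((1 : ℝ →L[ℝ] ℝ).smulRight (X t (γ t)))

lemma IsChartField.hasDerivAt {X : ℝ → ∀ m : M, TangentSpace I m} {J : Set ℝ} {s : M} {U : Set E}
    {v : ℝ × E → E} (h : IsChartField X J s U v) {γ : ℝ → M} {t : ℝ} (ht : t ∈ J)
    (hs : γ t ∈ (extChartAt I s).source) (hU : extChartAt I s (γ t) ∈ U)
    (hγ : IsCurveAt X γ t) :
    HasDerivAt (fun r => extChartAt I s (γ r)) (v (t, extChartAt I s (γ t))) t := by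
  have h1 := ((contMDiffAt_chart hs).mdifferentiableAt (by simp)).hasMFDerivAt.comp t hγ
  have h2 := h.eq_mfderiv t ht _ hU
  have h3 := hasMFDerivAt_iff_hasFDerivAt.1 h1
  have h4 := mfderiv_chart_comp_symm (I := I) (h.subset_target hU)
  have h5 := congrArg (fun A => A (v (t, extChartAt I s (γ t)))) h4
  rw [(extChartAt I s).left_inv hs] at h2 h5
  have h6 : (mfderiv I 𝓘(ℝ, E) (extChartAt I s) (γ t)) (X t (γ t)) =
      v (t, extChartAt I s (γ t)) := by rw [h2]; exact h5
  rw [hasDerivAt_iff_hasFDerivAt]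
  refine h3.congr_fderiv (ContinuousLinearMap.ext fun r => ?_)
  exact (ContinuousLinearMap.map_smul (mfderiv I 𝓘(ℝ, E) (extChartAt I s) (γ t)) r
    (X t (γ t))).trans (congrArg (fun w : E => (show ℝ from r) • w) h6)

lemma IsChartField.isCurveAt {X : ℝ → ∀ m : M, TangentSpace I m} {J : Set ℝ} {s : M} {U : Set E}
    {v : ℝ × E → E} (h : IsChartField X J s U v) {c : ℝ → E} {t : ℝ} (ht : t ∈ J)
    (hU : c t ∈ U) (hc : HasDerivAt c (v (t, c t)) t) :
    IsCurveAt X (fun r => (extChartAt I s).symm (c r)) t := by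
  have h1 := ((contMDiffAt_chart_symm (h.subset_target hU)).mdifferentiableAt
    (by simp)).hasMFDerivAt.comp t (hasMFDerivAt_iff_hasFDerivAt.2 hc.hasFDerivAt)
  unfold IsCurveAt
  rw [h.eq_mfderiv t ht _ hU]
  refine h1.congr_mfderiv ?_
  refine ContinuousLinearMap.ext fun r => ?_
  exact ContinuousLinearMap.map_smul (mfderiv 𝓘(ℝ, E) I (extChartAt I s).symm (c t)) r (v (t, c t))

/-- Local uniqueness of integral curves. -/
lemma IsChartField.eventuallyEq {X : ℝ → ∀ m : M, TangentSpace I m} {J : Set ℝ} (hJ : IsOpen J)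
    {s : M} {U : Set E} {v : ℝ × E → E} (h : IsChartField X J s U v) {γ γ' : ℝ → M} {t₀ : ℝ}
    (ht₀ : t₀ ∈ J) (hs : γ t₀ ∈ (extChartAt I s).source) (hU : extChartAt I s (γ t₀) ∈ U)
    (hγ : ∀ t ∈ J, IsCurveAt X γ t) (hγ' : ∀ t ∈ J, IsCurveAt X γ' t) (h0 : γ t₀ = γ' t₀) :
    γ =ᶠ[𝓝 t₀] γ' := by
  have hv : ContDiffAt ℝ 1 v (t₀, extChartAt I s (γ t₀)) :=
    (h.contDiffOn.contDiffAt ((hJ.prod h.isOpen).mem_nhds ⟨ht₀, hU⟩)).of_le (by simp)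
  obtain ⟨K, O, hO, hK⟩ := hv.exists_lipschitzOnWith
  obtain ⟨A, hA, D, hD, hAD⟩ := mem_nhds_prod_iff.1 hO
  have hlip : ∀ᶠ t in 𝓝 t₀, LipschitzOnWith K (fun x => v (t, x)) D := by
    filter_upwards [hA] with t ht
    refine LipschitzOnWith.of_dist_le_mul fun x hx y hy => ?_
    have := hK.dist_le_mul (t, x) (hAD ⟨ht, hx⟩) (t, y) (hAD ⟨ht, hy⟩)
    rwa [Prod.dist_eq, dist_self, max_eq_right dist_nonneg] at this
  have key : ∀ δ : ℝ → M, (∀ t ∈ J, IsCurveAt X δ t) → γ t₀ = δ t₀ → ∀ᶠ t in 𝓝 t₀,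
      δ t ∈ (extChartAt I s).source ∧
      (HasDerivAt (fun r => extChartAt I s (δ r)) (v (t, extChartAt I s (δ t))) t ∧
      extChartAt I s (δ t) ∈ D) := by
    intro δ hδ h0
    have hc : ContinuousAt δ t₀ := (hδ t₀ ht₀).continuousAt
    have h1 : ∀ᶠ t in 𝓝 t₀, δ t ∈ (extChartAt I s).source :=
      hc.eventually_mem ((isOpen_extChartAt_source s).mem_nhds (h0 ▸ hs))
    have hc2 : ContinuousAt (fun t => extChartAt I s (δ t)) t₀ :=
      (contMDiffAt_chart (h0 ▸ hs)).continuousAt.comp hc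
    filter_upwards [h1, hc2.eventually_mem (h.isOpen.mem_nhds (h0 ▸ hU)),
      hc2.eventually_mem (show D ∈ 𝓝 (extChartAt I s (δ t₀)) from h0 ▸ hD),
      hJ.mem_nhds ht₀] with t h1 h2 h3 h4
    exact ⟨h1, h.hasDerivAt h4 h1 h2 (hδ t h4), h3⟩
  have h1 := key γ hγ rfl
  have h2 := key γ' hγ' h0
  have h3 := ODE_solution_unique_of_eventually (v := fun t x => v (t, x)) (s := fun _ => D) hlip
    (h1.mono fun _ h => h.2) (h2.mono fun _ h => h.2) (by rw [h0])
  filter_upwards [h1, h2, h3] with t h1 h2 h3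
  exact (extChartAt I s).injOn h1.1 h2.1 h3

/-- The time-dependent field `X` is smooth on `W` for times in `J`. -/
def IsSmoothField (X : ℝ → ∀ m : M, TangentSpace I m) (J : Set ℝ) (W : Set M) : Prop :=
  ∀ m ∈ W, ∃ s U v, IsChartField X J s U v ∧ m ∈ (extChartAt I s).source ∧ extChartAt I s m ∈ U

/-- Uniqueness of integral curves of a smooth time-dependent field. -/
lemma IsSmoothField.eqOn [T2Space M] {X : ℝ → ∀ m : M, TangentSpace I m} {a b : ℝ} {W : Set M}
    (h : IsSmoothField X (Ioo a b) W) {γ γ' : ℝ → M} (hW : ∀ t ∈ Ioo a b, γ t ∈ W)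
    (hγ : ∀ t ∈ Ioo a b, IsCurveAt X γ t) (hγ' : ∀ t ∈ Ioo a b, IsCurveAt X γ' t) {t₀ : ℝ}
    (ht₀ : t₀ ∈ Ioo a b) (h0 : γ t₀ = γ' t₀) : EqOn γ γ' (Ioo a b) := by
  have hsub : Ioo a b ⊆ {t | γ =ᶠ[𝓝 t] γ'} := by
    refine isPreconnected_Ioo.subset_of_closure_inter_subset isOpen_setOfPred_eventually_nhds
      ⟨t₀, ht₀, ?_⟩ ?_
    · obtain ⟨s, U, v, hf, hs, hU⟩ := h _ (hW t₀ ht₀)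
      exact hf.eventuallyEq isOpen_Ioo ht₀ hs hU hγ hγ' h0
    · rintro t ⟨htc, ht⟩
      have heq : γ t = γ' t := by
        have h1 : ContinuousAt γ t := (hγ t ht).continuousAt
        have h2 : ContinuousAt γ' t := (hγ' t ht).continuousAt
        by_contra hne
        obtain ⟨A, D, hA, hD, hγA, hγD, hAD⟩ := t2_separation hne
        obtain ⟨r, ⟨hr1, hr2⟩, hr3⟩ := mem_closure_iff_nhds.1 htc _
          (Filter.inter_mem (h1 (hA.mem_nhds hγA)) (h2 (hD.mem_nhds hγD)))
        have hr3' : γ r = γ' r := hr3.self_of_nhds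
        exact disjoint_left.1 hAD hr1 (hr3' ▸ hr2)
      obtain ⟨s, U, v, hf, hs, hU⟩ := h _ (hW t ht)
      exact hf.eventuallyEq isOpen_Ioo ht hs hU hγ hγ' heq
  exact fun t ht => (hsub ht).self_of_nhds

/-- The map `(t, m) ↦ (t, χ t m)` on space-time. -/
def suspension (χ : ℝ → M → M) (p : ℝ × M) : ℝ × M := (p.1, χ p.1 p.2)

/-- Near a zero `s` of a time-dependent vector field its flow exists for times in `(a, b)`. -/
lemma exists_flow_near_zero [FiniteDimensional ℝ E] {X : ℝ → ∀ m : M, TangentSpace I m}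
    {a' a b b' : ℝ} (ha' : a' < a) (hb' : b < b') {W : Set M}
    (hWo : IsOpen W) (hX : IsSmoothField X (Ioo a' b') W) {s : M} (hs : s ∈ W)
    (hs0 : ∀ t ∈ Ioo a' b', X t s = 0) :
    ∃ (N : Set M) (χ : ℝ → M → M), IsOpen N ∧ s ∈ N ∧ (∀ m ∈ N, χ 0 m = m) ∧ (∀ t, χ t s = s) ∧
      (∀ t ∈ Ioo a b, ∀ m ∈ N, χ t m ∈ W ∧ IsCurveAt X (fun r => χ r m) t) ∧
      ∀ p ∈ Ioo a b ×ˢ N, IsLocalDiffeomorphAt (𝓘(ℝ, ℝ).prod I) (𝓘(ℝ, ℝ).prod I) ∞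
        (suspension χ) p := by
  obtain ⟨z, U, v, hf, hsz, hsU⟩ := hX s hs
  set ψ := extChartAt I z with hψ
  have hU₁ : IsOpen (U ∩ (ψ.target ∩ ψ.symm ⁻¹' W)) :=
    hf.isOpen.inter ((contMDiffOn_chart_symm z).continuousOn.isOpen_inter_preimage
      (isOpen_extChartAt_target z) hWo)
  have hf₁ : IsChartField X (Ioo a' b') z (U ∩ (ψ.target ∩ ψ.symm ⁻¹' W)) v :=
    ⟨hU₁, inter_subset_left.trans hf.subset_target,
      hf.contDiffOn.mono (prod_mono le_rfl inter_subset_left),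
      fun t ht x hx => hf.eq_mfderiv t ht x hx.1⟩
  have hv0 : ∀ t ∈ Ioo a' b', v (t, ψ s) = 0 := by
    intro t ht
    have h1 := hf.eq_mfderiv t ht _ hsU
    rw [(extChartAt I z).left_inv hsz, hs0 t ht] at h1
    have h2 := mfderiv_chart_comp_symm (I := I) (hf.subset_target hsU)
    have h3 := congrArg (fun A => A (v (t, ψ s))) h2
    refine Eq.trans (Eq.symm h3) ?_
    refine (congrArg (mfderiv I 𝓘(ℝ, E) ψ (ψ.symm (ψ s))) h1.symm).trans ?_
    exact map_zero (mfderiv I 𝓘(ℝ, E) ψ (ψ.symm (ψ s)))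
  obtain ⟨U', c, e, hU', hsU', hUU', hc, he, hc0, hcfix, hec, hce, hflow⟩ :=
    exists_local_flow ha' hb' hU₁ (x₀ := ψ s)
      ⟨hsU, ψ.map_source hsz, by rw [mem_preimage, ψ.left_inv hsz]; exact hs⟩ hf₁.contDiffOn hv0
  have hUt : U' ⊆ ψ.target := fun x hx => (hUU' hx).2.1
  have hsub : Icc a b ⊇ Ioo a b := Ioo_subset_Icc_self
  refine ⟨ψ.source ∩ ψ ⁻¹' U', fun t m => ψ.symm (c t (ψ m)),
    (contMDiffOn_chart z).continuousOn.isOpen_inter_preimage (isOpen_extChartAt_source z) hU',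
    ⟨hsz, hsU'⟩, fun m hm => ?_, fun t => ?_, fun t ht m hm => ?_, ?_⟩
  · simp only [hc0]; exact ψ.left_inv hm.1
  · simp only [hcfix]; exact ψ.left_inv hsz
  · obtain ⟨h1, h2⟩ := hflow t (hsub ht) _ hm.2
    exact ⟨h1.2.2, hf₁.isCurveAt ⟨ha'.trans ht.1, ht.2.trans hb'⟩ h1 h2⟩
  · have hJ : Ioo a b ⊆ Icc a b := Ioo_subset_Icc_self
    have hsm : ∀ f : ℝ → E → E, ContDiff ℝ ∞ (fun p : ℝ × E => f p.1 p.2) →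
        ContMDiffOn (𝓘(ℝ, ℝ).prod I) 𝓘(ℝ, E) ∞ (fun p : ℝ × M => f p.1 (ψ p.2))
          (univ ×ˢ ψ.source) := by
      intro f hfs
      have h1 : ContMDiffOn (𝓘(ℝ, ℝ).prod I) 𝓘(ℝ, ℝ × E) ∞ (fun p : ℝ × M => (p.1, ψ p.2))
          (univ ×ˢ ψ.source) :=
        contMDiffOn_fst.prodMk_space
          ((contMDiffOn_chart z).comp contMDiffOn_snd fun p hp => hp.2)
      exact hfs.contMDiff.comp_contMDiffOn h1
    let Θ : PartialDiffeomorph (𝓘(ℝ, ℝ).prod I) (𝓘(ℝ, ℝ).prod I) (ℝ × M) (ℝ × M) ∞ :=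
      { toFun := suspension fun t m => ψ.symm (c t (ψ m))
        invFun := fun p => (p.1, ψ.symm (e p.1 (ψ p.2)))
        source := Ioo a b ×ˢ (ψ.source ∩ ψ ⁻¹' U')
        target := (Ioo a b ×ˢ ψ.source) ∩ (fun p : ℝ × M => e p.1 (ψ p.2)) ⁻¹' U'
        map_source' := by
          rintro ⟨t, m⟩ ⟨ht, hm⟩
          have h1 := (hflow t (hJ ht) _ hm.2).1.2.1
          refine ⟨⟨ht, ψ.map_target h1⟩, ?_⟩
          change e t (ψ (ψ.symm (c t (ψ m)))) ∈ U'
          rw [ψ.right_inv h1, hec]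
          exact hm.2
        map_target' := by
          rintro ⟨t, y⟩ ⟨⟨ht, hy⟩, hye⟩
          have h1 : e t (ψ y) ∈ ψ.target := hUt hye
          refine ⟨ht, ψ.map_target h1, ?_⟩
          change ψ (ψ.symm (e t (ψ y))) ∈ U'
          rw [ψ.right_inv h1]
          exact hye
        left_inv' := by
          rintro ⟨t, m⟩ ⟨ht, hm⟩
          have h1 := (hflow t (hJ ht) _ hm.2).1.2.1
          change (t, ψ.symm (e t (ψ (ψ.symm (c t (ψ m)))))) = (t, m)
          rw [ψ.right_inv h1, hec, ψ.left_inv hm.1]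
        right_inv' := by
          rintro ⟨t, y⟩ ⟨⟨ht, hy⟩, hye⟩
          have h1 : e t (ψ y) ∈ ψ.target := hUt hye
          change (t, ψ.symm (c t (ψ (ψ.symm (e t (ψ y)))))) = (t, y)
          rw [ψ.right_inv h1, hce, ψ.left_inv hy]
        open_source := isOpen_Ioo.prod
          ((contMDiffOn_chart z).continuousOn.isOpen_inter_preimage
            (isOpen_extChartAt_source z) hU')
        open_target := by
          refine ContinuousOn.isOpen_inter_preimage ?_
            (isOpen_Ioo.prod (isOpen_extChartAt_source z)) hU'
          exact (hsm e he).continuousOn.mono (prod_mono (subset_univ _) le_rfl)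
        contMDiffOn_toFun := by
          refine contMDiffOn_fst.prodMk ((contMDiffOn_chart_symm z).comp
            ((hsm c hc).mono (prod_mono (subset_univ _) inter_subset_left)) ?_)
          rintro ⟨t, m⟩ ⟨ht, hm⟩
          exact (hflow t (hJ ht) _ hm.2).1.2.1
        contMDiffOn_invFun := by
          refine contMDiffOn_fst.prodMk ((contMDiffOn_chart_symm z).comp
            ((hsm e he).mono fun p hp => ⟨trivial, hp.1.2⟩) ?_)
          rintro ⟨t, y⟩ ⟨⟨ht, hy⟩, hye⟩
          exact hUt hye }
    exact fun p hp => ⟨Θ, hp, fun _ _ => rfl⟩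

/-- The flow of a smooth time-dependent vector field which vanishes on `S`, on a neighbourhood of
`S`. The local flows fit together by uniqueness of integral curves. -/
theorem exists_flow_near [FiniteDimensional ℝ E] [T2Space M]
    {X : ℝ → ∀ m : M, TangentSpace I m} {a' a b b' : ℝ} (ha' : a' < a) (hb' : b < b')
    (ha : a < 0) (hb : 0 < b) {W : Set M} (hWo : IsOpen W)
    (hX : IsSmoothField X (Ioo a' b') W) {S : Set M} (hS : S ⊆ W)
    (hS0 : ∀ t ∈ Ioo a' b', ∀ s ∈ S, X t s = 0) :
    ∃ (N : Set M) (χ : ℝ → M → M), IsOpen N ∧ S ⊆ N ∧ (∀ m ∈ N, χ 0 m = m) ∧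
      (∀ t ∈ Ioo a b, ∀ s ∈ S, χ t s = s) ∧
      (∀ t ∈ Ioo a b, ∀ m ∈ N, χ t m ∈ W ∧ IsCurveAt X (fun r => χ r m) t) ∧
      (∀ t ∈ Ioo a b, InjOn (χ t) N) ∧
      ∀ p ∈ Ioo a b ×ˢ N, IsLocalDiffeomorphAt (𝓘(ℝ, ℝ).prod I) (𝓘(ℝ, ℝ).prod I) ∞
        (suspension χ) p := by
  have h0 : (0 : ℝ) ∈ Ioo a b := ⟨ha, hb⟩
  have hXab : IsSmoothField X (Ioo a b) W := by
    intro m hm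
    obtain ⟨s, U, v, hf, h1, h2⟩ := hX m hm
    have hsub : Ioo a b ⊆ Ioo a' b' := Ioo_subset_Ioo ha'.le hb'.le
    exact ⟨s, U, v, ⟨hf.isOpen, hf.subset_target, hf.contDiffOn.mono (prod_mono hsub le_rfl),
      fun t ht => hf.eq_mfderiv t (hsub ht)⟩, h1, h2⟩
  choose! N χ hN hsN hχ0 hχfix hχ hdiff using fun s (hs : s ∈ S) =>
    exists_flow_near_zero ha' hb' hWo hX (hS hs) fun t ht => hS0 t ht s hs
  -- two local flows agree where both are defined
  have hagree : ∀ s ∈ S, ∀ s' ∈ S, ∀ m ∈ N s, m ∈ N s' → ∀ t ∈ Ioo a b, χ s t m = χ s' t m := by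
    intro s hs s' hs' m hm hm' t ht
    exact hXab.eqOn (γ := fun t => χ s t m) (γ' := fun t => χ s' t m)
      (fun t ht => (hχ s hs t ht m hm).1) (fun t ht => (hχ s hs t ht m hm).2)
      (fun t ht => (hχ s' hs' t ht m hm').2) h0 (by rw [hχ0 s hs m hm, hχ0 s' hs' m hm']) ht
  classical
  let idx : M → M := fun m => if h : ∃ s ∈ S, m ∈ N s then h.choose else m
  have hidx : ∀ s ∈ S, ∀ m ∈ N s, idx m ∈ S ∧ m ∈ N (idx m) := by
    intro s hs m hm
    have h : ∃ s ∈ S, m ∈ N s := ⟨s, hs, hm⟩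
    simp only [idx, dif_pos h]
    exact h.choose_spec
  have heq : ∀ s ∈ S, ∀ m ∈ N s, ∀ t ∈ Ioo a b, χ (idx m) t m = χ s t m := fun s hs m hm t ht =>
    hagree _ (hidx s hs m hm).1 s hs m (hidx s hs m hm).2 hm t ht
  have hcurve : ∀ s ∈ S, ∀ m ∈ N s, ∀ t ∈ Ioo a b, χ (idx m) t m ∈ W ∧
      IsCurveAt X (fun r => χ (idx m) r m) t := fun s hs m hm t ht =>
    hχ _ (hidx s hs m hm).1 t ht m (hidx s hs m hm).2
  refine ⟨⋃ s ∈ S, N s, fun t m => χ (idx m) t m, isOpen_biUnion hN,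
    fun s hs => mem_biUnion hs (hsN s hs), ?_, ?_, ?_, ?_, ?_⟩
  · intro m hm
    obtain ⟨s, hs, hm⟩ := mem_iUnion₂.1 hm
    exact hχ0 _ (hidx s hs m hm).1 m (hidx s hs m hm).2
  · intro t ht s hs
    exact (heq s hs s (hsN s hs) t ht).trans (hχfix s hs t)
  · intro t ht m hm
    obtain ⟨s, hs, hm⟩ := mem_iUnion₂.1 hm
    exact hcurve s hs m hm t ht
  · intro t ht m hm m' hm' hmm'
    obtain ⟨s, hs, hm⟩ := mem_iUnion₂.1 hm
    obtain ⟨s', hs', hm'⟩ := mem_iUnion₂.1 hm'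
    have h1 := hXab.eqOn (γ := fun t => χ (idx m) t m) (γ' := fun t => χ (idx m') t m')
      (fun t ht => (hcurve s hs m hm t ht).1) (fun t ht => (hcurve s hs m hm t ht).2)
      (fun t ht => (hcurve s' hs' m' hm' t ht).2) ht hmm' h0
    dsimp only at h1
    rwa [hχ0 _ (hidx s hs m hm).1 m (hidx s hs m hm).2,
      hχ0 _ (hidx s' hs' m' hm').1 m' (hidx s' hs' m' hm').2] at h1
  · rintro p ⟨ht, hm⟩
    obtain ⟨s, hs, hm⟩ := mem_iUnion₂.1 hm
    obtain ⟨Θ, hp, hΘ⟩ := hdiff s hs p ⟨ht, hm⟩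
    have hopen : IsOpen (Ioo a b ×ˢ N s) := isOpen_Ioo.prod (hN s hs)
    have heqOn : EqOn (suspension fun t m => χ (idx m) t m) (suspension (χ s))
        (Ioo a b ×ˢ N s) := fun q hq => Prod.ext rfl (heq s hs q.2 hq.2 q.1 hq.1)
    -- restrict the local diffeomorphism to the open set where both maps agree
    refine ⟨{ toFun := Θ
              invFun := Θ.invFun
              source := Θ.source ∩ Ioo a b ×ˢ N s
              target := Θ.target ∩ Θ.invFun ⁻¹' (Ioo a b ×ˢ N s)
              map_source' := fun q hq => ⟨Θ.map_source' hq.1, by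
                rw [mem_preimage, Θ.left_inv' hq.1]; exact hq.2⟩
              map_target' := fun q hq => ⟨Θ.map_target' hq.1, hq.2⟩
              left_inv' := fun q hq => Θ.left_inv' hq.1
              right_inv' := fun q hq => Θ.right_inv' hq.1
              open_source := Θ.open_source.inter hopen
              open_target := Θ.contMDiffOn_invFun.continuousOn.isOpen_inter_preimage
                Θ.open_target hopen
              contMDiffOn_toFun := Θ.contMDiffOn_toFun.mono inter_subset_left
              contMDiffOn_invFun := Θ.contMDiffOn_invFun.mono inter_subset_left }, ⟨hp, ht, hm⟩, ?_⟩
    exact fun q hq => (heqOn hq.2).trans (hΘ hq.1)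

end Charts

/-! ### Isotopies generated by time-dependent vector fields -/

section Isotopy

variable {E : Type*} [NormedAddCommGroup E] [NormedSpace ℝ E]
  {H : Type*} [TopologicalSpace H] {I : ModelWithCorners ℝ E H}
  {M : Type*} [TopologicalSpace M] [ChartedSpace H M] [IsManifold I ∞ M]

/-- The representative in a chart of a smooth time-dependent vector field is smooth. -/
lemma contDiffOn_chartField {Z : ℝ → ∀ m : M, TangentSpace I m} {T : Set ℝ} {W : Set M}
    (hZ : ContMDiffOn (𝓘(ℝ, ℝ).prod I) I.tangent ∞
      (fun p : ℝ × M => (⟨p.2, Z p.1 p.2⟩ : TangentBundle I M)) (T ×ˢ W)) (s : M) :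
    ContDiffOn ℝ ∞ (fun p : ℝ × E =>
      (mfderiv I 𝓘(ℝ, E) (extChartAt I s) ((extChartAt I s).symm p.2)
        (Z p.1 ((extChartAt I s).symm p.2)) : E))
      (T ×ˢ ((extChartAt I s).target ∩ (extChartAt I s).symm ⁻¹' W)) := by
  have h1 : ContMDiffOn 𝓘(ℝ, ℝ × E) (𝓘(ℝ, ℝ).prod I) ∞
      (fun p : ℝ × E => (p.1, (extChartAt I s).symm p.2))
      (T ×ˢ ((extChartAt I s).target ∩ (extChartAt I s).symm ⁻¹' W)) :=
    contDiff_fst.contMDiff.contMDiffOn.prodMk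
      ((contMDiffOn_chart_symm s).comp contDiff_snd.contMDiff.contMDiffOn fun p hp => hp.2.1)
  have h2 := hZ.comp h1 fun p hp => ⟨hp.1, hp.2.2⟩
  have h3 := (contMDiffOn_chart (I := I) s).contMDiffOn_tangentMapWithin (m := ∞) (by simp)
    (isOpen_extChartAt_source s).uniqueMDiffOn
  have h4 := (contMDiff_snd_tangentBundle_modelSpace (n := ∞) E 𝓘(ℝ, E)).comp_contMDiffOn
    (h3.comp h2 fun p hp => (extChartAt I s).map_target hp.2.1)
  refine h4.contDiffOn.congr fun p hp => ?_
  have h5 := mfderivWithin_of_isOpen (I := I) (I' := 𝓘(ℝ, E)) (f := extChartAt I s)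
    (isOpen_extChartAt_source s) ((extChartAt I s).map_target hp.2.1)
  exact congrArg (fun A => A (Z p.1 ((extChartAt I s).symm p.2))) h5.symm

variable [I.Boundaryless]

/-- A smooth time-dependent vector field on `[0, 1]`, reparametrized in time so as to vanish
outside `[0, 1]`. -/
def reparam (Z : ℝ → ∀ m : M, TangentSpace I m) (t : ℝ) (m : M) : TangentSpace I m :=
  deriv Real.smoothTransition t • Z (Real.smoothTransition t) m

lemma smoothTransition_mem (t : ℝ) : Real.smoothTransition t ∈ Icc (0 : ℝ) 1 :=
  ⟨Real.smoothTransition.nonneg t, Real.smoothTransition.le_one t⟩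

lemma isSmoothField_reparam {Z : ℝ → ∀ m : M, TangentSpace I m} {W : Set M} (hW : IsOpen W)
    (hZ : ContMDiffOn (𝓘(ℝ, ℝ).prod I) I.tangent ∞
      (fun p : ℝ × M => (⟨p.2, Z p.1 p.2⟩ : TangentBundle I M)) (Icc (0 : ℝ) 1 ×ˢ W))
    (J : Set ℝ) : IsSmoothField (reparam Z) J W := by
  intro m hm
  have hτ : ContDiff ℝ ∞ Real.smoothTransition := Real.smoothTransition.contDiff
  refine ⟨m, (extChartAt I m).target ∩ (extChartAt I m).symm ⁻¹' W, fun p =>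
    deriv Real.smoothTransition p.1 •
      (mfderiv I 𝓘(ℝ, E) (extChartAt I m) ((extChartAt I m).symm p.2)
        (Z (Real.smoothTransition p.1) ((extChartAt I m).symm p.2)) : E),
    ⟨(contMDiffOn_chart_symm m).continuousOn.isOpen_inter_preimage (isOpen_extChartAt_target m) hW,
      inter_subset_left, ?_, ?_⟩, mem_extChartAt_source m, mem_extChartAt_target m, ?_⟩
  · have h1 : ContDiff ℝ ∞ (deriv Real.smoothTransition) :=
      (contDiff_infty_iff_deriv.1 hτ).2
    refine (h1.comp contDiff_fst).contDiffOn.smul ?_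
    exact (contDiffOn_chartField hZ m).comp
      ((hτ.comp contDiff_fst).prodMk contDiff_snd).contDiffOn
      fun p hp => ⟨smoothTransition_mem _, hp.2⟩
  · intro t _ x hx
    have h1 : x ∈ (extChartAt I m).target := hx.1
    have h2 := mfderiv_chart_symm_comp (I := I) ((extChartAt I m).map_target h1)
    rw [(extChartAt I m).right_inv h1] at h2
    have h3 := congrArg (fun A => A (Z (Real.smoothTransition t) ((extChartAt I m).symm x))) h2
    refine Eq.trans ?_ (ContinuousLinearMap.map_smul
      (mfderiv 𝓘(ℝ, E) I (extChartAt I m).symm x) _ _).symm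
    exact congrArg (fun w : E => deriv Real.smoothTransition t • w) h3.symm
  · rw [mem_preimage, (extChartAt I m).left_inv (mem_extChartAt_source m)]
    exact hm

/-- A germ of a diffeomorphism which is joined with the identity by a flow on `[0, 1]` is joined
with the identity by a smooth family of injective local diffeomorphisms on an open interval. -/
theorem exists_isotopy [FiniteDimensional ℝ E] [T2Space M] {S W : Set M}
    {Z : ℝ → ∀ m : M, TangentSpace I m} {φ : M → M} (hW : IsOpen W) (hSW : S ⊆ W)
    (h : FlowJoinsIdTo I S W Z φ) {a b : ℝ} (ha : a < 0) (hb : 1 < b) :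
    ∃ (N : Set M) (Φ : ℝ → M → M), IsOpen N ∧ S ⊆ N ∧ (∀ m ∈ N, Φ 0 m = m) ∧
      (∀ m ∈ N, Φ 1 m = φ m) ∧ (∀ t ∈ Ioo a b, ∀ s ∈ S, Φ t s = s) ∧
      (∀ t ∈ Ioo a b, InjOn (Φ t) N) ∧
      ∀ p ∈ Ioo a b ×ˢ N, IsLocalDiffeomorphAt (𝓘(ℝ, ℝ).prod I) (𝓘(ℝ, ℝ).prod I) ∞
        (suspension Φ) p := by
  obtain ⟨hZ, hZ0, N₂, Φ₂, hN₂, hSN₂, -, hΦ₂⟩ := h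
  have hX := isSmoothField_reparam hW hZ (Ioo (a - 1) (b + 1))
  obtain ⟨N, Φ, hN, hSN, h0, hfix, hcurve, hinj, hdiff⟩ := exists_flow_near
    (sub_one_lt a) (lt_add_one b) ha (zero_lt_one.trans hb) hW hX hSW
    (fun t _ s hs => by
      rw [reparam, hZ0 _ (smoothTransition_mem t) s hs, smul_zero])
  refine ⟨N ∩ N₂, Φ, hN.inter hN₂, subset_inter hSN hSN₂, fun m hm => h0 m hm.1, ?_, hfix,
    fun t ht => (hinj t ht).mono inter_subset_left, fun p hp => hdiff p ⟨hp.1, hp.2.1⟩⟩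
  intro m hm
  have hcurve₂ : ∀ t, IsCurveAt (reparam Z) (fun r => Φ₂ (Real.smoothTransition r) m) t := by
    intro t
    have h1 := ((hΦ₂ m hm.2).2.2 _ (smoothTransition_mem t)).2
    have hτ : HasDerivAt Real.smoothTransition (deriv Real.smoothTransition t) t :=
      ((Real.smoothTransition.contDiff (n := 1)).differentiable (by simp) t).hasDerivAt
    have h2 := h1.comp (s := univ) t
      (hasMFDerivAt_iff_hasFDerivAt.2 hτ.hasFDerivAt).hasMFDerivWithinAt
      (fun r _ => smoothTransition_mem r)
    rw [hasMFDerivWithinAt_univ] at h2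
    refine h2.congr_mfderiv (ContinuousLinearMap.ext fun r => ?_)
    exact mul_smul (show ℝ from r) (deriv Real.smoothTransition t)
      (Z (Real.smoothTransition t) (Φ₂ (Real.smoothTransition t) m))
  have h01 : (1 : ℝ) ∈ Ioo a b := ⟨by linarith, hb⟩
  have := (isSmoothField_reparam hW hZ (Ioo a b)).eqOn (γ := fun t => Φ t m)
    (γ' := fun t => Φ₂ (Real.smoothTransition t) m)
    (fun t ht => (hcurve t ht m hm.1).1) (fun t ht => (hcurve t ht m hm.1).2)
    (fun t _ => hcurve₂ t) (t₀ := 0) ⟨ha, by linarith⟩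
    (by simp only [Real.smoothTransition.zero]; rw [h0 m hm.1, (hΦ₂ m hm.2).1]) h01
  simp only [Real.smoothTransition.one] at this
  rw [this, (hΦ₂ m hm.2).2.1]

end Isotopy

/-! ### Linear algebra of skew maps and adapted covectors -/

section LinearAlgebra

variable {T C : Type*} [AddCommGroup T] [Module ℝ T] [AddCommGroup C] [Module ℝ C]

/-- `α'` is the covector which agrees with `α` on `ker L` and whose image under the bivector `P`
lies in `ker L`. -/
def IsAdapted (P : Module.Dual ℝ T →ₗ[ℝ] T) (L : T →ₗ[ℝ] C) (α α' : Module.Dual ℝ T) : Prop :=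
  (∀ v, L v = 0 → α' v = α v) ∧ L (P α') = 0

/-- The fibres of a map with differential `L` are transversal to the bivector `P`: the induced
bivector on the base is nondegenerate. -/
def IsTransverse (P : Module.Dual ℝ T →ₗ[ℝ] T) (L : T →ₗ[ℝ] C) : Prop :=
  Function.Bijective (L ∘ₗ P ∘ₗ L.dualMap)

lemma apply_sharp_comm {P : Module.Dual ℝ T →ₗ[ℝ] T} (hP : ∀ α : Module.Dual ℝ T, α (P α) = 0)
    (α β : Module.Dual ℝ T) : α (P β) = -β (P α) := by
  have h := hP (α + β)
  simp only [map_add, LinearMap.add_apply, hP, zero_add, add_zero] at h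
  linarith

lemma mem_map_dualAnnihilator_ker [FiniteDimensional ℝ T] {P : Module.Dual ℝ T →ₗ[ℝ] T}
    {L : T →ₗ[ℝ] C} {v : T} :
    v ∈ (LinearMap.ker L).dualAnnihilator.map P ↔ ∃ c : Module.Dual ℝ C, P (L.dualMap c) = v := by
  rw [← LinearMap.range_dualMap_eq_dualAnnihilator_ker]
  simp

lemma IsTransverse.isCompl [FiniteDimensional ℝ T] {P : Module.Dual ℝ T →ₗ[ℝ] T}
    {L : T →ₗ[ℝ] C} (h : IsTransverse P L) :
    IsCompl (LinearMap.ker L) ((LinearMap.ker L).dualAnnihilator.map P) := by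
  constructor
  · rw [Submodule.disjoint_def]
    intro v hv hv'
    obtain ⟨c, rfl⟩ := mem_map_dualAnnihilator_ker.1 hv'
    have : c = 0 := h.1 (by simpa using hv)
    simp [this]
  · rw [codisjoint_iff, eq_top_iff]
    intro v _
    obtain ⟨c, hc⟩ := h.2 (L v)
    refine Submodule.mem_sup.2 ⟨v - P (L.dualMap c), ?_, P (L.dualMap c),
      mem_map_dualAnnihilator_ker.2 ⟨c, rfl⟩, sub_add_cancel _ _⟩
    have hc' : L (P (L.dualMap c)) = L v := hc
    rw [LinearMap.mem_ker, map_sub, hc', sub_self]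

lemma isAdapted_comp_projection [FiniteDimensional ℝ T] {P : Module.Dual ℝ T →ₗ[ℝ] T}
    (hP : ∀ α : Module.Dual ℝ T, α (P α) = 0) {L : T →ₗ[ℝ] C}
    (h : IsCompl (LinearMap.ker L) ((LinearMap.ker L).dualAnnihilator.map P))
    (α : Module.Dual ℝ T) : IsAdapted P L α (α ∘ₗ (LinearMap.ker L).projection _ h) := by
  constructor
  · intro v hv
    rw [LinearMap.comp_apply, (Submodule.projection_apply_of_mem_left h hv)]
  · refine (Module.forall_dual_apply_eq_zero_iff ℝ _).1 fun c => ?_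
    have h1 := apply_sharp_comm hP (L.dualMap c) (α ∘ₗ (LinearMap.ker L).projection _ h)
    rw [LinearMap.dualMap_apply, LinearMap.comp_apply,
      (Submodule.projection_apply_eq_zero_iff h).2 (mem_map_dualAnnihilator_ker.2 ⟨c, rfl⟩),
      map_zero, neg_zero] at h1
    exact h1

/-- If the image of `P` is a section of `L`, then `P` is transversal to the fibres of `L`. -/
lemma isTransverse_of_range_eq [FiniteDimensional ℝ C] {P : Module.Dual ℝ T →ₗ[ℝ] T}
    (hP : ∀ α : Module.Dual ℝ T, α (P α) = 0) {L : T →ₗ[ℝ] C} {ι : C →ₗ[ℝ] T}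
    (hL : L ∘ₗ ι = LinearMap.id)
    (hr : LinearMap.range P = LinearMap.range ι) : IsTransverse P L := by
  have hinj : Function.Injective (L ∘ₗ P ∘ₗ L.dualMap) := by
    rw [← LinearMap.ker_eq_bot, LinearMap.ker_eq_bot']
    intro c hc
    have h0 : P (L.dualMap c) = 0 := by
      obtain ⟨u, hu⟩ : P (L.dualMap c) ∈ LinearMap.range ι := hr ▸ LinearMap.mem_range_self P _
      have h1 : u = 0 := by
        have : (L ∘ₗ ι) u = 0 := by rw [LinearMap.comp_apply, hu]; exact hc
        simpa [hL] using this
      rw [← hu, h1, map_zero]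
    refine LinearMap.ext fun u => ?_
    obtain ⟨β, hβ⟩ : ι u ∈ LinearMap.range P := hr ▸ LinearMap.mem_range_self ι u
    have h2 : L (ι u) = u := congrArg (fun f => f u) hL
    have h3 := apply_sharp_comm hP (L.dualMap c) β
    rw [h0, map_zero, neg_zero, LinearMap.dualMap_apply, hβ, h2] at h3
    simpa using h3
  exact ⟨hinj, (LinearMap.injective_iff_surjective_of_finrank_eq_finrank
    (Subspace.dual_finrank_eq)).1 hinj⟩

/-- Adapted covectors are pulled back to adapted covectors by a linear map intertwining the
bivectors. -/
lemma IsAdapted.of_map {T' : Type*} [AddCommGroup T'] [Module ℝ T']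
    {P : Module.Dual ℝ T →ₗ[ℝ] T} {P' : Module.Dual ℝ T' →ₗ[ℝ] T'} {D : T →ₗ[ℝ] T'}
    (hD : ∀ α, P' α = D (P (α ∘ₗ D))) {L' : T' →ₗ[ℝ] C} {α α' : Module.Dual ℝ T'}
    (h : IsAdapted P' L' α α') : IsAdapted P (L' ∘ₗ D) (α ∘ₗ D) (α' ∘ₗ D) :=
  ⟨fun v hv => h.1 (D v) hv, by rw [LinearMap.comp_apply, ← hD]; exact h.2⟩

end LinearAlgebra

/-! ### The Jacobi identity in a vector space -/

section FlatPoisson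

set_option synthInstance.maxHeartbeats 200000

variable {G C : Type*} [NormedAddCommGroup G] [NormedSpace ℝ G]
  [NormedAddCommGroup C] [NormedSpace ℝ C]

/-- A smooth Poisson tensor on an open subset `O` of a vector space, as the map `T*G → TG`. -/
structure IsFlatPoisson (P : G → (G →L[ℝ] ℝ) →L[ℝ] G) (O : Set G) : Prop where
  isOpen : IsOpen O
  contDiffOn : ContDiffOn ℝ ∞ P O
  apply_self : ∀ x ∈ O, ∀ α : G →L[ℝ] ℝ, α (P x α) = 0
  jacobi : ∀ x ∈ O, ∀ α β γ : G →L[ℝ] ℝ, γ (fderiv ℝ P x (P x α) β) +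
    α (fderiv ℝ P x (P x β) γ) + β (fderiv ℝ P x (P x γ) α) = 0

/-- The differential in the space variables of a map on space-time. -/
def spaceDeriv (p : ℝ × G → C) (q : ℝ × G) : G →L[ℝ] C :=
  fderiv ℝ p q ∘L ContinuousLinearMap.inr ℝ ℝ G

/-- The time derivative of a map on space-time. -/
def timeDeriv (p : ℝ × G → C) (q : ℝ × G) : C := fderiv ℝ p q (1, 0)

lemma hasFDerivAt_space {p : ℝ × G → C} {t : ℝ} {x : G} (h : DifferentiableAt ℝ p (t, x)) :
    HasFDerivAt (fun y => p (t, y)) (spaceDeriv p (t, x)) x :=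
  h.hasFDerivAt.comp x (hasFDerivAt_prodMk_right t x)

lemma hasDerivAt_time {p : ℝ × G → C} {t : ℝ} {x : G} (h : DifferentiableAt ℝ p (t, x)) :
    HasDerivAt (fun s => p (s, x)) (timeDeriv p (t, x)) t := by
  have h1 : HasDerivAt (fun s => p (s, x)) _ t :=
    (h.hasFDerivAt.comp t (hasFDerivAt_prodMk_left t x)).hasDerivAt
  simpa [timeDeriv] using h1

lemma contDiffOn_spaceDeriv {p : ℝ × G → C} {Ω : Set (ℝ × G)} (hΩ : IsOpen Ω)
    (hp : ContDiffOn ℝ ∞ p Ω) : ContDiffOn ℝ ∞ (spaceDeriv p) Ω :=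
  (hp.fderiv_of_isOpen hΩ (m := ∞) (by simp)).clm_comp contDiffOn_const

lemma contDiffOn_timeDeriv {p : ℝ × G → C} {Ω : Set (ℝ × G)} (hΩ : IsOpen Ω)
    (hp : ContDiffOn ℝ ∞ p Ω) : ContDiffOn ℝ ∞ (timeDeriv p) Ω :=
  (hp.fderiv_of_isOpen hΩ (m := ∞) (by simp)).clm_apply contDiffOn_const

/-- The derivative of `y ↦ spaceDeriv p (t, y)` is symmetric. -/
lemma spaceDeriv_spaceDeriv_symm {p : ℝ × G → C} {t : ℝ} {x : G}
    (h : ContDiffAt ℝ ∞ p (t, x)) {D : G →L[ℝ] G →L[ℝ] C}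
    (hD : HasFDerivAt (fun y => spaceDeriv p (t, y)) D x) (u v : G) : D u v = D v u := by
  have h2 : HasFDerivAt (fderiv ℝ p) (fderiv ℝ (fderiv ℝ p) (t, x)) (t, x) :=
    ((h.fderiv_right (m := ∞) (by simp)).differentiableAt (by simp)).hasFDerivAt
  have hsymm : IsSymmSndFDerivAt ℝ p (t, x) := h.isSymmSndFDerivAt (by
    rw [minSmoothness_of_isRCLikeNormedField]; exact ENat.LEInfty.out)
  have key : ∀ u v : G, D u v = fderiv ℝ (fderiv ℝ p) (t, x) (0, u) (0, v) := by
    intro u v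
    have h2x : HasFDerivAt (fun y => fderiv ℝ p (t, y)) _ x :=
      h2.comp x (hasFDerivAt_prodMk_right t x)
    have h3 := h2x.clm_apply (hasFDerivAt_const ((0 : ℝ), v) x)
    have h4 := hD.clm_apply (hasFDerivAt_const v x)
    have h5 := congrArg (fun A => A u) (h4.unique h3)
    simpa using h5
  rw [key, key, hsymm]

/-- The variational equation: if `∂ₜχ = X(t, χ)`, the space differential of `χ` satisfies the
linearized equation. -/
lemma hasDerivAt_spaceDeriv_of_flow {χ : ℝ × G → G} {Y : G → G} {t : ℝ} {x : G}
    (h : ContDiffAt ℝ ∞ χ (t, x)) {D : G →L[ℝ] G} (hY : HasFDerivAt Y D (χ (t, x)))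
    (hflow : ∀ᶠ y in 𝓝 x, timeDeriv χ (t, y) = Y (χ (t, y))) (w : G) :
    HasDerivAt (fun s => spaceDeriv χ (s, x) w) (D (spaceDeriv χ (t, x) w)) t := by
  have h2 : HasFDerivAt (fderiv ℝ χ) (fderiv ℝ (fderiv ℝ χ) (t, x)) (t, x) :=
    ((h.fderiv_right (m := ∞) (by simp)).differentiableAt (by simp)).hasFDerivAt
  have hsymm : IsSymmSndFDerivAt ℝ χ (t, x) := h.isSymmSndFDerivAt (by
    rw [minSmoothness_of_isRCLikeNormedField]; exact ENat.LEInfty.out)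
  have h2t : HasFDerivAt (fun s => fderiv ℝ χ (s, x)) _ t :=
    h2.comp t (hasFDerivAt_prodMk_left t x)
  have h2x : HasFDerivAt (fun y => fderiv ℝ χ (t, y)) _ x :=
    h2.comp x (hasFDerivAt_prodMk_right t x)
  have h3 : HasDerivAt (fun s => fderiv ℝ χ (s, x) (0, w)) _ t :=
    (h2t.clm_apply (hasFDerivAt_const ((0 : ℝ), w) t)).hasDerivAt
  have h4 := h2x.clm_apply (hasFDerivAt_const ((1 : ℝ), (0 : G)) x)
  have h5 : HasFDerivAt (fun y => timeDeriv χ (t, y)) (D ∘L spaceDeriv χ (t, x)) x :=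
    (hY.comp x (hasFDerivAt_space (h.differentiableAt (by simp)))).congr_of_eventuallyEq hflow
  have h6 := congrArg (fun A => A w) (h5.unique h4)
  refine h3.congr_deriv (Eq.trans ?_ h6.symm)
  simpa using hsymm (1, 0) (0, w)

/-- The field `P (c ∘ dp)`, tangent to the symplectic leaves. -/
def leafField (P : G → (G →L[ℝ] ℝ) →L[ℝ] G) (p : ℝ × G → C) (c : ℝ × G → C →L[ℝ] ℝ)
    (q : ℝ × G) : G := P q.2 (c q ∘L spaceDeriv p q)

lemma IsFlatPoisson.apply_comm {P : G → (G →L[ℝ] ℝ) →L[ℝ] G} {O : Set G} (hP : IsFlatPoisson P O)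
    {y : G} (hy : y ∈ O) (ξ η : G →L[ℝ] ℝ) : ξ (P y η) = -η (P y ξ) := by
  have h := hP.apply_self y hy (ξ + η)
  simp only [map_add, add_apply, hP.apply_self y hy, zero_add, add_zero] at h
  linarith

lemma IsFlatPoisson.hasFDerivAt {P : G → (G →L[ℝ] ℝ) →L[ℝ] G} {O : Set G}
    (hP : IsFlatPoisson P O) {x : G} (hx : x ∈ O) : HasFDerivAt P (fderiv ℝ P x) x :=
  ((hP.contDiffOn.contDiffAt (hP.isOpen.mem_nhds hx)).differentiableAt (by simp)).hasFDerivAt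

lemma IsFlatPoisson.fderiv_apply_comm {P : G → (G →L[ℝ] ℝ) →L[ℝ] G} {O : Set G}
    (hP : IsFlatPoisson P O) {x : G} (hx : x ∈ O) (u : G) (ξ η : G →L[ℝ] ℝ) :
    ξ (fderiv ℝ P x u η) = -η (fderiv ℝ P x u ξ) := by
  have h1 : ∀ ξ η : G →L[ℝ] ℝ,
      HasFDerivAt (fun y => ξ (P y η)) (ξ ∘L (fderiv ℝ P x).flip η) x := by
    intro ξ η
    have h2 : HasFDerivAt (fun y => P y η) ((fderiv ℝ P x).flip η) x :=
      ((hP.hasFDerivAt hx).clm_apply (hasFDerivAt_const η x)).congr_fderiv (by ext; simp)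
    exact ξ.hasFDerivAt.comp x h2
  have h2 : HasFDerivAt (fun y => ξ (P y η)) (-(η ∘L (fderiv ℝ P x).flip ξ)) x := by
    refine (h1 η ξ).neg.congr_of_eventuallyEq ?_
    filter_upwards [hP.isOpen.mem_nhds hx] with y hy using hP.apply_comm hy ξ η
  have h3 := congrArg (fun A => A u) ((h1 ξ η).unique h2)
  simpa using h3

/-- The derivative of the leaf field, evaluated on covectors adapted to `p`. -/
lemma apply_fderiv_leafField {P : G → (G →L[ℝ] ℝ) →L[ℝ] G} {O : Set G} (hP : IsFlatPoisson P O)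
    {p : ℝ × G → C} {c : ℝ × G → C →L[ℝ] ℝ} {t : ℝ} {x : G} (hx : x ∈ O)
    (hc : DifferentiableAt ℝ c (t, x)) {DL : G →L[ℝ] G →L[ℝ] C}
    (hDL : HasFDerivAt (fun y => spaceDeriv p (t, y)) DL x) {D : G →L[ℝ] G}
    (hD : HasFDerivAt (fun y => leafField P p c (t, y)) D x) {β : G →L[ℝ] ℝ}
    (hβ : spaceDeriv p (t, x) (P x β) = 0) (u : G) :
    β (D u) = β (fderiv ℝ P x u (c (t, x) ∘L spaceDeriv p (t, x))) -
      c (t, x) (DL u (P x β)) := by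
  have h0 := (hasFDerivAt_space hc).clm_comp hDL
  have h1 := (hP.hasFDerivAt hx).clm_apply h0
  have h2 := congrArg (fun A => A u) (hD.unique h1)
  have h3 : D u = fderiv ℝ P x u (c (t, x) ∘L spaceDeriv p (t, x)) +
      P x (spaceDeriv c (t, x) u ∘L spaceDeriv p (t, x) + c (t, x) ∘L DL u) := by
    refine h2.trans ?_
    simp [add_comm]
  rw [h3, map_add, hP.apply_comm hx]
  simp [hβ, sub_eq_add_neg]

/-- Along the flow of `leafField P p c`, the value of `P` on two adapted covectors whose
restrictions to the kernel of `dp` are transported by the flow is constant. -/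
lemma hasDerivAt_eval_zero {P : G → (G →L[ℝ] ℝ) →L[ℝ] G} {O : Set G} (hP : IsFlatPoisson P O)
    {p : ℝ × G → C} {c : ℝ × G → C →L[ℝ] ℝ} {t : ℝ} {z : ℝ → G} (hz : z t ∈ O)
    (hp : ContDiffAt ℝ ∞ p (t, z t)) (hc : ContDiffAt ℝ ∞ c (t, z t))
    (hzd : HasDerivAt z (leafField P p c (t, z t)) t)
    {α β : ℝ → G →L[ℝ] ℝ} {α' β' : G →L[ℝ] ℝ} (hα : HasDerivAt α α' t) (hβ : HasDerivAt β β' t)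
    {D : G →L[ℝ] G} (hD : HasFDerivAt (fun y => leafField P p c (t, y)) D (z t))
    (hα' : ∀ u, spaceDeriv p (t, z t) u = 0 → α' u = -α t (D u))
    (hβ' : ∀ u, spaceDeriv p (t, z t) u = 0 → β' u = -β t (D u))
    (hαL : spaceDeriv p (t, z t) (P (z t) (α t)) = 0)
    (hβL : spaceDeriv p (t, z t) (P (z t) (β t)) = 0) :
    HasDerivAt (fun s => β s (P (z s) (α s))) 0 t := by
  have hLd : ∃ DL : G →L[ℝ] G →L[ℝ] C, HasFDerivAt (fun y => spaceDeriv p (t, y)) DL (z t) := by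
    have h1 : HasFDerivAt (fderiv ℝ p) (fderiv ℝ (fderiv ℝ p) (t, z t)) (t, z t) :=
      ((hp.fderiv_right (m := ∞) (by simp)).differentiableAt (by simp)).hasFDerivAt
    have h2 : HasFDerivAt (fun y => fderiv ℝ p (t, y)) _ (z t) :=
      h1.comp (z t) (hasFDerivAt_prodMk_right t (z t))
    exact ⟨_, h2.clm_comp (hasFDerivAt_const (ContinuousLinearMap.inr ℝ ℝ G) (z t))⟩
  obtain ⟨DL, hDL⟩ := hLd
  have hDu := apply_fderiv_leafField hP hz (hc.differentiableAt (by simp)) hDL hD hβL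
    (P (z t) (α t))
  have hDv := apply_fderiv_leafField hP hz (hc.differentiableAt (by simp)) hDL hD hαL
    (P (z t) (β t))
  have hjac := hP.jacobi (z t) hz (c (t, z t) ∘L spaceDeriv p (t, z t)) (α t) (β t)
  have hanti := hP.fderiv_apply_comm hz (P (z t) (α t)) (c (t, z t) ∘L spaceDeriv p (t, z t)) (β t)
  have hPz : HasDerivAt (fun s => P (z s)) (fderiv ℝ P (z t) (leafField P p c (t, z t))) t :=
    HasFDerivAt.comp_hasDerivAt (l := P) t (hP.hasFDerivAt hz) hzd
  have hPα : HasDerivAt (fun s => P (z s) (α s))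
      (fderiv ℝ P (z t) (leafField P p c (t, z t)) (α t) + P (z t) α') t := hPz.clm_apply hα
  refine (hβ.clm_apply hPα).congr_deriv ?_
  rw [map_add, hβ' _ hαL, hP.apply_comm hz (β t) α', hα' _ hβL, neg_neg, hDu, hDv,
    spaceDeriv_spaceDeriv_symm hp hDL (P (z t) (β t))]
  unfold leafField
  linarith

end FlatPoisson

/-! ### Transport along a compensating flow in a vector space -/

section FlatFlow

set_option synthInstance.maxHeartbeats 200000

variable {G C : Type*} [NormedAddCommGroup G] [NormedSpace ℝ G]
  [NormedAddCommGroup C] [NormedSpace ℝ C]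

/-- Precomposition with `A`, i.e. the transpose of `A`. -/
def transpose (A : G →L[ℝ] C) : (C →L[ℝ] ℝ) →L[ℝ] (G →L[ℝ] ℝ) :=
  (ContinuousLinearMap.compL ℝ G C ℝ).flip A

@[simp] lemma transpose_apply (A : G →L[ℝ] C) (c : C →L[ℝ] ℝ) : transpose A c = c ∘L A := rfl

/-- The bivector induced by `P` on the target of `p t`, at the point `q = (t, x)`. -/
def inducedBivector (P : G → (G →L[ℝ] ℝ) →L[ℝ] G) (p : ℝ × G → C) (q : ℝ × G) :
    (C →L[ℝ] ℝ) →L[ℝ] C :=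
  spaceDeriv p q ∘L P q.2 ∘L transpose (spaceDeriv p q)

lemma contDiffOn_transpose {p : ℝ × G → C} {Ω : Set (ℝ × G)} (hΩ : IsOpen Ω)
    (hp : ContDiffOn ℝ ∞ p Ω) :
    ContDiffOn ℝ ∞ (fun q : ℝ × G => transpose (spaceDeriv p q)) Ω := by
  have h1 : ContDiff ℝ ∞ (transpose : (G →L[ℝ] C) → _) :=
    ContinuousLinearMap.contDiff (𝕜 := ℝ) (E := G →L[ℝ] C)
      (F := (C →L[ℝ] ℝ) →L[ℝ] (G →L[ℝ] ℝ)) (ContinuousLinearMap.compL ℝ G C ℝ).flip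
  exact h1.comp_contDiffOn (contDiffOn_spaceDeriv hΩ hp)

lemma contDiffOn_inducedBivector {P : G → (G →L[ℝ] ℝ) →L[ℝ] G} {p : ℝ × G → C}
    {Ω : Set (ℝ × G)} (hΩ : IsOpen Ω) (hP : ContDiffOn ℝ ∞ (fun q : ℝ × G => P q.2) Ω)
    (hp : ContDiffOn ℝ ∞ p Ω) : ContDiffOn ℝ ∞ (inducedBivector P p) Ω :=
  (contDiffOn_spaceDeriv hΩ hp).clm_comp (hP.clm_comp (contDiffOn_transpose hΩ hp))

/-- The covector `c` on the target for which `leafField P p c` compensates the motion of `p`. -/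
def compensator (P : G → (G →L[ℝ] ℝ) →L[ℝ] G) (p : ℝ × G → C) (q : ℝ × G) : C →L[ℝ] ℝ :=
  -(inducedBivector P p q).inverse (timeDeriv p q)

/-- The projection onto `ker (dp)` along `P (ann (ker dp))`. -/
def flatConnection (P : G → (G →L[ℝ] ℝ) →L[ℝ] G) (p : ℝ × G → C) (q : ℝ × G) : G →L[ℝ] G :=
  ContinuousLinearMap.id ℝ G - P q.2 ∘L transpose (spaceDeriv p q) ∘L
    (inducedBivector P p q).inverse ∘L spaceDeriv p q

/-- A Poisson tensor `P` and a smooth time-dependent map `p` whose fibres are transversal to `P`,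
both defined on the open subset `Ω` of space-time. -/
structure IsTransverseFamily (P : G → (G →L[ℝ] ℝ) →L[ℝ] G) (p : ℝ × G → C) (Ω : Set (ℝ × G)) :
    Prop where
  isOpen : IsOpen Ω
  isFlatPoisson : ∃ O, IsFlatPoisson P O ∧ ∀ q ∈ Ω, q.2 ∈ O
  contDiffOn : ContDiffOn ℝ ∞ p Ω
  isInvertible : ∀ q ∈ Ω, (inducedBivector P p q).IsInvertible

/-- `χ` is, on `N` and for times in `(a, b)`, the flow of the field that compensates the motion
of `p`. -/
structure IsCompensatingFlow (P : G → (G →L[ℝ] ℝ) →L[ℝ] G) (p : ℝ × G → C) (Ω : Set (ℝ × G))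
    (a b : ℝ) (N : Set G) (χ : ℝ × G → G) : Prop where
  isOpen : IsOpen N
  contDiffOn : ContDiffOn ℝ ∞ χ (Ioo a b ×ˢ N)
  zero : ∀ y ∈ N, χ (0, y) = y
  mem : ∀ t ∈ Ioo a b, ∀ y ∈ N, (t, χ (t, y)) ∈ Ω
  timeDeriv_eq : ∀ t ∈ Ioo a b, ∀ y ∈ N,
    timeDeriv χ (t, y) = leafField P p (compensator P p) (t, χ (t, y))

namespace IsTransverseFamily

variable {P : G → (G →L[ℝ] ℝ) →L[ℝ] G} {p : ℝ × G → C} {Ω : Set (ℝ × G)}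

lemma spaceDeriv_leafField (h : IsTransverseFamily P p Ω) {q : ℝ × G} (hq : q ∈ Ω) :
    spaceDeriv p q (leafField P p (compensator P p) q) = -timeDeriv p q := by
  have h1 := congrArg (fun A => A (timeDeriv p q)) (h.isInvertible q hq).self_comp_inverse
  have h2 : spaceDeriv p q (P q.2 ((inducedBivector P p q).inverse (timeDeriv p q) ∘L
      spaceDeriv p q)) = timeDeriv p q := h1
  rw [leafField, compensator, ContinuousLinearMap.neg_comp, map_neg, map_neg, h2]

lemma contDiffOn_bivector (h : IsTransverseFamily P p Ω) :
    ContDiffOn ℝ ∞ (fun q : ℝ × G => P q.2) Ω := by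
  obtain ⟨O, hO, hΩO⟩ := h.isFlatPoisson
  exact hO.contDiffOn.comp contDiff_snd.contDiffOn hΩO

lemma contDiffOn_inverse [CompleteSpace C] (h : IsTransverseFamily P p Ω) :
    ContDiffOn ℝ ∞ (fun q : ℝ × G => (inducedBivector P p q).inverse) Ω := by
  have h1 := contDiffOn_inducedBivector h.isOpen h.contDiffOn_bivector h.contDiffOn
  intro q hq
  obtain ⟨e, he⟩ := h.isInvertible q hq
  have h2 : ContDiffAt ℝ ∞ ContinuousLinearMap.inverse (inducedBivector P p q) :=
    he ▸ contDiffAt_map_inverse e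
  exact h2.comp_contDiffWithinAt q (h1 q hq)

lemma contDiffOn_compensator [CompleteSpace C] (h : IsTransverseFamily P p Ω) :
    ContDiffOn ℝ ∞ (compensator P p) Ω :=
  (h.contDiffOn_inverse.clm_apply (contDiffOn_timeDeriv h.isOpen h.contDiffOn)).neg

lemma contDiffOn_leafField [CompleteSpace C] (h : IsTransverseFamily P p Ω) :
    ContDiffOn ℝ ∞ (leafField P p (compensator P p)) Ω :=
  h.contDiffOn_bivector.clm_apply
    (h.contDiffOn_compensator.clm_comp (contDiffOn_spaceDeriv h.isOpen h.contDiffOn))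

lemma contDiffOn_flatConnection [CompleteSpace C] (h : IsTransverseFamily P p Ω) :
    ContDiffOn ℝ ∞ (flatConnection P p) Ω :=
  contDiffOn_const.sub (h.contDiffOn_bivector.clm_comp ((contDiffOn_transpose h.isOpen
    h.contDiffOn).clm_comp
    (h.contDiffOn_inverse.clm_comp (contDiffOn_spaceDeriv h.isOpen h.contDiffOn))))

lemma flatConnection_apply_of_mem {q : ℝ × G} {u : G} (hu : spaceDeriv p q u = 0) :
    flatConnection P p q u = u := by
  simp [flatConnection, hu]

lemma spaceDeriv_flatConnection (h : IsTransverseFamily P p Ω) {q : ℝ × G} (hq : q ∈ Ω) (u : G) :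
    spaceDeriv p q (flatConnection P p q u) = 0 := by
  have h1 := congrArg (fun A => A (spaceDeriv p q u)) (h.isInvertible q hq).self_comp_inverse
  have h2 : spaceDeriv p q (P q.2 ((inducedBivector P p q).inverse (spaceDeriv p q u) ∘L
      spaceDeriv p q)) = spaceDeriv p q u := h1
  rw [flatConnection]
  simp only [sub_apply, ContinuousLinearMap.comp_apply, ContinuousLinearMap.id_apply,
    transpose_apply, map_sub, h2, sub_self]

lemma flatConnection_sharp (h : IsTransverseFamily P p Ω) {q : ℝ × G} (hq : q ∈ Ω)
    (c : C →L[ℝ] ℝ) : flatConnection P p q (P q.2 (c ∘L spaceDeriv p q)) = 0 := by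
  have h1 := congrArg (fun A => A c) (h.isInvertible q hq).inverse_comp_self
  have h2 : (inducedBivector P p q).inverse (spaceDeriv p q (P q.2 (c ∘L spaceDeriv p q))) = c :=
    h1
  rw [flatConnection]
  simp only [sub_apply, ContinuousLinearMap.comp_apply, ContinuousLinearMap.id_apply,
    transpose_apply, h2, sub_self]

/-- A covector composed with the connection is adapted. -/
lemma spaceDeriv_sharp_comp_flatConnection (h : IsTransverseFamily P p Ω)
    {q : ℝ × G} (hq : q ∈ Ω) (α : G →L[ℝ] ℝ) :
    spaceDeriv p q (P q.2 (α ∘L flatConnection P p q)) = 0 := by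
  obtain ⟨O, hO, hΩO⟩ := h.isFlatPoisson
  refine SeparatingDual.eq_zero_of_forall_dual_eq_zero (R := ℝ) fun c => ?_
  have h1 := hO.apply_comm (hΩO q hq) (c ∘L spaceDeriv p q) (α ∘L flatConnection P p q)
  rw [ContinuousLinearMap.comp_apply, ContinuousLinearMap.comp_apply, h.flatConnection_sharp hq,
    map_zero, neg_zero] at h1
  exact h1

/-- An adapted covector does not change under composition with the connection, and only depends on
its restriction to `ker (dp)`. -/
lemma comp_flatConnection_eq (h : IsTransverseFamily P p Ω) {q : ℝ × G} (hq : q ∈ Ω)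
    {α α' : G →L[ℝ] ℝ} (hα : ∀ u, spaceDeriv p q u = 0 → α' u = α u)
    (hα' : spaceDeriv p q (P q.2 α') = 0) : α ∘L flatConnection P p q = α' := by
  obtain ⟨O, hO, hΩO⟩ := h.isFlatPoisson
  ext u
  rw [ContinuousLinearMap.comp_apply, ← hα _ (h.spaceDeriv_flatConnection hq u), flatConnection]
  have h1 := hO.apply_comm (hΩO q hq) α'
    ((inducedBivector P p q).inverse (spaceDeriv p q u) ∘L spaceDeriv p q)
  rw [ContinuousLinearMap.comp_apply, hα', map_zero, neg_zero] at h1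
  simp only [sub_apply, ContinuousLinearMap.comp_apply, ContinuousLinearMap.id_apply,
    transpose_apply, map_sub, h1, sub_zero]

/-- The compensating field is chosen so that its flow freezes the family `p`. -/
lemma apply_flow_eq (h : IsTransverseFamily P p Ω) {a b : ℝ} (ha : a < 0) (hb : 0 < b) {z : ℝ → G}
    (hΩ : ∀ t ∈ Ioo a b, (t, z t) ∈ Ω)
    (hz : ∀ t ∈ Ioo a b, HasDerivAt z (leafField P p (compensator P p) (t, z t)) t)
    {t : ℝ} (ht : t ∈ Ioo a b) : p (t, z t) = p (0, z 0) := by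
  have h1 : ∀ t ∈ Ioo a b, HasDerivAt (fun s => p (s, z s)) 0 t := by
    intro t ht
    have hd : DifferentiableAt ℝ p (t, z t) := (h.contDiffOn.contDiffAt
      (h.isOpen.mem_nhds (hΩ t ht))).differentiableAt (by simp)
    have h2 : HasDerivAt (fun s => p (s, z s)) _ t :=
      HasFDerivAt.comp_hasDerivAt (l := p) t hd.hasFDerivAt ((hasDerivAt_id t).prodMk (hz t ht))
    refine h2.congr_deriv ?_
    have h3 := h.spaceDeriv_leafField (hΩ t ht)
    have h4 : ((1 : ℝ), leafField P p (compensator P p) (t, z t)) =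
      (1, 0) + (0, leafField P p (compensator P p) (t, z t)) := by simp
    rw [h4, map_add]
    have h5 : fderiv ℝ p (t, z t) (0, leafField P p (compensator P p) (t, z t)) =
      -timeDeriv p (t, z t) := h3
    rw [h5, timeDeriv, add_neg_cancel]
  exact isOpen_Ioo.is_const_of_deriv_eq_zero isPreconnected_Ioo
    (fun t ht => (h1 t ht).differentiableAt.differentiableWithinAt)
    (fun t ht => (h1 t ht).deriv) ht ⟨ha, hb⟩

variable {a b : ℝ} {N : Set G} {χ : ℝ × G → G}

lemma hasDerivAt_flow (hχ : IsCompensatingFlow P p Ω a b N χ) {t : ℝ} (ht : t ∈ Ioo a b) {y : G}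
    (hy : y ∈ N) :
    HasDerivAt (fun s => χ (s, y)) (leafField P p (compensator P p) (t, χ (t, y))) t := by
  rw [← hχ.timeDeriv_eq t ht y hy]
  exact hasDerivAt_time ((hχ.contDiffOn.contDiffAt
    ((isOpen_Ioo.prod hχ.isOpen).mem_nhds ⟨ht, hy⟩)).differentiableAt (by simp))

lemma apply_compensatingFlow_eq (h : IsTransverseFamily P p Ω) (ha : a < 0) (hb : 0 < b)
    (hχ : IsCompensatingFlow P p Ω a b N χ) {t : ℝ} (ht : t ∈ Ioo a b) {y : G} (hy : y ∈ N) :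
    p (t, χ (t, y)) = p (0, y) := by
  have := h.apply_flow_eq ha hb (fun t ht => hχ.mem t ht y hy)
    (fun t ht => hasDerivAt_flow hχ ht hy) ht
  rwa [hχ.zero y hy] at this

/-- `p t` composed with the flow is constant in time, hence so is its space differential. -/
lemma spaceDeriv_compensatingFlow (h : IsTransverseFamily P p Ω) (ha : a < 0) (hb : 0 < b)
    (hχ : IsCompensatingFlow P p Ω a b N χ) {t : ℝ} (ht : t ∈ Ioo a b) {x : G} (hx : x ∈ N)
    (w : G) :
    spaceDeriv p (t, χ (t, x)) (spaceDeriv χ (t, x) w) = spaceDeriv p (0, x) w := by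
  have hχat : ContDiffAt ℝ ∞ χ (t, x) :=
    hχ.contDiffOn.contDiffAt ((isOpen_Ioo.prod hχ.isOpen).mem_nhds ⟨ht, hx⟩)
  have hpat : ∀ t ∈ Ioo a b, ContDiffAt ℝ ∞ p (t, χ (t, x)) := fun t ht =>
    h.contDiffOn.contDiffAt (h.isOpen.mem_nhds (hχ.mem t ht x hx))
  have h1 : HasFDerivAt (fun y => p (t, χ (t, y)))
      (spaceDeriv p (t, χ (t, x)) ∘L spaceDeriv χ (t, x)) x :=
    HasFDerivAt.comp (g := fun y => p (t, y)) x
      (hasFDerivAt_space ((hpat t ht).differentiableAt (by simp)))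
      (hasFDerivAt_space (hχat.differentiableAt (by simp)))
  have h2 : HasFDerivAt (fun y => p (0, y)) (spaceDeriv p (0, x)) x := by
    have := hpat 0 ⟨ha, hb⟩
    rw [hχ.zero x hx] at this
    exact hasFDerivAt_space (this.differentiableAt (by simp))
  have h3 : (fun y => p (t, χ (t, y))) =ᶠ[𝓝 x] fun y => p (0, y) := by
    filter_upwards [hχ.isOpen.mem_nhds hx] with y hy
    exact h.apply_compensatingFlow_eq ha hb hχ ht hy
  exact congrArg (fun A => A w) (h1.unique (h2.congr_of_eventuallyEq h3))

variable [FiniteDimensional ℝ G] [FiniteDimensional ℝ C]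

/-- The value of `P` on adapted covectors is transported by the flow of the compensating field.
The covectors `α₀`, `α₁` are adapted to `p 0`, `p 1` and have restrictions to the kernels of the
differentials that correspond under the flow. -/
theorem eval_flow_eq (h : IsTransverseFamily P p Ω) (ha : a < 0) (hb : 1 < b)
    (hχ : IsCompensatingFlow P p Ω a b N χ)
    {x : G} (hx : x ∈ N) (hinj : ∀ t ∈ Ioo a b, Function.Injective (spaceDeriv χ (t, x)))
    {α₀ α₁ β₀ β₁ : G →L[ℝ] ℝ}
    (hα : ∀ u, spaceDeriv p (0, x) u = 0 → α₀ u = α₁ (spaceDeriv χ (1, x) u))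
    (hβ : ∀ u, spaceDeriv p (0, x) u = 0 → β₀ u = β₁ (spaceDeriv χ (1, x) u))
    (hα₀ : spaceDeriv p (0, x) (P x α₀) = 0) (hβ₀ : spaceDeriv p (0, x) (P x β₀) = 0)
    (hα₁ : spaceDeriv p (1, χ (1, x)) (P (χ (1, x)) α₁) = 0)
    (hβ₁ : spaceDeriv p (1, χ (1, x)) (P (χ (1, x)) β₁) = 0) :
    β₁ (P (χ (1, x)) α₁) = β₀ (P x α₀) := by
  have h0ab : (0 : ℝ) ∈ Ioo a b := ⟨ha, by linarith⟩
  have h1ab : (1 : ℝ) ∈ Ioo a b := ⟨by linarith, hb⟩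
  have hχat : ∀ t ∈ Ioo a b, ContDiffAt ℝ ∞ χ (t, x) := fun t ht =>
    hχ.contDiffOn.contDiffAt ((isOpen_Ioo.prod hχ.isOpen).mem_nhds ⟨ht, hx⟩)
  have hLA : ∀ t ∈ Ioo a b, ∀ w, spaceDeriv p (t, χ (t, x)) (spaceDeriv χ (t, x) w) =
      spaceDeriv p (0, x) w := fun t ht w =>
    h.spaceDeriv_compensatingFlow ha (zero_lt_one.trans hb) hχ ht hx w
  have hAinv : ∀ t ∈ Ioo a b, (spaceDeriv χ (t, x)).IsInvertible := by
    intro t ht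
    refine ⟨(LinearEquiv.ofInjectiveEndo (spaceDeriv χ (t, x)).toLinearMap
      (hinj t ht)).toContinuousLinearEquiv, ?_⟩
    ext u; rfl
  have hAd : DifferentiableOn ℝ (fun t => spaceDeriv χ (t, x)) (Ioo a b) := by
    have h1 := (contDiffOn_spaceDeriv (isOpen_Ioo.prod hχ.isOpen) hχ.contDiffOn).comp (s := Ioo a b)
      (f := fun t : ℝ => (t, x)) (by fun_prop) (fun t ht => ⟨ht, hx⟩)
    exact h1.differentiableOn (by simp)
  have hIA : DifferentiableOn ℝ (fun t => (spaceDeriv χ (t, x)).inverse) (Ioo a b) := by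
    intro t ht
    obtain ⟨e, he⟩ := hAinv t ht
    have h2 : ContDiffAt ℝ ∞ ContinuousLinearMap.inverse (spaceDeriv χ (t, x)) :=
      he ▸ contDiffAt_map_inverse e
    exact (h2.differentiableAt (by simp)).comp_differentiableWithinAt t (hAd t ht)
  have hzc : ContDiffOn ℝ ∞ (fun t : ℝ => (t, χ (t, x))) (Ioo a b) :=
    contDiffOn_id.prodMk (hχ.contDiffOn.comp
      (f := fun t : ℝ => (t, x)) (by fun_prop) (fun t ht => ⟨ht, hx⟩))
  have hΓd : DifferentiableOn ℝ (fun t => flatConnection P p (t, χ (t, x))) (Ioo a b) :=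
    (h.contDiffOn_flatConnection.comp hzc (fun t ht => hχ.mem t ht x hx)).differentiableOn (by simp)
  -- the adapted covector whose restriction to the kernel is transported by the flow
  let f : (G →L[ℝ] ℝ) → ℝ → G →L[ℝ] ℝ := fun ξ t =>
    (ξ ∘L spaceDeriv χ (1, x)) ∘L (spaceDeriv χ (t, x)).inverse ∘L
      flatConnection P p (t, χ (t, x))
  have hfL : ∀ ξ, ∀ t ∈ Ioo a b, spaceDeriv p (t, χ (t, x)) (P (χ (t, x)) (f ξ t)) = 0 :=
    fun ξ t ht => h.spaceDeriv_sharp_comp_flatConnection (hχ.mem t ht x hx)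
      ((ξ ∘L spaceDeriv χ (1, x)) ∘L (spaceDeriv χ (t, x)).inverse)
  have hinvA : ∀ t ∈ Ioo a b, ∀ w,
      (spaceDeriv χ (t, x)).inverse (spaceDeriv χ (t, x) w) = w := fun t ht w =>
    congrArg (fun A => A w) (hAinv t ht).inverse_comp_self
  have hAinv' : ∀ t ∈ Ioo a b, ∀ w,
      spaceDeriv χ (t, x) ((spaceDeriv χ (t, x)).inverse w) = w := fun t ht w =>
    congrArg (fun A => A w) (hAinv t ht).self_comp_inverse
  have hfA : ∀ ξ, ∀ t ∈ Ioo a b, ∀ w, spaceDeriv p (0, x) w = 0 →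
      f ξ t (spaceDeriv χ (t, x) w) = ξ (spaceDeriv χ (1, x) w) := by
    intro ξ t ht w hw
    have h1 : flatConnection P p (t, χ (t, x)) (spaceDeriv χ (t, x) w) = spaceDeriv χ (t, x) w :=
      flatConnection_apply_of_mem (by rw [hLA t ht, hw])
    simp only [f, ContinuousLinearMap.comp_apply, h1, hinvA t ht]
  have hfd : ∀ ξ, ∀ t ∈ Ioo a b, ∃ ξ' : G →L[ℝ] ℝ, HasDerivAt (f ξ) ξ' t ∧
      ∀ D : G →L[ℝ] G, HasFDerivAt (fun y => leafField P p (compensator P p) (t, y)) D (χ (t, x)) →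
        ∀ u, spaceDeriv p (t, χ (t, x)) u = 0 → ξ' u = -f ξ t (D u) := by
    intro ξ t ht
    have hd : DifferentiableAt ℝ (f ξ) t := by
      have h1 : DifferentiableOn ℝ (f ξ) (Ioo a b) :=
        (differentiableOn_const _).clm_comp (hIA.clm_comp hΓd)
      exact h1.differentiableAt (isOpen_Ioo.mem_nhds ht)
    refine ⟨_, hd.hasDerivAt, fun D hD u hu => ?_⟩
    obtain ⟨w, rfl⟩ : ∃ w, spaceDeriv χ (t, x) w = u := ⟨_, hAinv' t ht u⟩
    rw [hLA t ht] at hu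
    have h1 := hasDerivAt_spaceDeriv_of_flow (hχat t ht) hD (by
      filter_upwards [hχ.isOpen.mem_nhds hx] with y hy using hχ.timeDeriv_eq t ht y hy) w
    have h2 := hd.hasDerivAt.clm_apply h1
    have h3 : (fun s => f ξ s (spaceDeriv χ (s, x) w)) =ᶠ[𝓝 t]
        fun _ => ξ (spaceDeriv χ (1, x) w) := by
      filter_upwards [isOpen_Ioo.mem_nhds ht] with s hs using hfA ξ s hs w hu
    have h4 := h2.unique ((hasDerivAt_const t _).congr_of_eventuallyEq h3)
    linarith
  obtain ⟨O, hO, hΩO⟩ := h.isFlatPoisson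
  have hder : ∀ t ∈ Ioo a b,
      HasDerivAt (fun s => f β₁ s (P (χ (s, x)) (f α₁ s))) 0 t := by
    intro t ht
    obtain ⟨α', hα', hα''⟩ := hfd α₁ t ht
    obtain ⟨β', hβ', hβ''⟩ := hfd β₁ t ht
    have hD := hasFDerivAt_space (((h.contDiffOn_leafField.contDiffAt
      (h.isOpen.mem_nhds (hχ.mem t ht x hx)))).differentiableAt (by simp))
    exact hasDerivAt_eval_zero hO (z := fun s => χ (s, x)) (hΩO _ (hχ.mem t ht x hx))
      (h.contDiffOn.contDiffAt (h.isOpen.mem_nhds (hχ.mem t ht x hx)))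
      (h.contDiffOn_compensator.contDiffAt (h.isOpen.mem_nhds (hχ.mem t ht x hx)))
      (hasDerivAt_flow hχ ht hx)
      hα' hβ' hD (hα'' _ hD) (hβ'' _ hD) (hfL α₁ t ht) (hfL β₁ t ht)
  have hconst := isOpen_Ioo.is_const_of_deriv_eq_zero isPreconnected_Ioo
    (fun t ht => (hder t ht).differentiableAt.differentiableWithinAt)
    (fun t ht => (hder t ht).deriv) h1ab h0ab
  have hA0 : spaceDeriv χ (0, x) = ContinuousLinearMap.id ℝ G := by
    refine (hasFDerivAt_space ((hχat 0 h0ab).differentiableAt (by simp))).unique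
      ((hasFDerivAt_id x).congr_of_eventuallyEq ?_)
    filter_upwards [hχ.isOpen.mem_nhds hx] with y hy using hχ.zero y hy
  have hend : ∀ ξ, spaceDeriv p (1, χ (1, x)) (P (χ (1, x)) ξ) = 0 → f ξ 1 = ξ := by
    intro ξ hξ
    have h1 : ∀ u, f ξ 1 u = ξ (flatConnection P p (1, χ (1, x)) u) := fun u => by
      simp only [f, ContinuousLinearMap.comp_apply, hAinv' 1 h1ab]
    ext u
    rw [h1]
    exact congrArg (fun A => A u)
      (h.comp_flatConnection_eq (hχ.mem 1 h1ab x hx) (fun u _ => rfl) hξ)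
  have hstart : ∀ ξ ξ₀, (∀ u, spaceDeriv p (0, x) u = 0 → ξ₀ u = ξ (spaceDeriv χ (1, x) u)) →
      spaceDeriv p (0, x) (P x ξ₀) = 0 → f ξ 0 = ξ₀ := by
    intro ξ ξ₀ h1 h2
    have h3 : ∀ u, (spaceDeriv χ (0, x)).inverse u = u := fun u => by
      rw [hA0, ContinuousLinearMap.inverse_id]; rfl
    have h4 : (0, x) ∈ Ω := by simpa [hχ.zero x hx] using hχ.mem 0 h0ab x hx
    have h5 := h.comp_flatConnection_eq (α := ξ ∘L spaceDeriv χ (1, x)) h4 h1 h2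
    ext u
    simp only [f, ContinuousLinearMap.comp_apply, h3, hχ.zero x hx]
    exact congrArg (fun A => A u) h5
  rw [hend α₁ hα₁, hend β₁ hβ₁, hstart α₁ α₀ hα hα₀, hstart β₁ β₀ hβ hβ₀, hχ.zero x hx] at hconst
  exact hconst

end IsTransverseFamily

end FlatFlow

/-! ### Bivector fields in charts -/

lemma contDiffOn_of_forall_dual {E G : Type*} [NormedAddCommGroup E] [NormedSpace ℝ E]
    [NormedAddCommGroup G] [NormedSpace ℝ G] [FiniteDimensional ℝ E] {f : G → E} {s : Set G}
    (h : ∀ b : E →L[ℝ] ℝ, ContDiffOn ℝ ∞ (fun x => b (f x)) s) : ContDiffOn ℝ ∞ f s := by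
  let e := Module.finBasis ℝ E
  have h1 : ∀ x, f x = ∑ i, (e.coord i).toContinuousLinearMap (f x) • e i := fun x =>
    (e.sum_repr (f x)).symm
  rw [funext h1]
  exact ContDiffOn.sum fun i _ => (h _).smul contDiffOn_const

section ChartBivector

set_option synthInstance.maxHeartbeats 200000

variable {E : Type*} [NormedAddCommGroup E] [NormedSpace ℝ E]
  {H : Type*} [TopologicalSpace H] {I : ModelWithCorners ℝ E H}
  {M : Type*} [TopologicalSpace M] [ChartedSpace H M]

lemma differential_comp_chart [IsManifold I ∞ M] {s : M} {x : E}
    (hx : x ∈ (extChartAt I s).target) {F : E → ℝ}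
    (hF : DifferentiableAt ℝ F x) {g : M → ℝ}
    (hg : g =ᶠ[𝓝 ((extChartAt I s).symm x)] fun m => F (extChartAt I s m)) :
    differential I g ((extChartAt I s).symm x) = (fderiv ℝ F x).toLinearMap ∘ₗ
      (mfderiv I 𝓘(ℝ, E) (extChartAt I s) ((extChartAt I s).symm x)).toLinearMap := by
  have h1 := ((contMDiffAt_chart ((extChartAt I s).map_target hx)).mdifferentiableAt
    (by simp)).hasMFDerivAt
  have h2 : HasMFDerivAt 𝓘(ℝ, E) 𝓘(ℝ, ℝ) F (extChartAt I s ((extChartAt I s).symm x))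
      (fderiv ℝ F x) := by
    rw [(extChartAt I s).right_inv hx]
    exact hasMFDerivAt_iff_hasFDerivAt.2 hF.hasFDerivAt
  have h3 := ((h2.comp _ h1).congr_of_eventuallyEq hg).mfderiv
  exact congrArg ContinuousLinearMap.toLinearMap h3

variable [FiniteDimensional ℝ E]

/-- The expression of a bivector field in the chart at `s`. -/
def chartBivector (P : BivectorField I M) (s : M) (x : E) : (E →L[ℝ] ℝ) →L[ℝ] E :=
  LinearMap.toContinuousLinearMap
    ((mfderiv I 𝓘(ℝ, E) (extChartAt I s) ((extChartAt I s).symm x)).toLinearMap ∘ₗ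
      P.sharp ((extChartAt I s).symm x) ∘ₗ
      (mfderiv I 𝓘(ℝ, E) (extChartAt I s) ((extChartAt I s).symm x)).toLinearMap.dualMap ∘ₗ
      ContinuousLinearMap.coeLM ℝ)

variable [IsManifold I ∞ M]

lemma bracket_chart (P : BivectorField I M) {s : M} {x : E} (hx : x ∈ (extChartAt I s).target)
    {F : E → ℝ} (hF : DifferentiableAt ℝ F x) (a : E →L[ℝ] ℝ) {g : M → ℝ}
    (hg : g =ᶠ[𝓝 ((extChartAt I s).symm x)] fun m => F (extChartAt I s m)) :
    P.bracket (fun m => a (extChartAt I s m)) g ((extChartAt I s).symm x) =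
      fderiv ℝ F x (chartBivector P s x a) := by
  have h1 := differential_comp_chart hx hF hg
  have h2 := differential_comp_chart (g := fun m => a (extChartAt I s m)) hx a.differentiableAt
    (.refl _ _)
  rw [a.fderiv] at h2
  rw [BivectorField.bracket, BivectorField.eval, h1, h2]
  rfl

variable [I.Boundaryless]

/-- The expression of a Poisson tensor in a chart is Poisson. -/
lemma isFlatPoisson_chartBivector {P : BivectorField I M} {N : Set M} (hN : IsOpen N)
    (hP : P.IsPoissonOn N) (s : M) :
    IsFlatPoisson (chartBivector P s) ((extChartAt I s).target ∩ (extChartAt I s).symm ⁻¹' N) := by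
  set ψ := extChartAt I s with hψ
  have hO : IsOpen (ψ.target ∩ ψ.symm ⁻¹' N) :=
    (contMDiffOn_chart_symm s).continuousOn.isOpen_inter_preimage (isOpen_extChartAt_target s) hN
  have hU : IsOpen (ψ.source ∩ N) := (isOpen_extChartAt_source s).inter hN
  have hsm : ∀ a : E →L[ℝ] ℝ, ContMDiffOn I 𝓘(ℝ, ℝ) ∞ (fun m => a (ψ m)) (ψ.source ∩ N) :=
    fun a => a.contDiff.contMDiff.comp_contMDiffOn ((contMDiffOn_chart s).mono inter_subset_left)
  -- the bracket of two linear coordinates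
  have hbr : ∀ a b : E →L[ℝ] ℝ, ∀ x ∈ ψ.target,
      P.bracket (fun m => a (ψ m)) (fun m => b (ψ m)) (ψ.symm x) = b (chartBivector P s x a) := by
    intro a b x hx
    rw [bracket_chart P hx b.differentiableAt a (.refl _ _), b.fderiv]
  have hcoord : ∀ a b : E →L[ℝ] ℝ,
      ContDiffOn ℝ ∞ (fun x => b (chartBivector P s x a)) (ψ.target ∩ ψ.symm ⁻¹' N) := by
    intro a b
    have h1 := (hP.smooth _ hU inter_subset_right _ _ (hsm a) (hsm b)).comp
      ((contMDiffOn_chart_symm s).mono inter_subset_left)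
      (fun x (hx : x ∈ ψ.target ∩ ψ.symm ⁻¹' N) => ⟨ψ.map_target hx.1, hx.2⟩)
    exact h1.contDiffOn.congr fun x hx => (hbr a b x hx.1).symm
  have hCD : ContDiffOn ℝ ∞ (chartBivector P s) (ψ.target ∩ ψ.symm ⁻¹' N) :=
    contDiffOn_clm_apply.2 fun a => contDiffOn_of_forall_dual (hcoord a)
  refine ⟨hO, hCD, fun x _ α => P.apply_sharp_self (ψ.symm x) (α.toLinearMap ∘ₗ
    (mfderiv I 𝓘(ℝ, E) ψ (ψ.symm x)).toLinearMap), ?_⟩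
  intro x hx α β γ
  have hPx : HasFDerivAt (chartBivector P s) (fderiv ℝ (chartBivector P s) x) x :=
    ((hCD.contDiffAt (hO.mem_nhds hx)).differentiableAt (by simp)).hasFDerivAt
  have hd : ∀ a b : E →L[ℝ] ℝ, HasFDerivAt (fun y => b (chartBivector P s y a))
      (b ∘L (fderiv ℝ (chartBivector P s) x).flip a) x := by
    intro a b
    have h2 : HasFDerivAt (fun y => chartBivector P s y a)
        ((fderiv ℝ (chartBivector P s) x).flip a) x :=
      (hPx.clm_apply (hasFDerivAt_const a x)).congr_fderiv (by ext; simp)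
    exact b.hasFDerivAt.comp x h2
  have hbr2 : ∀ a b c : E →L[ℝ] ℝ, P.bracket (fun m => a (ψ m))
      (P.bracket (fun m => b (ψ m)) (fun m => c (ψ m))) (ψ.symm x) =
      c (fderiv ℝ (chartBivector P s) x (chartBivector P s x a) b) := by
    intro a b c
    rw [bracket_chart P hx.1 (hd b c).differentiableAt a, (hd b c).fderiv]
    · rfl
    · filter_upwards [(isOpen_extChartAt_source s).mem_nhds (ψ.map_target hx.1)] with m hm
      rw [← hbr b c _ (ψ.map_source hm), ψ.left_inv hm]
  have hj := hP.jacobi _ hU inter_subset_right _ _ _ (hsm α) (hsm β) (hsm γ) (ψ.symm x)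
    ⟨ψ.map_target hx.1, hx.2⟩
  rwa [hbr2, hbr2, hbr2] at hj

end ChartBivector

section LeafVector

variable {T C : Type*} [AddCommGroup T] [Module ℝ T] [AddCommGroup C] [Module ℝ C]

open Classical in
/-- The vector in `P (ann (ker L))` with image `w` under `L` (and `0` if `P` is not transversal to
the fibres of `L`). -/
def leafVector (P : Module.Dual ℝ T →ₗ[ℝ] T) (L : T →ₗ[ℝ] C) (w : C) : T :=
  if h : IsTransverse P L then P (L.dualMap ((LinearEquiv.ofBijective _ h).symm w)) else 0

lemma leafVector_zero (P : Module.Dual ℝ T →ₗ[ℝ] T) (L : T →ₗ[ℝ] C) : leafVector P L 0 = 0 := by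
  unfold leafVector
  split_ifs <;> simp

lemma leafVector_eq {P : Module.Dual ℝ T →ₗ[ℝ] T} {L : T →ₗ[ℝ] C} (h : IsTransverse P L) {w : C}
    {c : Module.Dual ℝ C} (hc : L (P (L.dualMap c)) = w) : leafVector P L w = P (L.dualMap c) := by
  rw [leafVector, dif_pos h]
  have : LinearEquiv.ofBijective _ h c = w := hc
  rw [← this, LinearEquiv.symm_apply_apply]

end LeafVector

/-! ### Time-dependent maps in charts -/

section TimeDependentMaps

variable {E : Type*} [NormedAddCommGroup E] [NormedSpace ℝ E]
  {H : Type*} [TopologicalSpace H] {I : ModelWithCorners ℝ E H}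
  {M : Type*} [TopologicalSpace M] [ChartedSpace H M]
  {EB : Type*} [NormedAddCommGroup EB] [NormedSpace ℝ EB]
  {B : Type*} [TopologicalSpace B] [ChartedSpace EB B]

variable (I) in
/-- The differential of the chart at `s`, with values in the model space. -/
def chartDiff (s m : M) : TangentSpace I m →ₗ[ℝ] E :=
  (mfderiv I 𝓘(ℝ, E) (extChartAt I s) m).toLinearMap

variable (I) in
/-- The differential of the inverse of the chart at `s`. -/
def chartSymmDiff (s : M) (x : E) : E →ₗ[ℝ] TangentSpace I ((extChartAt I s).symm x) :=
  (mfderiv 𝓘(ℝ, E) I (extChartAt I s).symm x).toLinearMap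

lemma chartDiff_injective [IsManifold I ∞ M] [I.Boundaryless] {s m : M}
    (hm : m ∈ (extChartAt I s).source) :
    Function.Injective (chartDiff I s m) := (chartEquiv hm).injective

lemma chartDiff_surjective [IsManifold I ∞ M] [I.Boundaryless] {s m : M}
    (hm : m ∈ (extChartAt I s).source) :
    Function.Surjective (chartDiff I s m) := (chartEquiv hm).surjective

lemma chartDiff_comp_chartSymmDiff [IsManifold I ∞ M] [I.Boundaryless] {s : M} {x : E}
    (hx : x ∈ (extChartAt I s).target) (u : E) :
    chartDiff I s ((extChartAt I s).symm x) (chartSymmDiff I s x u) = u :=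
  congrArg (fun A => A u) (mfderiv_chart_comp_symm hx)

lemma chartSymmDiff_comp_chartDiff [IsManifold I ∞ M] [I.Boundaryless] {s : M} {x : E}
    (hx : x ∈ (extChartAt I s).target) (u : TangentSpace I ((extChartAt I s).symm x)) :
    chartSymmDiff I s x (chartDiff I s ((extChartAt I s).symm x) u) = u :=
  chartDiff_injective ((extChartAt I s).map_target hx) (chartDiff_comp_chartSymmDiff hx _)

lemma chartBivector_eval [FiniteDimensional ℝ E] {P : BivectorField I M} {s m : M} {x : E}
    (hm : (extChartAt I s).symm x = m) {α β : Cotangent I m} {a b : E →L[ℝ] ℝ}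
    (ha : ∀ v, a (chartDiff I s m v) = α v) (hb : ∀ v, b (chartDiff I s m v) = β v) :
    b (chartBivector P s x a) = P.eval m α β := by
  subst hm
  have h1 : chartBivector P s x a = chartDiff I s _ (P.sharp _ α) :=
    congrArg (fun ξ => chartDiff I s _ (P.sharp _ ξ)) (LinearMap.ext ha)
  rw [h1, hb]
  rfl

variable (I EB) in
/-- The space differential of a time-dependent map. -/
def mapDiff (f : ℝ → M → B) (t : ℝ) (m : M) :
    TangentSpace I m →ₗ[ℝ] TangentSpace 𝓘(ℝ, EB) (f t m) :=
  (mfderiv I 𝓘(ℝ, EB) (f t) m).toLinearMap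

variable (EB) in
/-- The time derivative of a time-dependent map at the point `m`. -/
def velocity (f : ℝ → M → B) (t : ℝ) (m : M) : TangentSpace 𝓘(ℝ, EB) (f t m) :=
  mfderiv 𝓘(ℝ, ℝ) 𝓘(ℝ, EB) (fun r => f r m) t (1 : ℝ)

variable (I EB) in
/-- The expression of a time-dependent map `f t : M → B` in the charts at `s` and `b₀`. -/
def chartFamily (f : ℝ → M → B) (s : M) (b₀ : B) (q : ℝ × E) : EB :=
  extChartAt 𝓘(ℝ, EB) b₀ (f q.1 ((extChartAt I s).symm q.2))

lemma mdifferentiableAt_of_uncurry {f : ℝ → M → B} {t : ℝ} {m : M}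
    (h : ContMDiffAt (𝓘(ℝ, ℝ).prod I) 𝓘(ℝ, EB) ∞ (fun p : ℝ × M => f p.1 p.2) (t, m)) :
    MDifferentiableAt I 𝓘(ℝ, EB) (f t) m ∧
      MDifferentiableAt 𝓘(ℝ, ℝ) 𝓘(ℝ, EB) (fun r => f r m) t :=
  ⟨(ContMDiffAt.comp m (g := fun p : ℝ × M => f p.1 p.2) h
      (contMDiffAt_const.prodMk contMDiffAt_id)).mdifferentiableAt (by simp),
    (ContMDiffAt.comp t (g := fun p : ℝ × M => f p.1 p.2) h
      (contMDiffAt_id.prodMk contMDiffAt_const)).mdifferentiableAt (by simp)⟩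

variable (I EB) in
/-- The pair of charts at `s` and `b₀` is suitable for `f` at the point `(t, x)` of space-time. -/
structure IsChartPoint (f : ℝ → M → B) (s : M) (b₀ : B) (t : ℝ) (x : E) : Prop where
  mem_target : x ∈ (extChartAt I s).target
  mem_source : f t ((extChartAt I s).symm x) ∈ (extChartAt 𝓘(ℝ, EB) b₀).source
  contMDiffAt : ContMDiffAt (𝓘(ℝ, ℝ).prod I) 𝓘(ℝ, EB) ∞ (fun p : ℝ × M => f p.1 p.2)
      (t, (extChartAt I s).symm x)

namespace IsChartPoint

set_option synthInstance.maxHeartbeats 200000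

variable [IsManifold I ∞ M] [I.Boundaryless] [IsManifold 𝓘(ℝ, EB) ∞ B]
  {f : ℝ → M → B} {s : M} {b₀ : B} {t : ℝ} {x : E}

lemma contDiffAt (h : IsChartPoint I EB f s b₀ t x) :
    ContDiffAt ℝ ∞ (chartFamily I EB f s b₀) (t, x) := by
  have h1 : ContMDiffAt 𝓘(ℝ, ℝ × E) (𝓘(ℝ, ℝ).prod I) ∞
      (fun q : ℝ × E => (q.1, (extChartAt I s).symm q.2)) (t, x) :=
    contDiff_fst.contMDiff.contMDiffAt.prodMk
      (ContMDiffAt.comp (t, x) (contMDiffAt_chart_symm h.mem_target)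
        contDiff_snd.contMDiff.contMDiffAt)
  have h2 := ContMDiffAt.comp (t, x) (g := fun p : ℝ × M => f p.1 p.2) h.contMDiffAt h1
  exact (ContMDiffAt.comp (t, x) (contMDiffAt_chart h.mem_source) h2).contDiffAt

lemma spaceDeriv_eq (h : IsChartPoint I EB f s b₀ t x) (u : E) :
    spaceDeriv (chartFamily I EB f s b₀) (t, x) u =
      chartDiff 𝓘(ℝ, EB) b₀ (f t ((extChartAt I s).symm x))
        (mapDiff I EB f t ((extChartAt I s).symm x) (chartSymmDiff I s x u)) := by
  have h1 := ((contMDiffAt_chart_symm h.mem_target).mdifferentiableAt (by simp)).hasMFDerivAt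
  have h2 := (mdifferentiableAt_of_uncurry h.contMDiffAt).1.hasMFDerivAt
  have h3 := ((contMDiffAt_chart h.mem_source).mdifferentiableAt (by simp)).hasMFDerivAt
  have h4 := hasMFDerivAt_iff_hasFDerivAt.1 (h3.comp x (h2.comp x h1))
  exact congrArg (fun A => A u)
    ((hasFDerivAt_space (h.contDiffAt.differentiableAt (by simp))).unique h4)

lemma timeDeriv_eq (h : IsChartPoint I EB f s b₀ t x) :
    timeDeriv (chartFamily I EB f s b₀) (t, x) =
      chartDiff 𝓘(ℝ, EB) b₀ (f t ((extChartAt I s).symm x))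
        (velocity EB f t ((extChartAt I s).symm x)) := by
  have h2 := (mdifferentiableAt_of_uncurry h.contMDiffAt).2.hasMFDerivAt
  have h3 := ((contMDiffAt_chart h.mem_source).mdifferentiableAt (by simp)).hasMFDerivAt
  have h4 := hasMFDerivAt_iff_hasFDerivAt.1 (h3.comp t h2)
  have h5 := hasDerivAt_time (h.contDiffAt.differentiableAt (by simp))
  exact (one_smul ℝ _).symm.trans (congrArg (fun A => A (1 : ℝ)) (h5.hasFDerivAt.unique h4))

lemma spaceDeriv_chartDiff (h : IsChartPoint I EB f s b₀ t x)
    (u : TangentSpace I ((extChartAt I s).symm x)) :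
    spaceDeriv (chartFamily I EB f s b₀) (t, x) (chartDiff I s ((extChartAt I s).symm x) u) =
      chartDiff 𝓘(ℝ, EB) b₀ (f t ((extChartAt I s).symm x))
        (mapDiff I EB f t ((extChartAt I s).symm x) u) := by
  rw [h.spaceDeriv_eq, chartSymmDiff_comp_chartDiff h.mem_target]

variable [FiniteDimensional ℝ E] {P : BivectorField I M}

lemma leafField_eq (h : IsChartPoint I EB f s b₀ t x) (c : ℝ × E → EB →L[ℝ] ℝ) :
    leafField (chartBivector P s) (chartFamily I EB f s b₀) c (t, x) =
      chartDiff I s ((extChartAt I s).symm x) (P.sharp ((extChartAt I s).symm x)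
        ((mapDiff I EB f t ((extChartAt I s).symm x)).dualMap
          ((c (t, x)).toLinearMap ∘ₗ
            chartDiff 𝓘(ℝ, EB) b₀ (f t ((extChartAt I s).symm x))))) := by
  refine congrArg (fun α => chartDiff I s ((extChartAt I s).symm x)
    (P.sharp ((extChartAt I s).symm x) α)) ?_
  exact LinearMap.ext fun u => congrArg (c (t, x)) (h.spaceDeriv_chartDiff u)

lemma inducedBivector_eq (h : IsChartPoint I EB f s b₀ t x) (c : EB →L[ℝ] ℝ) :
    inducedBivector (chartBivector P s) (chartFamily I EB f s b₀) (t, x) c =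
      chartDiff 𝓘(ℝ, EB) b₀ (f t ((extChartAt I s).symm x))
        ((mapDiff I EB f t ((extChartAt I s).symm x) ∘ₗ P.sharp ((extChartAt I s).symm x) ∘ₗ
          (mapDiff I EB f t ((extChartAt I s).symm x)).dualMap)
            (c.toLinearMap ∘ₗ chartDiff 𝓘(ℝ, EB) b₀ (f t ((extChartAt I s).symm x)))) := by
  have h1 := h.leafField_eq (P := P) (fun _ => c)
  refine (congrArg (spaceDeriv (chartFamily I EB f s b₀) (t, x)) h1).trans ?_
  rw [h.spaceDeriv_chartDiff]
  rfl

/-- The expression in the chart at `s` of covectors one of which is adapted to the other. -/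
lemma exists_flat_adapted {m : M}
    (h : IsChartPoint I EB f s b₀ t x) (hm : (extChartAt I s).symm x = m)
    {α α' : Cotangent I m} (hα : IsAdapted (P.sharp m) (mapDiff I EB f t m) α α') :
    ∃ a' : E →L[ℝ] ℝ, (∀ v, a' (chartDiff I s m v) = α' v) ∧
      spaceDeriv (chartFamily I EB f s b₀) (t, x) (chartBivector P s x a') = 0 ∧
      ∀ v, spaceDeriv (chartFamily I EB f s b₀) (t, x) (chartDiff I s m v) = 0 →
        a' (chartDiff I s m v) = α v := by
  subst hm
  let K := chartEquiv (I := I) ((extChartAt I s).map_target h.mem_target)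
  let a' : E →L[ℝ] ℝ := LinearMap.toContinuousLinearMap (α' ∘ₗ K.symm.toLinearMap)
  have h0 : ∀ v, a' (chartDiff I s _ v) = α' v := fun v => congrArg α' (K.symm_apply_apply v)
  refine ⟨a', h0, ?_, ?_⟩
  · have h1 : chartBivector P s x a' = chartDiff I s _ (P.sharp _ α') :=
      congrArg (fun ξ => chartDiff I s _ (P.sharp _ ξ)) (LinearMap.ext h0)
    rw [h1, h.spaceDeriv_chartDiff, hα.2, map_zero]
  · intro v hv
    rw [h.spaceDeriv_chartDiff, map_eq_zero_iff _ (chartDiff_injective h.mem_source)] at hv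
    rw [h0, hα.1 v hv]

variable [FiniteDimensional ℝ EB]

lemma isInvertible_inducedBivector (h : IsChartPoint I EB f s b₀ t x)
    (hW : IsTransverse (P.sharp ((extChartAt I s).symm x))
      (mapDiff I EB f t ((extChartAt I s).symm x))) :
    (inducedBivector (chartBivector P s) (chartFamily I EB f s b₀) (t, x)).IsInvertible := by
  have hinj : Function.Injective
      (inducedBivector (chartBivector P s) (chartFamily I EB f s b₀) (t, x)).toLinearMap := by
    rw [← LinearMap.ker_eq_bot, LinearMap.ker_eq_bot']
    intro c hc
    have h1 := (h.inducedBivector_eq (P := P) c).symm.trans hc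
    rw [map_eq_zero_iff _ (chartDiff_injective h.mem_source), map_eq_zero_iff _ hW.1] at h1
    ext u
    obtain ⟨w, rfl⟩ := chartDiff_surjective h.mem_source u
    exact congrArg (fun A => A w) h1
  have hdim : Module.finrank ℝ (EB →L[ℝ] ℝ) = Module.finrank ℝ EB := by
    rw [← (LinearMap.toContinuousLinearMap : (EB →ₗ[ℝ] ℝ) ≃ₗ[ℝ] _).finrank_eq]
    exact Subspace.dual_finrank_eq
  refine ⟨(LinearEquiv.ofBijective _ ⟨hinj,
    (LinearMap.injective_iff_surjective_of_finrank_eq_finrank hdim).1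
      hinj⟩).toContinuousLinearEquiv, ?_⟩
  ext c
  rfl

lemma isTransverse (h : IsChartPoint I EB f s b₀ t x)
    (hW : (inducedBivector (chartBivector P s) (chartFamily I EB f s b₀) (t, x)).IsInvertible) :
    IsTransverse (P.sharp ((extChartAt I s).symm x))
      (mapDiff I EB f t ((extChartAt I s).symm x)) := by
  have hfin : FiniteDimensional ℝ (TangentSpace 𝓘(ℝ, EB) (f t ((extChartAt I s).symm x))) :=
    inferInstanceAs (FiniteDimensional ℝ EB)
  have hinj : Function.Injective (mapDiff I EB f t ((extChartAt I s).symm x) ∘ₗ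
      P.sharp ((extChartAt I s).symm x) ∘ₗ
      (mapDiff I EB f t ((extChartAt I s).symm x)).dualMap) := by
    rw [← LinearMap.ker_eq_bot, LinearMap.ker_eq_bot']
    intro c hc
    let K := chartEquiv h.mem_source
    let c' : EB →L[ℝ] ℝ := LinearMap.toContinuousLinearMap (c ∘ₗ K.symm.toLinearMap)
    have h0 : c'.toLinearMap ∘ₗ chartDiff 𝓘(ℝ, EB) b₀ (f t ((extChartAt I s).symm x)) = c :=
      LinearMap.ext fun u => congrArg c (K.symm_apply_apply u)
    have h1 : inducedBivector (chartBivector P s) (chartFamily I EB f s b₀) (t, x) c' = 0 := by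
      rw [h.inducedBivector_eq, h0, hc, map_zero]
    have h2 : c' = 0 := by
      have h3 := congrArg (fun A => A c') hW.inverse_comp_self
      have h4 : (inducedBivector (chartBivector P s) (chartFamily I EB f s b₀) (t, x)).inverse
        (inducedBivector (chartBivector P s) (chartFamily I EB f s b₀) (t, x) c') = c' := h3
      rw [← h4, h1, map_zero]
    rw [← h0, h2]
    exact LinearMap.zero_comp _
  exact ⟨hinj, (LinearMap.injective_iff_surjective_of_finrank_eq_finrank
    (Subspace.dual_finrank_eq)).1 hinj⟩

end IsChartPoint

end TimeDependentMaps

/-! ### The compensating vector field -/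

section Straightening

set_option synthInstance.maxHeartbeats 200000

variable {E : Type*} [NormedAddCommGroup E] [NormedSpace ℝ E] [FiniteDimensional ℝ E]
  {H : Type*} [TopologicalSpace H] {I : ModelWithCorners ℝ E H} [I.Boundaryless]
  {M : Type*} [TopologicalSpace M] [ChartedSpace H M] [IsManifold I ∞ M]
  {EB : Type*} [NormedAddCommGroup EB] [NormedSpace ℝ EB] [FiniteDimensional ℝ EB]
  {B : Type*} [TopologicalSpace B] [ChartedSpace EB B] [IsManifold 𝓘(ℝ, EB) ∞ B]

/-- The charts at `s` and `b₀` are suitable for the family `f` at the points of `U` and for times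
in `J`, and the fibres of `f` are transversal to `P` there. -/
structure IsTransverseChart (P : BivectorField I M) (EB : Type*) [NormedAddCommGroup EB]
    [NormedSpace ℝ EB] [ChartedSpace EB B] (f : ℝ → M → B) (s : M) (b₀ : B) (J : Set ℝ)
    (U : Set E) : Prop where
  isOpen : IsOpen U
  isChartPoint : ∀ t ∈ J, ∀ x ∈ U, IsChartPoint I EB f s b₀ t x
  isTransverseFamily : IsTransverseFamily (chartBivector P s) (chartFamily I EB f s b₀) (J ×ˢ U)

/-- A family which is transversal to `P` along a curve of the form `t ↦ (t, s)` is transversal to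
`P` on a product neighbourhood of any compact part of the curve. -/
lemma exists_isTransverseChart {P : BivectorField I M} {N : Set M} (hN : IsOpen N)
    (hP : P.IsPoissonOn N) {f : ℝ → M → B} {a a' b' b : ℝ} (ha : a < a') (hb : b' < b)
    (hf : ∀ t ∈ Ioo a b, ∀ m ∈ N, ContMDiffAt (𝓘(ℝ, ℝ).prod I) 𝓘(ℝ, EB) ∞
      (fun p : ℝ × M => f p.1 p.2) (t, m)) {s : M} (hs : s ∈ N) {b₀ : B}
    (hfs : ∀ t ∈ Ioo a b, f t s = b₀)
    (htr : ∀ t ∈ Ioo a b, IsTransverse (P.sharp s) (mapDiff I EB f t s)) :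
    ∃ U, extChartAt I s s ∈ U ∧ IsTransverseChart P EB f s b₀ (Ioo a' b') U ∧
      ∀ x ∈ U, (extChartAt I s).symm x ∈ N := by
  set ψ := extChartAt I s with hψ
  have hflat := isFlatPoisson_chartBivector hN hP s
  set O := ψ.target ∩ ψ.symm ⁻¹' N with hO
  -- the set of points of space-time where the charts are suitable
  let Ω₀ : Set (ℝ × E) := (Ioo a b ×ˢ O) ∩
    (fun q : ℝ × E => f q.1 (ψ.symm q.2)) ⁻¹' (extChartAt 𝓘(ℝ, EB) b₀).source
  have hcont : ContinuousOn (fun q : ℝ × E => f q.1 (ψ.symm q.2)) (Ioo a b ×ˢ O) := by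
    rintro ⟨t, x⟩ ⟨ht, hx⟩
    have h1 := (hf t ht _ hx.2).continuousAt
    have h2 : ContinuousAt (fun q : ℝ × E => (q.1, ψ.symm q.2)) (t, x) :=
      continuousAt_fst.prodMk (ContinuousAt.comp (contMDiffAt_chart_symm hx.1).continuousAt
        continuousAt_snd)
    exact (ContinuousAt.comp (f := fun q : ℝ × E => (q.1, ψ.symm q.2)) (x := (t, x))
      (g := fun p : ℝ × M => f p.1 p.2) h1 h2).continuousWithinAt
  have hΩ₀ : IsOpen Ω₀ := hcont.isOpen_inter_preimage (isOpen_Ioo.prod hflat.isOpen)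
    (isOpen_extChartAt_source b₀)
  have hpt : ∀ q ∈ Ω₀, IsChartPoint I EB f s b₀ q.1 q.2 := fun q hq =>
    ⟨hq.1.2.1, hq.2, hf _ hq.1.1 _ hq.1.2.2⟩
  have hp : ContDiffOn ℝ ∞ (chartFamily I EB f s b₀) Ω₀ := fun q hq =>
    (hpt q hq).contDiffAt.contDiffWithinAt
  have hind := contDiffOn_inducedBivector hΩ₀
    (hflat.contDiffOn.comp contDiff_snd.contDiffOn fun q (hq : q ∈ Ω₀) => hq.1.2) hp
  have hΩ : IsOpen (Ω₀ ∩ inducedBivector (chartBivector P s) (chartFamily I EB f s b₀) ⁻¹'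
      {A | A.IsInvertible}) :=
    hind.continuousOn.isOpen_inter_preimage hΩ₀ ContinuousLinearEquiv.isOpen
  obtain ⟨U₁, U, -, hU, hJU₁, hsU, hsub⟩ := generalized_tube_lemma
    (isCompact_Icc (a := a') (b := b'))
    (isCompact_singleton (x := ψ s)) hΩ (by
      rintro ⟨t, x⟩ ⟨ht, hx⟩
      obtain rfl : x = ψ s := hx
      have ht' : t ∈ Ioo a b := ⟨ha.trans_le ht.1, ht.2.trans_lt hb⟩
      have hss : ψ.symm (ψ s) = s := extChartAt_to_inv s
      have h1 : (t, ψ s) ∈ Ω₀ := by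
        refine ⟨⟨ht', mem_extChartAt_target s, ?_⟩, ?_⟩
        · rw [mem_preimage, hss]; exact hs
        · change f t (ψ.symm (ψ s)) ∈ (extChartAt 𝓘(ℝ, EB) b₀).source
          rw [hss, hfs t ht']
          exact mem_extChartAt_source b₀
      refine ⟨h1, (hpt _ h1).isInvertible_inducedBivector ?_⟩
      change IsTransverse (P.sharp (ψ.symm (ψ s))) (mapDiff I EB f t (ψ.symm (ψ s)))
      rw [hss]
      exact htr t ht')
  have hsub' : Ioo a' b' ×ˢ U ⊆ Ω₀ ∩ inducedBivector (chartBivector P s)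
      (chartFamily I EB f s b₀) ⁻¹' {A | A.IsInvertible} := fun q hq =>
    hsub ⟨hJU₁ (Ioo_subset_Icc_self hq.1), hq.2⟩
  refine ⟨U ∩ O, ⟨hsU rfl, mem_extChartAt_target s, ?_⟩, ⟨hU.inter hflat.isOpen, ?_,
    ⟨isOpen_Ioo.prod (hU.inter hflat.isOpen), ⟨O, hflat, fun q hq => hq.2.2⟩, ?_, ?_⟩⟩, ?_⟩
  · rw [mem_preimage, extChartAt_to_inv]; exact hs
  · exact fun t ht x hx => hpt (t, x) (hsub' ⟨ht, hx.1⟩).1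
  · exact hp.mono fun q hq => (hsub' ⟨hq.1, hq.2.1⟩).1
  · exact fun q hq => (hsub' ⟨hq.1, hq.2.1⟩).2
  · exact fun x hx => hx.2.2

variable (EB) in
/-- The time-dependent vector field with values in `P♮ (ann (ker d(f t)))` which compensates the
motion of the family `f`. -/
def compensatingField (P : BivectorField I M) (f : ℝ → M → B) (t : ℝ) (m : M) :
    TangentSpace I m :=
  leafVector (P.sharp m) (mapDiff I EB f t m) (-velocity EB f t m)

namespace IsTransverseChart

variable {P : BivectorField I M} {f : ℝ → M → B} {s : M} {b₀ : B} {J : Set ℝ} {U : Set E}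

lemma compensatingField_eq (h : IsTransverseChart P EB f s b₀ J U) {t : ℝ} (ht : t ∈ J) {x : E}
    (hx : x ∈ U) :
    compensatingField EB P f t ((extChartAt I s).symm x) =
      chartSymmDiff I s x (leafField (chartBivector P s) (chartFamily I EB f s b₀)
        (compensator (chartBivector P s) (chartFamily I EB f s b₀)) (t, x)) := by
  have hpt := h.isChartPoint t ht x hx
  have hleaf := hpt.leafField_eq (P := P)
    (compensator (chartBivector P s) (chartFamily I EB f s b₀))
  have htr := hpt.isTransverse (h.isTransverseFamily.isInvertible (t, x) ⟨ht, hx⟩)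
  rw [hleaf, chartSymmDiff_comp_chartDiff hpt.mem_target]
  refine leafVector_eq htr (chartDiff_injective hpt.mem_source ?_)
  have h1 := h.isTransverseFamily.spaceDeriv_leafField (q := (t, x)) ⟨ht, hx⟩
  rw [hleaf, hpt.spaceDeriv_chartDiff, hpt.timeDeriv_eq] at h1
  rw [h1, map_neg]

lemma isChartField (h : IsTransverseChart P EB f s b₀ J U) (hJ : J.Nonempty) :
    IsChartField (compensatingField EB P f) J s U
      (leafField (chartBivector P s) (chartFamily I EB f s b₀)
        (compensator (chartBivector P s) (chartFamily I EB f s b₀))) where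
  isOpen := h.isOpen
  subset_target x hx := (h.isChartPoint _ hJ.choose_spec x hx).mem_target
  contDiffOn := h.isTransverseFamily.contDiffOn_leafField
  eq_mfderiv _ ht _ hx := h.compensatingField_eq ht hx

end IsTransverseChart

end Straightening

/-! ### Straightening a family of maps -/

section SpaceTime

variable {E : Type*} [NormedAddCommGroup E] [NormedSpace ℝ E]
  {H : Type*} [TopologicalSpace H] {I : ModelWithCorners ℝ E H}
  {M : Type*} [TopologicalSpace M] [ChartedSpace H M]

lemma contMDiffAt_of_suspension {χ : ℝ → M → M} {p : ℝ × M}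
    (h : IsLocalDiffeomorphAt (𝓘(ℝ, ℝ).prod I) (𝓘(ℝ, ℝ).prod I) ∞ (suspension χ) p) :
    ContMDiffAt (𝓘(ℝ, ℝ).prod I) I ∞ (fun q : ℝ × M => χ q.1 q.2) p :=
  contMDiffAt_snd.comp p h.contMDiffAt

/-- If the suspension of `χ` is a local diffeomorphism, then so is each `χ t`; here only the
injectivity of the differential is needed. -/
lemma injective_mfderiv_of_suspension {χ : ℝ → M → M} {t : ℝ} {m : M}
    (h : IsLocalDiffeomorphAt (𝓘(ℝ, ℝ).prod I) (𝓘(ℝ, ℝ).prod I) ∞ (suspension χ) (t, m)) :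
    Function.Injective (mfderiv I I (χ t) m) := by
  have hχ := contMDiffAt_of_suspension h
  obtain ⟨Θ, hp, hΘ⟩ := h
  have hΘm : suspension χ (t, m) = Θ (t, m) := hΘ hp
  have hΘt : (t, χ t m) ∈ Θ.target := by
    have := Θ.map_source' hp
    rwa [← hΘm] at this
  have h1 : ContMDiffAt I I ∞ (fun y => (Θ.invFun (t, y)).2) (χ t m) := by
    have h2 := Θ.contMDiffOn_invFun.contMDiffAt (Θ.open_target.mem_nhds hΘt)
    exact contMDiffAt_snd.comp (χ t m) (ContMDiffAt.comp (χ t m) (g := Θ.invFun) h2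
      (contMDiffAt_const.prodMk contMDiffAt_id))
  have h3 : ContMDiffAt I I ∞ (χ t) m :=
    ContMDiffAt.comp m (g := fun q : ℝ × M => χ q.1 q.2) hχ
      (contMDiffAt_const.prodMk contMDiffAt_id)
  have h4 := (h1.mdifferentiableAt (by simp)).hasMFDerivAt.comp m
    (h3.mdifferentiableAt (by simp)).hasMFDerivAt
  have h5 : HasMFDerivAt I I (fun y => (Θ.invFun (t, χ t y)).2) m
      (ContinuousLinearMap.id ℝ (TangentSpace I m)) := by
    refine (hasMFDerivAt_id m).congr_of_eventuallyEq ?_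
    have h6 : ∀ᶠ y in 𝓝 m, (t, y) ∈ Θ.source :=
      (continuous_const.prodMk continuous_id).continuousAt.eventually_mem
        (Θ.open_source.mem_nhds hp)
    filter_upwards [h6] with y hy
    have h7 : (t, χ t y) = Θ (t, y) := hΘ hy
    have h8 : Θ.invFun (t, χ t y) = (t, y) := h7 ▸ Θ.left_inv' hy
    rw [h8]
    rfl
  intro v w hvw
  have h9 := hasMFDerivAt_unique h5 h4
  have h10 : ∀ u, u = mfderiv I I (fun y => (Θ.invFun (t, y)).2) (χ t m) (mfderiv I I (χ t) m u) :=
    fun u => congrArg (fun A => A u) h9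
  exact (h10 v).trans ((congrArg _ hvw).trans (h10 w).symm)

variable (I) in
/-- The expression of a time-dependent map of `M` to itself in the chart at `s`. -/
def chartFlow (χ : ℝ → M → M) (s : M) (q : ℝ × E) : E :=
  extChartAt I s (χ q.1 ((extChartAt I s).symm q.2))

variable [IsManifold I ∞ M] [I.Boundaryless]

lemma contDiffAt_chartFlow {χ : ℝ → M → M} {s m : M} {t : ℝ} {x : E}
    (hx : x ∈ (extChartAt I s).target) (hm : (extChartAt I s).symm x = m)
    (hχm : χ t m ∈ (extChartAt I s).source)
    (hχ : ContMDiffAt (𝓘(ℝ, ℝ).prod I) I ∞ (fun q : ℝ × M => χ q.1 q.2) (t, m)) :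
    ContDiffAt ℝ ∞ (chartFlow I χ s) (t, x) := by
  subst hm
  have h1 : ContMDiffAt 𝓘(ℝ, ℝ × E) (𝓘(ℝ, ℝ).prod I) ∞
      (fun q : ℝ × E => (q.1, (extChartAt I s).symm q.2)) (t, x) :=
    contDiff_fst.contMDiff.contMDiffAt.prodMk
      (ContMDiffAt.comp (t, x) (contMDiffAt_chart_symm hx) contDiff_snd.contMDiff.contMDiffAt)
  have h2 := ContMDiffAt.comp (t, x) (g := fun p : ℝ × M => χ p.1 p.2) hχ h1
  exact (ContMDiffAt.comp (t, x) (contMDiffAt_chart hχm) h2).contDiffAt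

lemma spaceDeriv_chartFlow {χ : ℝ → M → M} {s m : M} {t : ℝ} {x : E}
    (hx : x ∈ (extChartAt I s).target) (hm : (extChartAt I s).symm x = m)
    (hχm : χ t m ∈ (extChartAt I s).source)
    (hχ : ContMDiffAt (𝓘(ℝ, ℝ).prod I) I ∞ (fun q : ℝ × M => χ q.1 q.2) (t, m))
    (w : TangentSpace I m) :
    spaceDeriv (chartFlow I χ s) (t, x) (chartDiff I s m w) =
      chartDiff I s (χ t m) (mfderiv I I (χ t) m w) := by
  have h0 := contDiffAt_chartFlow hx hm hχm hχ
  subst hm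
  have h1 := ((contMDiffAt_chart_symm hx).mdifferentiableAt (by simp)).hasMFDerivAt
  have h2 : ContMDiffAt I I ∞ (χ t) ((extChartAt I s).symm x) :=
    ContMDiffAt.comp ((extChartAt I s).symm x) (g := fun q : ℝ × M => χ q.1 q.2) hχ
      (contMDiffAt_const.prodMk contMDiffAt_id)
  have h3 := ((contMDiffAt_chart hχm).mdifferentiableAt (by simp)).hasMFDerivAt
  have h4 := hasMFDerivAt_iff_hasFDerivAt.1
    (h3.comp x ((h2.mdifferentiableAt (by simp)).hasMFDerivAt.comp x h1))
  have h5 := congrArg (fun A => A (chartDiff I s ((extChartAt I s).symm x) w))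
    ((hasFDerivAt_space (h0.differentiableAt (by simp))).unique h4)
  refine h5.trans ?_
  exact congrArg (fun v => chartDiff I s (χ t ((extChartAt I s).symm x))
    (mfderiv I I (χ t) ((extChartAt I s).symm x) v)) (chartSymmDiff_comp_chartDiff hx w)

end SpaceTime

section Straightening

set_option synthInstance.maxHeartbeats 200000

variable {E : Type*} [NormedAddCommGroup E] [NormedSpace ℝ E] [FiniteDimensional ℝ E]
  {H : Type*} [TopologicalSpace H] {I : ModelWithCorners ℝ E H} [I.Boundaryless]
  {M : Type*} [TopologicalSpace M] [ChartedSpace H M] [IsManifold I ∞ M]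
  {EB : Type*} [NormedAddCommGroup EB] [NormedSpace ℝ EB] [FiniteDimensional ℝ EB]
  {B : Type*} [TopologicalSpace B] [ChartedSpace EB B] [IsManifold 𝓘(ℝ, EB) ∞ B]
  {P : BivectorField I M} {f : ℝ → M → B}

variable (EB) in
/-- `χ` is the flow of the field which compensates the motion of the family `f`, on `N` and for
times in `(a, b)`. -/
structure IsStraighteningFlow (P : BivectorField I M) (f : ℝ → M → B) (a b : ℝ) (N : Set M)
    (χ : ℝ → M → M) : Prop where
  zero : ∀ m ∈ N, χ 0 m = m
  isCurveAt : ∀ t ∈ Ioo a b, ∀ m ∈ N, IsCurveAt (compensatingField EB P f) (fun r => χ r m) t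
  isLocalDiffeomorphAt : ∀ p ∈ Ioo a b ×ˢ N,
    IsLocalDiffeomorphAt (𝓘(ℝ, ℝ).prod I) (𝓘(ℝ, ℝ).prod I) ∞ (suspension χ) p

namespace IsTransverseChart

variable {s : M} {b₀ : B} {a b : ℝ} {U : Set E} {N : Set M} {χ : ℝ → M → M}

lemma isCompensatingFlow (h : IsTransverseChart P EB f s b₀ (Ioo a b) U) (ha : a < 0) (hb : 1 < b)
    (hN : IsOpen N) (hχ : IsStraighteningFlow EB P f a b N χ)
    (hU : ∀ t ∈ Ioo a b, ∀ m ∈ N, χ t m ∈ (extChartAt I s).source ∧ extChartAt I s (χ t m) ∈ U) :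
    IsCompensatingFlow (chartBivector P s) (chartFamily I EB f s b₀) (Ioo a b ×ˢ U) a b
      ((extChartAt I s).target ∩ (extChartAt I s).symm ⁻¹' N) (chartFlow I χ s) where
  isOpen := (contMDiffOn_chart_symm s).continuousOn.isOpen_inter_preimage
    (isOpen_extChartAt_target s) hN
  contDiffOn := by
    rintro ⟨t, x⟩ ⟨ht, hx⟩
    exact (contDiffAt_chartFlow hx.1 rfl (hU t ht _ hx.2).1
      (contMDiffAt_of_suspension (hχ.isLocalDiffeomorphAt _ ⟨ht, hx.2⟩))).contDiffWithinAt
  zero y hy := by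
    change extChartAt I s (χ 0 ((extChartAt I s).symm y)) = y
    rw [hχ.zero _ hy.2, (extChartAt I s).right_inv hy.1]
  mem t ht y hy := ⟨ht, (hU t ht _ hy.2).2⟩
  timeDeriv_eq t ht y hy := by
    have h1 := (h.isChartField ⟨0, ha, by linarith⟩).hasDerivAt ht (hU t ht _ hy.2).1
      (hU t ht _ hy.2).2 (hχ.isCurveAt t ht _ hy.2)
    exact (hasDerivAt_time ((contDiffAt_chartFlow hy.1 rfl (hU t ht _ hy.2).1
      (contMDiffAt_of_suspension (hχ.isLocalDiffeomorphAt _ ⟨ht, hy.2⟩))).differentiableAt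
        (by simp))).unique h1

/-- The flow of the compensating field freezes the family `f`. -/
lemma apply_flow_eq (h : IsTransverseChart P EB f s b₀ (Ioo a b) U) (ha : a < 0) (hb : 1 < b)
    (hN : IsOpen N) (hNs : N ⊆ (extChartAt I s).source) (hχ : IsStraighteningFlow EB P f a b N χ)
    (hU : ∀ t ∈ Ioo a b, ∀ m ∈ N, χ t m ∈ (extChartAt I s).source ∧ extChartAt I s (χ t m) ∈ U)
    {t : ℝ} (ht : t ∈ Ioo a b) {m : M} (hm : m ∈ N) : f t (χ t m) = f 0 m := by
  have h0 : (0 : ℝ) ∈ Ioo a b := ⟨ha, by linarith⟩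
  have hinv := (extChartAt I s).left_inv (hNs hm)
  have h1 := h.isTransverseFamily.apply_compensatingFlow_eq ha (zero_lt_one.trans hb)
    (h.isCompensatingFlow ha hb hN hχ hU) ht (y := extChartAt I s m)
    ⟨(extChartAt I s).map_source (hNs hm), by rwa [mem_preimage, hinv]⟩
  have h2 := h.isChartPoint t ht _ (hU t ht m hm).2
  have h3 := h.isChartPoint 0 h0 _ (hU 0 h0 m hm).2
  have h4 := h2.mem_source
  have h5 := h3.mem_source
  rw [(extChartAt I s).left_inv (hU t ht m hm).1] at h4
  rw [(extChartAt I s).left_inv (hU 0 h0 m hm).1, hχ.zero m hm] at h5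
  refine (extChartAt 𝓘(ℝ, EB) b₀).injOn h4 h5 ?_
  have h6 : extChartAt 𝓘(ℝ, EB) b₀ (f t ((extChartAt I s).symm (extChartAt I s
    (χ t ((extChartAt I s).symm (extChartAt I s m)))))) =
      extChartAt 𝓘(ℝ, EB) b₀ (f 0 ((extChartAt I s).symm (extChartAt I s m))) := h1
  rwa [hinv, (extChartAt I s).left_inv (hU t ht m hm).1] at h6

/-- The flow of the compensating field transports the value of `P` on adapted covectors. -/
lemma eval_flow_eq (h : IsTransverseChart P EB f s b₀ (Ioo a b) U) (ha : a < 0) (hb : 1 < b)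
    (hN : IsOpen N) (hNs : N ⊆ (extChartAt I s).source) (hχ : IsStraighteningFlow EB P f a b N χ)
    (hU : ∀ t ∈ Ioo a b, ∀ m ∈ N, χ t m ∈ (extChartAt I s).source ∧ extChartAt I s (χ t m) ∈ U)
    {m : M} (hm : m ∈ N) {α α' β β' : Cotangent I (χ 1 m)} {α₀ β₀ : Cotangent I m}
    (hα : IsAdapted (P.sharp (χ 1 m)) (mapDiff I EB f 1 (χ 1 m)) α α')
    (hβ : IsAdapted (P.sharp (χ 1 m)) (mapDiff I EB f 1 (χ 1 m)) β β')
    (hα₀ : IsAdapted (P.sharp m) (mapDiff I EB f 0 m)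
      (α ∘ₗ (mfderiv I I (χ 1) m).toLinearMap) α₀)
    (hβ₀ : IsAdapted (P.sharp m) (mapDiff I EB f 0 m)
      (β ∘ₗ (mfderiv I I (χ 1) m).toLinearMap) β₀) :
    P.eval (χ 1 m) α' β' = P.eval m α₀ β₀ := by
  have h0ab : (0 : ℝ) ∈ Ioo a b := ⟨ha, by linarith⟩
  have h1ab : (1 : ℝ) ∈ Ioo a b := ⟨by linarith, hb⟩
  have hinv := (extChartAt I s).left_inv (hNs hm)
  have hflow := h.isCompensatingFlow ha hb hN hχ hU
  set x := extChartAt I s m with hx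
  have hxt : x ∈ (extChartAt I s).target := (extChartAt I s).map_source (hNs hm)
  have hxN : x ∈ (extChartAt I s).target ∩ (extChartAt I s).symm ⁻¹' N :=
    ⟨hxt, by rwa [mem_preimage, hinv]⟩
  have hy : chartFlow I χ s (1, x) = extChartAt I s (χ 1 m) := by
    change extChartAt I s (χ 1 ((extChartAt I s).symm x)) = _
    rw [hinv]
  have hsymm : (extChartAt I s).symm (chartFlow I χ s (1, x)) = χ 1 m := by
    rw [hy, (extChartAt I s).left_inv (hU 1 h1ab m hm).1]
  have hpt0 : IsChartPoint I EB f s b₀ 0 x := by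
    have := h.isChartPoint 0 h0ab _ (hU 0 h0ab m hm).2
    rwa [hχ.zero m hm] at this
  have hpt1 : IsChartPoint I EB f s b₀ 1 (chartFlow I χ s (1, x)) := by
    rw [hy]; exact h.isChartPoint 1 h1ab _ (hU 1 h1ab m hm).2
  have hsm : ∀ t ∈ Ioo a b,
      ContMDiffAt (𝓘(ℝ, ℝ).prod I) I ∞ (fun q : ℝ × M => χ q.1 q.2) (t, m) := fun t ht =>
    contMDiffAt_of_suspension (hχ.isLocalDiffeomorphAt _ ⟨ht, hm⟩)
  have hsp : ∀ t ∈ Ioo a b, ∀ w, spaceDeriv (chartFlow I χ s) (t, x) (chartDiff I s m w) =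
      chartDiff I s (χ t m) (mfderiv I I (χ t) m w) := fun t ht w =>
    spaceDeriv_chartFlow hxt hinv (hU t ht m hm).1 (hsm t ht) w
  have hinj : ∀ t ∈ Ioo a b, Function.Injective (spaceDeriv (chartFlow I χ s) (t, x)) := by
    intro t ht u v huv
    obtain ⟨u, rfl⟩ := chartDiff_surjective (I := I) (hNs hm) u
    obtain ⟨v, rfl⟩ := chartDiff_surjective (I := I) (hNs hm) v
    rw [hsp t ht, hsp t ht] at huv
    rw [injective_mfderiv_of_suspension (hχ.isLocalDiffeomorphAt _ ⟨ht, hm⟩)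
      (chartDiff_injective (hU t ht m hm).1 huv)]
  have hker : ∀ w, spaceDeriv (chartFamily I EB f s b₀) (0, x) (chartDiff I s m w) = 0 →
      spaceDeriv (chartFamily I EB f s b₀) (1, chartFlow I χ s (1, x))
        (chartDiff I s (χ 1 m) (mfderiv I I (χ 1) m w)) = 0 := by
    intro w hw
    rw [← hsp 1 h1ab, h.isTransverseFamily.spaceDeriv_compensatingFlow ha (zero_lt_one.trans hb)
      hflow h1ab hxN, hw]
  obtain ⟨a₁, ha₁, ha₁L, ha₁ker⟩ := hpt1.exists_flat_adapted hsymm hα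
  obtain ⟨b₁, hb₁, hb₁L, hb₁ker⟩ := hpt1.exists_flat_adapted hsymm hβ
  obtain ⟨a₀, ha₀, ha₀L, ha₀ker⟩ := hpt0.exists_flat_adapted hinv hα₀
  obtain ⟨c₀, hc₀, hc₀L, hc₀ker⟩ := hpt0.exists_flat_adapted hinv hβ₀
  have key := h.isTransverseFamily.eval_flow_eq ha hb hflow hxN hinj (α₀ := a₀) (α₁ := a₁)
    (β₀ := c₀) (β₁ := b₁) (by
      intro u hu
      obtain ⟨w, rfl⟩ := chartDiff_surjective (I := I) (hNs hm) u
      rw [hsp 1 h1ab, ha₀ker w hu, ha₁ker _ (hker w hu)]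
      rfl) (by
      intro u hu
      obtain ⟨w, rfl⟩ := chartDiff_surjective (I := I) (hNs hm) u
      rw [hsp 1 h1ab, hc₀ker w hu, hb₁ker _ (hker w hu)]
      rfl) ha₀L hc₀L ha₁L hb₁L
  rw [chartBivector_eval hinv ha₀ hc₀] at key
  rw [← key]
  exact (chartBivector_eval hsymm ha₁ hb₁).symm

end IsTransverseChart

/-- A family `f t` of maps to `B` which is constant on `S`, with fibres transversal to a Poisson
tensor `P` along `S`, is made constant near `S` by a flow which transports the value of `P` on
adapted covectors. -/
theorem exists_straightening [T2Space M] {N S : Set M} (hN : IsOpen N) (hP : P.IsPoissonOn N)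
    (hSN : S ⊆ N) {a a' b' b : ℝ} (ha : a < a') (hb : b' < b) (ha' : a' < 0) (hb' : 1 < b')
    (hf : ∀ t ∈ Ioo a b, ∀ m ∈ N, ContMDiffAt (𝓘(ℝ, ℝ).prod I) 𝓘(ℝ, EB) ∞
      (fun p : ℝ × M => f p.1 p.2) (t, m))
    (hfS : ∀ t ∈ Ioo a b, ∀ s ∈ S, f t s = f 0 s)
    (htr : ∀ t ∈ Ioo a b, ∀ s ∈ S, IsTransverse (P.sharp s) (mapDiff I EB f t s)) :
    ∃ (N' : Set M) (χ : ℝ → M → M), IsOpen N' ∧ S ⊆ N' ∧ (∀ m ∈ N', χ 0 m = m) ∧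
      (∀ t ∈ Ioo a' b', ∀ s ∈ S, χ t s = s) ∧ (∀ t ∈ Ioo a' b', ∀ m ∈ N', χ t m ∈ N) ∧
      (∀ t ∈ Ioo a' b', InjOn (χ t) N') ∧
      (∀ p ∈ Ioo a' b' ×ˢ N', IsLocalDiffeomorphAt (𝓘(ℝ, ℝ).prod I) (𝓘(ℝ, ℝ).prod I) ∞
        (suspension χ) p) ∧
      (∀ t ∈ Ioo a' b', ∀ m ∈ N', f t (χ t m) = f 0 m) ∧
      ∀ m ∈ N', ∀ (α α' β β' : Cotangent I (χ 1 m)) (α₀ β₀ : Cotangent I m),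
        IsAdapted (P.sharp (χ 1 m)) (mapDiff I EB f 1 (χ 1 m)) α α' →
        IsAdapted (P.sharp (χ 1 m)) (mapDiff I EB f 1 (χ 1 m)) β β' →
        IsAdapted (P.sharp m) (mapDiff I EB f 0 m) (α ∘ₗ (mfderiv I I (χ 1) m).toLinearMap) α₀ →
        IsAdapted (P.sharp m) (mapDiff I EB f 0 m) (β ∘ₗ (mfderiv I I (χ 1) m).toLinearMap) β₀ →
        P.eval (χ 1 m) α' β' = P.eval m α₀ β₀ := by
  obtain ⟨a₁, haa₁, ha₁⟩ := exists_between ha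
  obtain ⟨a₂, ha₁₂, ha₂⟩ := exists_between ha₁
  obtain ⟨b₁, hb₁, hbb₁⟩ := exists_between hb
  obtain ⟨b₂, hb₂, hb₂₁⟩ := exists_between hb₁
  have h0 : (0 : ℝ) ∈ Ioo a b := ⟨by linarith, by linarith⟩
  choose! U hsU hchart hUN using fun s (hs : s ∈ S) =>
    exists_isTransverseChart (EB := EB) hN hP haa₁ hbb₁ hf (hSN hs)
      (fun t ht => hfS t ht s hs) (fun t ht => htr t ht s hs)
  let D : M → Set M := fun s => (extChartAt I s).source ∩ extChartAt I s ⁻¹' U s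
  have hDo : ∀ s ∈ S, IsOpen (D s) := fun s hs =>
    (contMDiffOn_chart s).continuousOn.isOpen_inter_preimage (isOpen_extChartAt_source s)
      (hchart s hs).isOpen
  have hsD : ∀ s ∈ S, s ∈ D s := fun s hs => ⟨mem_extChartAt_source s, hsU s hs⟩
  have hfield : IsSmoothField (compensatingField EB P f) (Ioo a₁ b₁) (⋃ s ∈ S, D s) := by
    intro m hm
    obtain ⟨s, hs, hm⟩ := mem_iUnion₂.1 hm
    exact ⟨s, U s, _, (hchart s hs).isChartField ⟨0, by constructor <;> linarith⟩, hm⟩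
  have hzero : ∀ t ∈ Ioo a₁ b₁, ∀ s ∈ S, compensatingField EB P f t s = 0 := by
    intro t ht s hs
    have h1 : HasMFDerivAt 𝓘(ℝ, ℝ) 𝓘(ℝ, EB) (fun r => f r s) t 0 := by
      refine (hasMFDerivAt_const (f 0 s) t).congr_of_eventuallyEq ?_
      filter_upwards [isOpen_Ioo.mem_nhds
        (show t ∈ Ioo a b from ⟨haa₁.trans ht.1, ht.2.trans hbb₁⟩)] with r hr using hfS r hr s hs
    have h2 : velocity EB f t s = 0 := congrArg (fun A => A (1 : ℝ)) h1.mfderiv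
    rw [compensatingField, h2, neg_zero, leafVector_zero]
  obtain ⟨N₁, χ, hN₁, hSN₁, hχ0, hχfix, hχ, hinj, hdiff⟩ := exists_flow_near ha₁₂ hb₂₁
    (by linarith) (by linarith) (isOpen_biUnion hDo) hfield
    (fun s hs => mem_biUnion hs (hsD s hs)) hzero
  have hsub : Ioo a' b' ⊆ Ioo a₂ b₂ := Ioo_subset_Ioo ha₂.le hb₂.le
  -- near `s`, the flow stays in the chart at `s` for all times
  have hloc : ∀ s ∈ S, ∃ N₂, IsOpen N₂ ∧ s ∈ N₂ ∧ N₂ ⊆ N₁ ∧ N₂ ⊆ (extChartAt I s).source ∧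
      ∀ t ∈ Ioo a' b', ∀ m ∈ N₂, χ t m ∈ D s := by
    intro s hs
    have hcont : ContinuousOn (fun q : ℝ × M => χ q.1 q.2) (Ioo a₂ b₂ ×ˢ N₁) := fun q hq =>
      (contMDiffAt_of_suspension (hdiff q hq)).continuousAt.continuousWithinAt
    obtain ⟨A, N₂, -, hN₂, hA, hsN₂, hsub₂⟩ := generalized_tube_lemma
      (isCompact_Icc (a := a') (b := b')) (isCompact_singleton (x := s))
      (hcont.isOpen_inter_preimage (isOpen_Ioo.prod hN₁) (hDo s hs)) (by
        rintro ⟨t, m⟩ ⟨ht, hm⟩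
        obtain rfl : m = s := hm
        have ht' : t ∈ Ioo a₂ b₂ := ⟨ha₂.trans_le ht.1, ht.2.trans_lt hb₂⟩
        refine ⟨⟨ht', hSN₁ hs⟩, ?_⟩
        change χ t m ∈ D m
        rw [hχfix t ht' m hs]
        exact hsD m hs)
    refine ⟨N₂ ∩ (extChartAt I s).source, hN₂.inter (isOpen_extChartAt_source s),
      ⟨hsN₂ rfl, mem_extChartAt_source s⟩, fun m hm => ?_, inter_subset_right, fun t ht m hm => ?_⟩
    · exact (@hsub₂ (0, m) ⟨hA ⟨ha'.le, by linarith⟩, hm.1⟩).1.2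
    · exact (@hsub₂ (t, m) ⟨hA (Ioo_subset_Icc_self ht), hm.1⟩).2
  choose! N₂ hN₂ hsN₂ hN₂₁ hN₂s hN₂D using hloc
  have hflow : ∀ s ∈ S, IsStraighteningFlow EB P f a' b' (N₂ s) χ := fun s hs =>
    ⟨fun m hm => hχ0 m (hN₂₁ s hs hm), fun t ht m hm => (hχ t (hsub ht) m (hN₂₁ s hs hm)).2,
      fun p hp => hdiff p ⟨hsub hp.1, hN₂₁ s hs hp.2⟩⟩
  have hchart' : ∀ s ∈ S, IsTransverseChart P EB f s (f 0 s) (Ioo a' b') (U s) := by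
    intro s hs
    have hsub' : Ioo a' b' ⊆ Ioo a₁ b₁ := Ioo_subset_Ioo ha₁.le hb₁.le
    have h1 := hchart s hs
    exact ⟨h1.isOpen, fun t ht => h1.isChartPoint t (hsub' ht),
      ⟨isOpen_Ioo.prod h1.isOpen, h1.isTransverseFamily.isFlatPoisson.imp fun O hO =>
        ⟨hO.1, fun q hq => hO.2 q ⟨hsub' hq.1, hq.2⟩⟩,
        h1.isTransverseFamily.contDiffOn.mono (prod_mono hsub' le_rfl),
        fun q hq => h1.isTransverseFamily.isInvertible q ⟨hsub' hq.1, hq.2⟩⟩⟩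
  have hN'₁ : (⋃ s ∈ S, N₂ s) ⊆ N₁ := iUnion₂_subset hN₂₁
  refine ⟨⋃ s ∈ S, N₂ s, χ, isOpen_biUnion hN₂, fun s hs => mem_biUnion hs (hsN₂ s hs),
    fun m hm => hχ0 m (hN'₁ hm), fun t ht => hχfix t (hsub ht), ?_,
    fun t ht => (hinj t (hsub ht)).mono hN'₁, fun p hp => hdiff p ⟨hsub hp.1, hN'₁ hp.2⟩, ?_, ?_⟩
  · intro t ht m hm
    obtain ⟨s, hs, hm⟩ := mem_iUnion₂.1 hm
    have h1 := hN₂D s hs t ht m hm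
    have h2 := hUN s hs _ h1.2
    rwa [(extChartAt I s).left_inv h1.1] at h2
  · intro t ht m hm
    obtain ⟨s, hs, hm⟩ := mem_iUnion₂.1 hm
    exact (hchart' s hs).apply_flow_eq ha' hb' (hN₂ s hs) (hN₂s s hs) (hflow s hs)
      (hN₂D s hs) ht hm
  · intro m hm α α' β β' α₀ β₀ hα hβ hα₀ hβ₀
    obtain ⟨s, hs, hm⟩ := mem_iUnion₂.1 hm
    exact (hchart' s hs).eval_flow_eq ha' hb' (hN₂ s hs) (hN₂s s hs) (hflow s hs)
      (hN₂D s hs) hm hα hβ hα₀ hβ₀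

end Straightening

/-! ### Isotopies and their generating fields -/

/-- An injective local diffeomorphism is a diffeomorphism onto its image. -/
lemma exists_partialDiffeomorph {E E' H H' X Y : Type*} [NormedAddCommGroup E] [NormedSpace ℝ E]
    [NormedAddCommGroup E'] [NormedSpace ℝ E'] [TopologicalSpace H] [TopologicalSpace H']
    {I : ModelWithCorners ℝ E H} {J : ModelWithCorners ℝ E' H'} [TopologicalSpace X]
    [ChartedSpace H X] [TopologicalSpace Y] [ChartedSpace H' Y] [Nonempty X] {f : X → Y}
    {U : Set X} (hU : IsOpen U) (hinj : InjOn f U)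
    (hf : ∀ x ∈ U, IsLocalDiffeomorphAt I J ∞ f x) :
    ∃ e : PartialDiffeomorph I J X Y ∞, e.source = U ∧ e.target = f '' U ∧ EqOn f e U := by
  have hloc : ∀ y ∈ f '' U, ∃ V ∈ 𝓝 y, V ⊆ f '' U ∧ ∃ h : Y → X, ContMDiffAt J I ∞ h y ∧
      ∀ z ∈ V, Function.invFunOn f U z = h z := by
    rintro _ ⟨x, hx, rfl⟩
    obtain ⟨Φ, hxΦ, hΦ⟩ := hf x hx
    have hfx : f x = Φ.toFun x := hΦ hxΦ
    have hinv : Φ.invFun (f x) = x := by rw [hfx]; exact Φ.left_inv' hxΦ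
    have hfxt : f x ∈ Φ.target := by rw [hfx]; exact Φ.map_source' hxΦ
    have hV : IsOpen (Φ.target ∩ Φ.invFun ⁻¹' U) :=
      Φ.contMDiffOn_invFun.continuousOn.isOpen_inter_preimage Φ.open_target hU
    have hright : ∀ z ∈ Φ.target, f (Φ.invFun z) = z := fun z hz =>
      (hΦ (Φ.map_target' hz)).trans (Φ.right_inv' hz)
    refine ⟨_, hV.mem_nhds ⟨hfxt, by rw [mem_preimage, hinv]; exact hx⟩,
      fun z hz => ⟨_, hz.2, hright z hz.1⟩, Φ.invFun,
      Φ.contMDiffOn_invFun.contMDiffAt (Φ.open_target.mem_nhds hfxt), fun z hz => ?_⟩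
    have hmem : z ∈ f '' U := ⟨_, hz.2, hright z hz.1⟩
    exact hinj (Function.invFunOn_mem hmem) hz.2
      ((Function.invFunOn_eq hmem).trans (hright z hz.1).symm)
  refine ⟨{ toFun := f
            invFun := Function.invFunOn f U
            source := U
            target := f '' U
            map_source' := fun x hx => mem_image_of_mem f hx
            map_target' := fun y hy => Function.invFunOn_mem hy
            left_inv' := fun x hx => hinj.leftInvOn_invFunOn hx
            right_inv' := fun y hy => Function.invFunOn_eq hy
            open_source := hU
            open_target := isOpen_iff_mem_nhds.2 fun y hy => by
              obtain ⟨V, hV, hVU, -⟩ := hloc y hy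
              exact Filter.mem_of_superset hV hVU
            contMDiffOn_toFun := fun x hx => (hf x hx).contMDiffAt.contMDiffWithinAt
            contMDiffOn_invFun := fun y hy => by
              obtain ⟨V, hV, -, h, hh, heq⟩ := hloc y hy
              exact (hh.congr_of_eventuallyEq
                (Filter.mem_of_superset hV heq)).contMDiffWithinAt }, rfl, rfl, fun _ _ => rfl⟩

/-- A tube lemma for `[c, d] × S`, where `S` need not be compact: the width of the tube may vary
along `S`. -/
lemma exists_tube {M : Type*} [TopologicalSpace M] {S : Set M} {Ω : Set (ℝ × M)} (hΩ : IsOpen Ω)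
    {c d : ℝ} (h : ∀ t ∈ Icc c d, ∀ s ∈ S, (t, s) ∈ Ω) :
    ∃ W, IsOpen W ∧ S ⊆ W ∧ Icc c d ×ˢ W ⊆ Ω := by
  have h1 : ∀ s ∈ S, ∃ W, IsOpen W ∧ s ∈ W ∧ Icc c d ×ˢ W ⊆ Ω := by
    intro s hs
    obtain ⟨A, W, -, hW, hA, hsW, hsub⟩ := generalized_tube_lemma
      (isCompact_Icc (a := c) (b := d)) (isCompact_singleton (x := s)) hΩ (by
        rintro ⟨t, m⟩ ⟨ht, hm⟩
        obtain rfl : m = s := hm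
        exact h t ht m hs)
    exact ⟨W, hW, hsW rfl, (prod_mono hA le_rfl).trans hsub⟩
  choose! W hW hsW hsub using h1
  refine ⟨⋃ s ∈ S, W s, isOpen_biUnion hW, fun s hs => mem_biUnion hs (hsW s hs), ?_⟩
  rintro ⟨t, m⟩ ⟨ht, hm⟩
  obtain ⟨s, hs, hm⟩ := mem_iUnion₂.1 hm
  exact hsub s hs ⟨ht, hm⟩

section GeneratingField

variable {E : Type*} [NormedAddCommGroup E] [NormedSpace ℝ E]
  {H : Type*} [TopologicalSpace H] {I : ModelWithCorners ℝ E H}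
  {M : Type*} [TopologicalSpace M] [ChartedSpace H M]

variable (I) in
/-- The time derivative of a time-dependent map `Ψ` of `M` to itself, at the point `q` of
space-time. -/
def flowVelocity (Ψ : ℝ → M → M) (q : ℝ × M) : TangentSpace I (Ψ q.1 q.2) :=
  mfderiv (𝓘(ℝ, ℝ).prod I) I (fun p : ℝ × M => Ψ p.1 p.2) q ((1 : ℝ), (0 : E))

lemma hasMFDerivAt_of_flowVelocity {Ψ : ℝ → M → M} {t : ℝ} {m : M}
    (h : MDifferentiableAt (𝓘(ℝ, ℝ).prod I) I (fun p : ℝ × M => Ψ p.1 p.2) (t, m)) :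
    HasMFDerivAt 𝓘(ℝ, ℝ) I (fun r => Ψ r m) t
      ((1 : ℝ →L[ℝ] ℝ).smulRight (flowVelocity I Ψ (t, m))) := by
  have h1 : HasMFDerivAt 𝓘(ℝ, ℝ) (𝓘(ℝ, ℝ).prod I) (fun r : ℝ => (r, m)) t _ :=
    (hasMFDerivAt_id t).prodMk (hasMFDerivAt_const m t)
  refine (HasMFDerivAt.comp t (g := fun p : ℝ × M => Ψ p.1 p.2) h.hasMFDerivAt h1).congr_mfderiv ?_
  refine ContinuousLinearMap.ext fun r => ?_
  have h2 : ((r, 0) : ℝ × E) = (show ℝ from r) • ((1 : ℝ), (0 : E)) := by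
    rw [Prod.smul_mk, smul_zero]
    exact Prod.ext (mul_one (show ℝ from r)).symm rfl
  exact (congrArg (mfderiv (𝓘(ℝ, ℝ).prod I) I (fun p : ℝ × M => Ψ p.1 p.2) (t, m)) h2).trans
    (ContinuousLinearMap.map_smul
      (mfderiv (𝓘(ℝ, ℝ).prod I) I (fun p : ℝ × M => Ψ p.1 p.2) (t, m)) _ _)

/-- If `f ∘ Ψ t` does not depend on `t` then the velocity of `Ψ` is tangent to the fibres
of `f`. -/
lemma mfderiv_flowVelocity_eq_zero {E' H' M' : Type*} [NormedAddCommGroup E'] [NormedSpace ℝ E']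
    [TopologicalSpace H'] {I' : ModelWithCorners ℝ E' H'} [TopologicalSpace M']
    [ChartedSpace H' M'] {f : M → M'} {Ψ : ℝ → M → M} {t : ℝ} {m : M}
    (h : MDifferentiableAt (𝓘(ℝ, ℝ).prod I) I (fun p : ℝ × M => Ψ p.1 p.2) (t, m))
    (hf : MDifferentiableAt I I' f (Ψ t m)) {y : M'} (hconst : ∀ᶠ r in 𝓝 t, f (Ψ r m) = y) :
    mfderiv I I' f (Ψ t m) (flowVelocity I Ψ (t, m)) = 0 := by
  have h1 := HasMFDerivAt.comp t (g := f) hf.hasMFDerivAt (hasMFDerivAt_of_flowVelocity h)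
  have h2 : HasMFDerivAt 𝓘(ℝ, ℝ) I' (fun r => f (Ψ r m)) t 0 :=
    (hasMFDerivAt_const y t).congr_of_eventuallyEq hconst
  have h3 := congrArg (fun A => A (1 : ℝ)) (hasMFDerivAt_unique h1 h2)
  refine Eq.trans ?_ h3
  exact congrArg (mfderiv I I' f (Ψ t m)) (one_smul ℝ (flowVelocity I Ψ (t, m))).symm

variable [IsManifold I ∞ M]

/-- The vector field `∂/∂t` on space-time is smooth. -/
lemma contMDiff_timeField : ContMDiff (𝓘(ℝ, ℝ).prod I) (𝓘(ℝ, ℝ).prod I).tangent ∞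
    (fun q : ℝ × M => (⟨q, ((1 : ℝ), (0 : E))⟩ :
      TangentBundle (𝓘(ℝ, ℝ).prod I) (ℝ × M))) := by
  have h1 : ContMDiff 𝓘(ℝ, ℝ) 𝓘(ℝ, ℝ).tangent ∞
      (fun t : ℝ => (⟨t, (1 : ℝ)⟩ : TangentBundle 𝓘(ℝ, ℝ) ℝ)) :=
    contMDiff_vectorSpace_iff_contDiff.2 contDiff_const
  have h2 : ContMDiff I I.tangent ∞ (fun m : M => (⟨m, (0 : E)⟩ : TangentBundle I M)) :=
    Bundle.contMDiff_zeroSection ℝ (TangentSpace I : M → Type _)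
  exact contMDiff_equivTangentBundleProd_symm.comp
    ((h1.comp contMDiff_fst).prodMk (h2.comp contMDiff_snd))

lemma contMDiffOn_flowVelocity {Ψ : ℝ → M → M} {D : Set (ℝ × M)} (hD : IsOpen D)
    (h : ContMDiffOn (𝓘(ℝ, ℝ).prod I) I ∞ (fun p : ℝ × M => Ψ p.1 p.2) D) :
    ContMDiffOn (𝓘(ℝ, ℝ).prod I) I.tangent ∞
      (fun p : ℝ × M => (⟨Ψ p.1 p.2, flowVelocity I Ψ p⟩ : TangentBundle I M)) D := by
  have h1 := (h.contMDiffOn_tangentMapWithin (m := ∞) (by simp) hD.uniqueMDiffOn).comp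
    contMDiff_timeField.contMDiffOn (fun q hq => hq)
  refine h1.congr fun q hq => ?_
  exact congrArg (fun A : ℝ × E →L[ℝ] E => (⟨Ψ q.1 q.2, A (1, 0)⟩ : TangentBundle I M))
    (mfderivWithin_of_isOpen hD hq).symm

/-- An isotopy `Ψ` relative to `S`, defined near `S` and starting at the identity, is the flow of
the time-dependent vector field `Y t = (∂ₜ Ψ) ∘ Ψ t ⁻¹`; the latter is tangent to the fibres of
every map that is invariant under `Ψ`. -/
theorem exists_generating_field [Nonempty M] {S N : Set M} (hN : IsOpen N) (hSN : S ⊆ N)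
    {a b : ℝ} (ha : a < 0) (hb : 1 < b) {Ψ : ℝ → M → M} (h0 : ∀ m ∈ N, Ψ 0 m = m)
    (hS : ∀ t ∈ Ioo a b, ∀ s ∈ S, Ψ t s = s) (hinj : ∀ t ∈ Ioo a b, InjOn (Ψ t) N)
    (hdiff : ∀ p ∈ Ioo a b ×ˢ N, IsLocalDiffeomorphAt (𝓘(ℝ, ℝ).prod I) (𝓘(ℝ, ℝ).prod I) ∞
      (suspension Ψ) p)
    {E' H' M' : Type*} [NormedAddCommGroup E'] [NormedSpace ℝ E']
    [TopologicalSpace H'] {I' : ModelWithCorners ℝ E' H'} [TopologicalSpace M']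
    [ChartedSpace H' M'] {f : M → M'} (hf : MDifferentiable I I' f)
    (hfΨ : ∀ t ∈ Ioo a b, ∀ m ∈ N, f (Ψ t m) = f m) :
    IsDiffeoGerm I S (Ψ 1) ∧ ∃ (W : Set M) (Y : ℝ → ∀ m : M, TangentSpace I m),
      IsOpen W ∧ S ⊆ W ∧ (∀ t ∈ Icc (0 : ℝ) 1, ∀ m ∈ W, mfderiv I I' f m (Y t m) = 0) ∧
        FlowJoinsIdTo I S W Y (Ψ 1) := by
  have h1ab : (1 : ℝ) ∈ Ioo a b := ⟨by linarith, hb⟩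
  have hIcc : Icc (0 : ℝ) 1 ⊆ Ioo a b := fun t ht => ⟨ha.trans_le ht.1, ht.2.trans_lt hb⟩
  have hD : IsOpen (Ioo a b ×ˢ N) := isOpen_Ioo.prod hN
  obtain ⟨Θ, hΘs, hΘt, hΘ⟩ := exists_partialDiffeomorph hD (f := suspension Ψ) (by
    rintro ⟨t, m⟩ ⟨ht, hm⟩ ⟨t', m'⟩ ⟨ht', hm'⟩ h
    obtain rfl : t = t' := congrArg Prod.fst h
    exact Prod.ext rfl (hinj t ht hm hm' (congrArg Prod.snd h))) hdiff
  let σ : ℝ × M → M := fun q => (Θ.invFun q).2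
  -- `σ` is the inverse of `Ψ`, with time as a parameter
  have hσ : ∀ q ∈ Θ.target, q.1 ∈ Ioo a b ∧ σ q ∈ N ∧ Ψ q.1 (σ q) = q.2 ∧
      Θ.invFun q = (q.1, σ q) := by
    intro q hq
    have h1 := Θ.map_target' hq
    have h2 : suspension Ψ (Θ.invFun q) = q := (hΘ (hΘs ▸ h1)).trans (Θ.right_inv' hq)
    have h3 : (suspension Ψ (Θ.invFun q)).1 = q.1 := congrArg Prod.fst h2
    change (Θ.invFun q).1 = q.1 at h3
    have h4 : (suspension Ψ (Θ.invFun q)).2 = q.2 := congrArg Prod.snd h2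
    change Ψ (Θ.invFun q).1 (σ q) = q.2 at h4
    have h5 : Θ.invFun q ∈ Ioo a b ×ˢ N := hΘs ▸ h1
    rw [h3] at h4
    exact ⟨h3 ▸ h5.1, h5.2, h4, Prod.ext h3 rfl⟩
  have hΨσ : ∀ t ∈ Ioo a b, ∀ m ∈ N, (t, Ψ t m) ∈ Θ.target ∧ σ (t, Ψ t m) = m := by
    intro t ht m hm
    have h1 : (t, m) ∈ Θ.source := hΘs ▸ ⟨ht, hm⟩
    have h2 : (t, Ψ t m) = Θ.toFun (t, m) := @hΘ (t, m) ⟨ht, hm⟩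
    have h3 : Θ.invFun (t, Ψ t m) = (t, m) := by rw [h2]; exact Θ.left_inv' h1
    exact ⟨h2 ▸ Θ.map_source' h1, congrArg Prod.snd h3⟩
  have hσsm : ContMDiffOn (𝓘(ℝ, ℝ).prod I) I ∞ σ Θ.target :=
    contMDiff_snd.comp_contMDiffOn Θ.contMDiffOn_invFun
  have hΨsm : ContMDiffOn (𝓘(ℝ, ℝ).prod I) I ∞ (fun p : ℝ × M => Ψ p.1 p.2) (Ioo a b ×ˢ N) :=
    fun p hp => (contMDiffAt_of_suspension (hdiff p hp)).contMDiffWithinAt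
  have hΨd : ∀ t ∈ Ioo a b, ∀ m ∈ N,
      MDifferentiableAt (𝓘(ℝ, ℝ).prod I) I (fun p : ℝ × M => Ψ p.1 p.2) (t, m) := fun t ht m hm =>
    (contMDiffAt_of_suspension (hdiff (t, m) ⟨ht, hm⟩)).mdifferentiableAt (by simp)
  have hSσ : ∀ t ∈ Ioo a b, ∀ s ∈ S, (t, s) ∈ Θ.target ∧ σ (t, s) = s := by
    intro t ht s hs
    have := hΨσ t ht s (hSN hs)
    rwa [hS t ht s hs] at this
  obtain ⟨W, hW, hSW, hWΘ⟩ := exists_tube (c := 0) (d := 1) Θ.open_target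
    fun t ht s hs => (hSσ t (hIcc ht) s hs).1
  obtain ⟨N', hN', hSN', hN'W⟩ := exists_tube (c := 0) (d := 1)
    (hΨsm.continuousOn.isOpen_inter_preimage hD hW) fun t ht s hs =>
      ⟨⟨hIcc ht, hSN hs⟩, show Ψ t s ∈ W from (hS t (hIcc ht) s hs).symm ▸ hSW hs⟩
  let Y : ℝ → ∀ m : M, TangentSpace I m := fun t m => (flowVelocity I Ψ (t, σ (t, m)) : E)
  -- the values of `Y` at the two descriptions of a point agree
  have hYt : ∀ t n m, Ψ t n = m → σ (t, m) = n →
      (⟨m, Y t m⟩ : TangentBundle I M) = ⟨Ψ t n, flowVelocity I Ψ (t, n)⟩ := by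
    rintro t n m rfl h
    exact congrArg (fun k => (⟨Ψ t n, (flowVelocity I Ψ (t, k) : E)⟩ : TangentBundle I M)) h
  have hYm : ∀ t n m, Ψ t n = m → σ (t, m) = n → ∀ Q : ∀ m : M, TangentSpace I m → Prop,
      Q (Ψ t n) (flowVelocity I Ψ (t, n)) → Q m (Y t m) := by
    rintro t n m rfl h Q hQ
    have h1 : Y t (Ψ t n) = flowVelocity I Ψ (t, n) :=
      congrArg (fun k => (flowVelocity I Ψ (t, k) : E)) h
    rwa [h1]
  refine ⟨⟨?_, fun s hs => hS 1 h1ab s hs⟩, W, Y, hW, hSW, ?_, ?_, ?_, N ∩ N', Ψ,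
    hN.inter hN', subset_inter hSN hSN', hΨsm.mono (prod_mono hIcc inter_subset_left), ?_⟩
  · refine ⟨{ toFun := Ψ 1
              invFun := fun m => σ (1, m)
              source := N
              target := (fun m => ((1 : ℝ), m)) ⁻¹' Θ.target
              map_source' := fun m hm => (hΨσ 1 h1ab m hm).1
              map_target' := fun m hm => (hσ _ hm).2.1
              left_inv' := fun m hm => (hΨσ 1 h1ab m hm).2
              right_inv' := fun m hm => (hσ _ hm).2.2.1
              open_source := hN
              open_target := Θ.open_target.preimage (continuous_const.prodMk continuous_id)
              contMDiffOn_toFun := hΨsm.comp (contMDiff_const.prodMk contMDiff_id).contMDiffOn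
                fun m hm => ⟨h1ab, hm⟩
              contMDiffOn_invFun := hσsm.comp (contMDiff_const.prodMk contMDiff_id).contMDiffOn
                fun m hm => hm }, hSN, fun _ _ => rfl⟩
  · intro t ht m hm
    obtain ⟨h1, h2, h3, -⟩ := hσ _ (@hWΘ (t, m) ⟨ht, hm⟩)
    refine hYm t _ m h3 rfl (fun m v => mfderiv I I' f m v = 0) ?_
    refine mfderiv_flowVelocity_eq_zero (hΨd t h1 _ h2) (hf _) (y := f (σ (t, m))) ?_
    filter_upwards [isOpen_Ioo.mem_nhds h1] with r hr using hfΨ r hr _ h2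
  · have h1 : ContMDiffOn (𝓘(ℝ, ℝ).prod I) (𝓘(ℝ, ℝ).prod I) ∞ (fun q : ℝ × M => (q.1, σ q))
        (Icc 0 1 ×ˢ W) := contMDiffOn_fst.prodMk (hσsm.mono hWΘ)
    refine ((contMDiffOn_flowVelocity hD hΨsm).comp h1 fun q hq => ?_).congr fun q hq => ?_
    · exact ⟨(hσ q (hWΘ hq)).1, (hσ q (hWΘ hq)).2.1⟩
    · exact hYt q.1 (σ q) q.2 (hσ q (hWΘ hq)).2.2.1 rfl
  · intro t ht s hs
    refine hYm t s s (hS t (hIcc ht) s hs) (hSσ t (hIcc ht) s hs).2 (fun m v => v = 0) ?_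
    have h1 := mfderiv_flowVelocity_eq_zero (f := id) (hΨd t (hIcc ht) s (hSN hs))
      mdifferentiableAt_id (y := s) (by
        filter_upwards [isOpen_Ioo.mem_nhds (hIcc ht)] with r hr using hS r hr s hs)
    rwa [mfderiv_id] at h1
  · intro m hm
    refine ⟨h0 m hm.1, rfl, fun t ht => ⟨(@hN'W (t, m) ⟨ht, hm.2⟩).2, ?_⟩⟩
    have h1 := (hasMFDerivAt_of_flowVelocity (hΨd t (hIcc ht) m hm.1)).hasMFDerivWithinAt
      (s := Icc 0 1)
    have h2 : Y t (Ψ t m) = flowVelocity I Ψ (t, m) :=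
      congrArg (fun k => (flowVelocity I Ψ (t, k) : E)) (hΨσ t (hIcc ht) m hm.1).2
    rwa [h2]

end GeneratingField

/-! ### Horizontal nondegeneracy and the vertical part -/

lemma t2Space_totalSpace {B F : Type*} [TopologicalSpace B] [T2Space B] [TopologicalSpace F]
    [T2Space F] (V : B → Type*) [TopologicalSpace (TotalSpace F V)] [∀ b, TopologicalSpace (V b)]
    [FiberBundle F V] : T2Space (TotalSpace F V) := by
  refine ⟨fun x y hxy => ?_⟩
  by_cases h : x.proj = y.proj
  · let e := trivializationAt F V x.proj
    have hx : x ∈ e.source := e.mem_source.2 (FiberBundle.mem_baseSet_trivializationAt' x.proj)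
    have hy : y ∈ e.source := e.mem_source.2
      (h ▸ FiberBundle.mem_baseSet_trivializationAt' x.proj)
    obtain ⟨u, v, hu, hv, hxu, hyv, huv⟩ := t2_separation (e.injOn.ne hx hy hxy)
    refine ⟨e.source ∩ e ⁻¹' u, e.source ∩ e ⁻¹' v,
      e.continuousOn.isOpen_inter_preimage e.open_source hu,
      e.continuousOn.isOpen_inter_preimage e.open_source hv, ⟨hx, hxu⟩, ⟨hy, hyv⟩, ?_⟩
    exact (huv.preimage e).mono inter_subset_right inter_subset_right
  · exact separated_by_continuous (FiberBundle.continuous_proj F V) h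

lemma IsAdapted.congr_ker {T C C' : Type*} [AddCommGroup T] [Module ℝ T] [AddCommGroup C]
    [Module ℝ C] [AddCommGroup C'] [Module ℝ C'] {P : Module.Dual ℝ T →ₗ[ℝ] T} {L : T →ₗ[ℝ] C}
    {L' : T →ₗ[ℝ] C'} (h : ∀ v, L v = 0 ↔ L' v = 0) {α α' : Module.Dual ℝ T}
    (hα : IsAdapted P L α α') : IsAdapted P L' α α' :=
  ⟨fun v hv => hα.1 v ((h v).2 hv), (h _).1 hα.2⟩

section Pullback

variable {E : Type*} [NormedAddCommGroup E] [NormedSpace ℝ E]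
  {H : Type*} [TopologicalSpace H] {I : ModelWithCorners ℝ E H}
  {M : Type*} [TopologicalSpace M] [ChartedSpace H M] {P Q : BivectorField I M}

lemma BivectorField.PullbackEqAt.congr_of_eventuallyEq {φ φ' : M → M} {m : M}
    (h : PullbackEqAt φ Q P m) (hφ : φ =ᶠ[𝓝 m] φ') : PullbackEqAt φ' Q P m := by
  -- both differentials are regarded as maps to the model space
  have hD : ∀ (y y' : M) (D D' : E →ₗ[ℝ] E), y = y' → D = D' →
      (∀ α β : Cotangent I y, Q.eval y α β = P.eval m (α ∘ₗ D) (β ∘ₗ D)) →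
      ∀ α β : Cotangent I y', Q.eval y' α β = P.eval m (α ∘ₗ D') (β ∘ₗ D') := by
    rintro y _ D _ rfl rfl h
    exact h
  exact hD (φ m) (φ' m) _ _ hφ.self_of_nhds
    (congrArg ContinuousLinearMap.toLinearMap hφ.mfderiv_eq) h

lemma BivectorField.PullbackEqAt.sharp_eq [FiniteDimensional ℝ E] {φ : M → M} {m : M}
    (h : PullbackEqAt φ Q P m) (α : Cotangent I (φ m)) :
    Q.sharp (φ m) α =
      (mfderiv I I φ m).toLinearMap (P.sharp m (α ∘ₗ (mfderiv I I φ m).toLinearMap)) := by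
  rw [← sub_eq_zero]
  have : FiniteDimensional ℝ (TangentSpace I (φ m)) := inferInstanceAs (FiniteDimensional ℝ E)
  refine (Module.forall_dual_apply_eq_zero_iff ℝ _).1 fun β => ?_
  rw [map_sub, sub_eq_zero]
  exact h α β

end Pullback

section VectorBundle

variable {EB : Type*} [NormedAddCommGroup EB] [NormedSpace ℝ EB] [FiniteDimensional ℝ EB]
  {B : Type*} [TopologicalSpace B] [ChartedSpace EB B]
  {F : Type*} [NormedAddCommGroup F] [NormedSpace ℝ F]
  {V : B → Type*} [TopologicalSpace (TotalSpace F V)]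
  [∀ b, TopologicalSpace (V b)] [FiberBundle F V]
  {P : BivectorField (𝓘(ℝ, EB).prod 𝓘(ℝ, F)) (TotalSpace F V)}

variable (EB) in
/-- The differential of the projection. -/
def projDiff (m : TotalSpace F V) :
    TangentSpace (𝓘(ℝ, EB).prod 𝓘(ℝ, F)) m →ₗ[ℝ] TangentSpace 𝓘(ℝ, EB) m.proj :=
  (mfderiv (𝓘(ℝ, EB).prod 𝓘(ℝ, F)) 𝓘(ℝ, EB) (π F V) m).toLinearMap

/-- The vertical part of `P` is the value of `P` on adapted covectors. -/
lemma exists_adapted_of_isCompl [FiniteDimensional ℝ F] {m : TotalSpace F V}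
    (h : IsHorizontallyNondegenerateAt P m) :
    ∃ p : Cotangent (𝓘(ℝ, EB).prod 𝓘(ℝ, F)) m → Cotangent (𝓘(ℝ, EB).prod 𝓘(ℝ, F)) m,
      (∀ α, IsAdapted (P.sharp m) (projDiff EB m) α (p α)) ∧
      ∀ α β, (verticalPart P).eval m α β = P.eval m (p α) (p β) := by
  have : FiniteDimensional ℝ (TangentSpace (𝓘(ℝ, EB).prod 𝓘(ℝ, F)) m) :=
    inferInstanceAs (FiniteDimensional ℝ (EB × F))
  refine ⟨fun α => α ∘ₗ connectionForm P m, fun α => ?_, fun α β => rfl⟩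
  have h' : IsCompl (vertical m) (horizontal P m) := h
  simp only [connectionForm, dif_pos h']
  exact isAdapted_comp_projection (P.apply_sharp_self m) h' α

/-- If `Φ` pulls `Q` back to `P` and the diffeomorphism `χ` turns the values of `P` on covectors
adapted to `π ∘ Φ` into the values on covectors adapted to `π`, then `Φ ∘ χ` pulls the vertical
part of `Q` back to the vertical part of `P`. -/
lemma pullbackEqAt_verticalPart [FiniteDimensional ℝ F]
    {Q : BivectorField (𝓘(ℝ, EB).prod 𝓘(ℝ, F)) (TotalSpace F V)}
    {Φ χ : TotalSpace F V → TotalSpace F V} {m : TotalSpace F V}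
    (hχ : MDifferentiableAt (𝓘(ℝ, EB).prod 𝓘(ℝ, F)) (𝓘(ℝ, EB).prod 𝓘(ℝ, F)) χ m)
    (hΦ : MDifferentiableAt (𝓘(ℝ, EB).prod 𝓘(ℝ, F)) (𝓘(ℝ, EB).prod 𝓘(ℝ, F)) Φ (χ m))
    (hpull : BivectorField.PullbackEqAt Φ Q P (χ m)) (hPm : IsHorizontallyNondegenerateAt P m)
    (hQm : IsHorizontallyNondegenerateAt Q (Φ (χ m)))
    (key : ∀ (α α' β β' : Cotangent (𝓘(ℝ, EB).prod 𝓘(ℝ, F)) (χ m))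
      (α₀ β₀ : Cotangent (𝓘(ℝ, EB).prod 𝓘(ℝ, F)) m),
      IsAdapted (P.sharp (χ m)) (projDiff EB (Φ (χ m)) ∘ₗ (mfderiv (𝓘(ℝ, EB).prod 𝓘(ℝ, F))
        (𝓘(ℝ, EB).prod 𝓘(ℝ, F)) Φ (χ m)).toLinearMap) α α' →
      IsAdapted (P.sharp (χ m)) (projDiff EB (Φ (χ m)) ∘ₗ (mfderiv (𝓘(ℝ, EB).prod 𝓘(ℝ, F))
        (𝓘(ℝ, EB).prod 𝓘(ℝ, F)) Φ (χ m)).toLinearMap) β β' →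
      IsAdapted (P.sharp m) (projDiff EB m) (α ∘ₗ (mfderiv (𝓘(ℝ, EB).prod 𝓘(ℝ, F))
        (𝓘(ℝ, EB).prod 𝓘(ℝ, F)) χ m).toLinearMap) α₀ →
      IsAdapted (P.sharp m) (projDiff EB m) (β ∘ₗ (mfderiv (𝓘(ℝ, EB).prod 𝓘(ℝ, F))
        (𝓘(ℝ, EB).prod 𝓘(ℝ, F)) χ m).toLinearMap) β₀ →
      P.eval (χ m) α' β' = P.eval m α₀ β₀) :
    BivectorField.PullbackEqAt (fun m => Φ (χ m)) (verticalPart Q) (verticalPart P) m := by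
  intro α β
  obtain ⟨p, hp, hpeval⟩ := exists_adapted_of_isCompl hPm
  obtain ⟨q, hq, hqeval⟩ := exists_adapted_of_isCompl hQm
  have hd := (HasMFDerivAt.comp m (g := Φ) hΦ.hasMFDerivAt hχ.hasMFDerivAt).mfderiv
  have hg : ∀ α : Cotangent (𝓘(ℝ, EB).prod 𝓘(ℝ, F)) (Φ (χ m)),
      α ∘ₗ (mfderiv (𝓘(ℝ, EB).prod 𝓘(ℝ, F)) (𝓘(ℝ, EB).prod 𝓘(ℝ, F))
        (fun m => Φ (χ m)) m).toLinearMap =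
      (α ∘ₗ (mfderiv (𝓘(ℝ, EB).prod 𝓘(ℝ, F)) (𝓘(ℝ, EB).prod 𝓘(ℝ, F)) Φ (χ m)).toLinearMap) ∘ₗ
        (mfderiv (𝓘(ℝ, EB).prod 𝓘(ℝ, F)) (𝓘(ℝ, EB).prod 𝓘(ℝ, F)) χ m).toLinearMap := fun α =>
    congrArg (fun A => α ∘ₗ ContinuousLinearMap.toLinearMap A) hd
  rw [hg, hg, hpeval]
  refine (hqeval α β).trans ((hpull (q α) (q β)).trans ?_)
  exact key _ _ _ _ _ _ ((hq α).of_map hpull.sharp_eq) ((hq β).of_map hpull.sharp_eq) (hp _) (hp _)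

variable [∀ b, AddCommGroup (V b)] [∀ b, Module ℝ (V b)] [VectorBundle ℝ F V]

/-- Along the zero section, `P` is transversal to the fibres of every retraction onto the zero
section. -/
lemma HasZeroSectionAsLeaf.isTransverse
    {σ : ∀ b : B, TangentSpace 𝓘(ℝ, EB) b [⋀^Fin 2]→L[ℝ] ℝ} (h : HasZeroSectionAsLeaf P σ)
    {f : ℝ → TotalSpace F V → B} {t : ℝ} {b : B}
    (hf : MDifferentiableAt (𝓘(ℝ, EB).prod 𝓘(ℝ, F)) 𝓘(ℝ, EB) (f t) (zeroSection F V b))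
    (hfb : ∀ b, f t (zeroSection F V b) = b) :
    IsTransverse (P.sharp (zeroSection F V b))
      (mapDiff (𝓘(ℝ, EB).prod 𝓘(ℝ, F)) EB f t (zeroSection F V b)) := by
  have h1 : MDifferentiableAt 𝓘(ℝ, EB) (𝓘(ℝ, EB).prod 𝓘(ℝ, F)) (zeroSection F V) b :=
    (Bundle.contMDiff_zeroSection (n := 1) ℝ V).mdifferentiableAt (by simp)
  have h2 := HasMFDerivAt.comp b (g := f t) hf.hasMFDerivAt h1.hasMFDerivAt
  have h3 : HasMFDerivAt 𝓘(ℝ, EB) 𝓘(ℝ, EB) (f t ∘ zeroSection F V) b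
      (ContinuousLinearMap.id ℝ (TangentSpace 𝓘(ℝ, EB) b)) :=
    (hasMFDerivAt_id b).congr_of_eventuallyEq (Filter.Eventually.of_forall hfb)
  have h4 := congrArg ContinuousLinearMap.toLinearMap (hasMFDerivAt_unique h2 h3)
  exact isTransverse_of_range_eq (C := EB) (P.apply_sharp_self _) h4 (h.range_sharp b)

variable [FiniteDimensional ℝ F] [IsManifold 𝓘(ℝ, EB) ∞ B] [ContMDiffVectorBundle ∞ F V 𝓘(ℝ, EB)]

/-- A Poisson tensor with the zero section as a leaf is horizontally nondegenerate near the zero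
section, since transversality is an open condition. -/
lemma IsCoup.eventually_isHorizontallyNondegenerateAt
    {σ : ∀ b : B, TangentSpace 𝓘(ℝ, EB) b [⋀^Fin 2]→L[ℝ] ℝ} (h : IsCoup σ P) :
    ∀ᶠ m in 𝓝ˢ (zeroSet F V), IsHorizontallyNondegenerateAt P m := by
  obtain ⟨⟨N, hN, hSN, hP⟩, hleaf⟩ := h
  have hπ : ContMDiff (𝓘(ℝ, EB).prod 𝓘(ℝ, F)) 𝓘(ℝ, EB) ∞ (π F V) := Bundle.contMDiff_proj V
  rw [eventually_nhdsSet_iff_forall]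
  rintro _ ⟨b, rfl⟩
  obtain ⟨U, hsU, hU, -⟩ := exists_isTransverseChart (EB := EB) (f := fun _ : ℝ => π F V) hN hP
    (a := -2) (a' := -1) (b' := 1) (b := 2) (by norm_num) (by norm_num)
    (fun t _ m _ => hπ.contMDiffAt.comp (t, m) contMDiffAt_snd) (hSN ⟨b, rfl⟩) (b₀ := b)
    (fun _ _ => rfl)
    (fun t _ => hleaf.isTransverse (f := fun _ : ℝ => π F V) (t := t)
      (hπ.mdifferentiableAt (by simp)) fun _ => rfl)
  set s := zeroSection F V b
  have h1 := (continuousAt_extChartAt (I := 𝓘(ℝ, EB).prod 𝓘(ℝ, F)) s).eventually_mem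
    (hU.isOpen.mem_nhds hsU)
  filter_upwards [h1, extChartAt_source_mem_nhds (I := 𝓘(ℝ, EB).prod 𝓘(ℝ, F)) s] with m hm hms
  have h0 : (0 : ℝ) ∈ Ioo (-1 : ℝ) 1 := by norm_num
  have htr := (hU.isChartPoint 0 h0 _ hm).isTransverse
    (hU.isTransverseFamily.isInvertible (0, _) ⟨h0, hm⟩)
  rw [(extChartAt (𝓘(ℝ, EB).prod 𝓘(ℝ, F)) s).left_inv hms] at htr
  have : FiniteDimensional ℝ (TangentSpace (𝓘(ℝ, EB).prod 𝓘(ℝ, F)) m) :=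
    inferInstanceAs (FiniteDimensional ℝ (EB × F))
  exact htr.isCompl

end VectorBundle

end PoissonCoupling

end

theorem theorem3p2
    {EB : Type*} [NormedAddCommGroup EB] [NormedSpace ℝ EB] [FiniteDimensional ℝ EB]
    {B : Type*} [TopologicalSpace B] [T2Space B] [SecondCountableTopology B] [ConnectedSpace B]
    [ChartedSpace EB B] [IsManifold 𝓘(ℝ, EB) ∞ B]
    {F : Type*} [NormedAddCommGroup F] [NormedSpace ℝ F] [FiniteDimensional ℝ F]
    {V : B → Type*} [TopologicalSpace (TotalSpace F V)]
    [∀ b, AddCommGroup (V b)] [∀ b, Module ℝ (V b)] [∀ b, TopologicalSpace (V b)]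
    [FiberBundle F V] [VectorBundle ℝ F V] [ContMDiffVectorBundle ∞ F V 𝓘(ℝ, EB)]
    (σ : ∀ b : B, TangentSpace 𝓘(ℝ, EB) b [⋀^Fin 2]→L[ℝ] ℝ)
    (hσ : PoissonCoupling.IsSymplecticForm σ)
    (P Q : PoissonCoupling.BivectorField (𝓘(ℝ, EB).prod 𝓘(ℝ, F)) (TotalSpace F V))
    (hP : PoissonCoupling.IsCoup σ P) (hQ : PoissonCoupling.IsCoup σ Q)
    (φ : TotalSpace F V → TotalSpace F V)
    (hφ : PoissonCoupling.IsDiffZero (𝓘(ℝ, EB).prod 𝓘(ℝ, F))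
      (PoissonCoupling.zeroSet F V) φ)
    (hφPQ : ∀ᶠ m in 𝓝ˢ (PoissonCoupling.zeroSet F V),
      PoissonCoupling.BivectorField.PullbackEqAt φ Q P m) :
    (∀ᶠ m in 𝓝ˢ (PoissonCoupling.zeroSet F V),
      PoissonCoupling.IsHorizontallyNondegenerateAt P m ∧
        PoissonCoupling.IsHorizontallyNondegenerateAt Q m) ∧
    ∃ g : TotalSpace F V → TotalSpace F V,
      PoissonCoupling.IsEndZero EB g ∧
      (∀ᶠ m in 𝓝ˢ (PoissonCoupling.zeroSet F V), (g m).proj = m.proj) ∧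
      ∀ᶠ m in 𝓝ˢ (PoissonCoupling.zeroSet F V),
        PoissonCoupling.BivectorField.PullbackEqAt g
          (PoissonCoupling.verticalPart Q) (PoissonCoupling.verticalPart P) m := by
  have hPnd := hP.eventually_isHorizontallyNondegenerateAt
  have hQnd := hQ.eventually_isHorizontallyNondegenerateAt
  refine ⟨hPnd.and hQnd, ?_⟩
  have : T2Space (TotalSpace F V) := PoissonCoupling.t2Space_totalSpace V
  let I := 𝓘(ℝ, EB).prod 𝓘(ℝ, F)
  set S := PoissonCoupling.zeroSet F V
  obtain ⟨-, W, Z, hW, hSW, hZ⟩ := hφ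
  -- all isotopies are defined on open time intervals containing `[0, 1]`; straightening needs a
  -- slightly larger interval than the one on which it takes place
  obtain ⟨N₀, Φ, hN₀, hSN₀, hΦ0, hΦ1, hΦS, hΦinj, hΦdiff⟩ :=
    PoissonCoupling.exists_isotopy hW hSW hZ (a := -2) (b := 3) (by norm_num) (by norm_num)
  obtain ⟨⟨N₁, hN₁, hSN₁, hPois⟩, hleaf⟩ := hP
  have hπ : ContMDiff I 𝓘(ℝ, EB) ∞ (π F V) := Bundle.contMDiff_proj V
  have hSfst : ∀ s ∈ S, zeroSection F V s.proj = s := by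
    rintro _ ⟨b, rfl⟩
    rfl
  have h0 : (0 : ℝ) ∈ Ioo (-2 : ℝ) 3 := by norm_num
  have h1 : (1 : ℝ) ∈ Ioo (-2 : ℝ) 3 := by norm_num
  have h1' : (1 : ℝ) ∈ Ioo (-1 : ℝ) 2 := by norm_num
  have hsub : Ioo (-1 : ℝ) 2 ⊆ Ioo (-2) 3 := Ioo_subset_Ioo (by norm_num) (by norm_num)
  have hΦsm : ∀ t ∈ Ioo (-2 : ℝ) 3, ∀ m ∈ N₀, ContMDiffAt (𝓘(ℝ, ℝ).prod I) I ∞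
      (fun p : ℝ × TotalSpace F V => Φ p.1 p.2) (t, m) := fun t ht m hm =>
    PoissonCoupling.contMDiffAt_of_suspension (hΦdiff (t, m) ⟨ht, hm⟩)
  -- the family of projections which has to be straightened
  let f : ℝ → TotalSpace F V → B := fun t m => (Φ t m).proj
  have hfsm : ∀ t ∈ Ioo (-2 : ℝ) 3, ∀ m ∈ N₀ ∩ N₁, ContMDiffAt (𝓘(ℝ, ℝ).prod I) 𝓘(ℝ, EB) ∞
      (fun p : ℝ × TotalSpace F V => f p.1 p.2) (t, m) := fun t ht m hm =>
    hπ.contMDiffAt.comp (t, m) (hΦsm t ht m hm.1)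
  obtain ⟨N, χ, hN, hSN, hχ0, hχS, hχN, hχinj, hχdiff, hχf, hχeval⟩ :=
    PoissonCoupling.exists_straightening (EB := EB) (f := f) (hN₀.inter hN₁)
      (⟨fun U hU hUN => hPois.smooth U hU (hUN.trans inter_subset_right),
        fun U hU hUN => hPois.jacobi U hU (hUN.trans inter_subset_right)⟩ :
        P.IsPoissonOn (N₀ ∩ N₁)) (subset_inter hSN₀ hSN₁) (a := -2) (a' := -1) (b' := 2) (b := 3)
      (by norm_num) (by norm_num) (by norm_num) (by norm_num) hfsm
      (fun t ht s hs => by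
        change (Φ t s).proj = (Φ 0 s).proj
        rw [hΦS t ht s hs, hΦS 0 h0 s hs])
      (fun t ht s hs => by
        have h2 := hfsm t ht s ⟨hSN₀ hs, hSN₁ hs⟩
        rw [← hSfst s hs] at h2 ⊢
        refine hleaf.isTransverse (PoissonCoupling.mdifferentiableAt_of_uncurry h2).1 fun b => ?_
        change (Φ t (zeroSection F V b)).proj = b
        rw [hΦS t ht _ ⟨b, rfl⟩]
        rfl)
  have hχN₀ : ∀ t ∈ Ioo (-1 : ℝ) 2, ∀ m ∈ N, χ t m ∈ N₀ := fun t ht m hm => (hχN t ht m hm).1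
  have hNN₀ : N ⊆ N₀ := fun m hm => by
    have := hχN₀ 0 (by norm_num) m hm
    rwa [hχ0 m hm] at this
  -- the composed isotopy preserves the fibres
  let Ψ : ℝ → TotalSpace F V → TotalSpace F V := fun t m => Φ t (χ t m)
  have hΨπ : ∀ t ∈ Ioo (-1 : ℝ) 2, ∀ m ∈ N, (Ψ t m).proj = m.proj := by
    intro t ht m hm
    refine (hχf t ht m hm).trans ?_
    change (Φ 0 m).proj = m.proj
    rw [hΦ0 m (hNN₀ hm)]
  have : Nonempty B := inferInstance
  have : Nonempty (TotalSpace F V) := this.map (zeroSection F V)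
  obtain ⟨hgerm, W', Y, hW', hSW', hY, hflow⟩ := PoissonCoupling.exists_generating_field hN hSN (a := -1) (b := 2)
    (by norm_num) (by norm_num) (Ψ := Ψ)
    (fun m hm => by
      change Φ 0 (χ 0 m) = m
      rw [hχ0 m hm, hΦ0 m (hNN₀ hm)])
    (fun t ht s hs => by
      change Φ t (χ t s) = s
      rw [hχS t ht s hs, hΦS t (hsub ht) s hs])
    (fun t ht => (hΦinj t (hsub ht)).comp (hχinj t ht) (hχN₀ t ht))
    (fun p hp => IsLocalDiffeomorphAt.comp (g := PoissonCoupling.suspension Φ) _ _ (hχdiff p hp)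
      (hΦdiff (p.1, χ p.1 p.2) ⟨hsub hp.1, hχN₀ p.1 hp.1 p.2 hp.2⟩))
    (I' := 𝓘(ℝ, EB)) (f := π F V) (hπ.mdifferentiable (by simp)) hΨπ
  refine ⟨Ψ 1, ⟨hgerm, W', Y, hW', hSW', hY, hflow⟩,
    Filter.mem_of_superset (hN.mem_nhdsSet.2 hSN) fun m hm => hΨπ 1 h1' m hm, ?_⟩
  rw [eventually_nhdsSet_iff_forall] at hφPQ hPnd hQnd ⊢
  intro s hs
  have hχsm : ∀ m ∈ N, ContMDiffAt (𝓘(ℝ, ℝ).prod I) I ∞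
      (fun p : ℝ × TotalSpace F V => χ p.1 p.2) (1, m) := fun m hm =>
    PoissonCoupling.contMDiffAt_of_suspension (hχdiff (1, m) ⟨h1', hm⟩)
  have hχd : ∀ m ∈ N, MDifferentiableAt I I (χ 1) m := fun m hm =>
    (ContMDiffAt.comp m (g := fun p : ℝ × TotalSpace F V => χ p.1 p.2) (hχsm m hm)
      (contMDiffAt_const.prodMk contMDiffAt_id)).mdifferentiableAt (by simp)
  have hΦd : ∀ m ∈ N₀, MDifferentiableAt I I (Φ 1) m := fun m hm =>
    (ContMDiffAt.comp m (g := fun p : ℝ × TotalSpace F V => Φ p.1 p.2) (hΦsm 1 h1 m hm)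
      (contMDiffAt_const.prodMk contMDiffAt_id)).mdifferentiableAt (by simp)
  have hχs : Filter.Tendsto (χ 1) (𝓝 s) (𝓝 s) := by
    have := (hχd s (hSN hs)).continuousAt.tendsto
    rwa [hχS 1 h1' s hs] at this
  have hΦs : Filter.Tendsto (Φ 1) (𝓝 s) (𝓝 s) := by
    have := (hΦd s (hSN₀ hs)).continuousAt.tendsto
    rwa [hΦS 1 h1 s hs] at this
  filter_upwards [hN.mem_nhds (hSN hs), hχs.eventually (hφPQ s hs), hPnd s hs,
    (hΦs.comp hχs).eventually (hQnd s hs)] with m hm hm₁ hm₂ hm₃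
  have hn : χ 1 m ∈ N₀ := hχN₀ 1 h1' m hm
  have hΦφ : φ =ᶠ[𝓝 (χ 1 m)] Φ 1 := by
    filter_upwards [hN₀.mem_nhds hn] with n hn using (hΦ1 n hn).symm
  refine PoissonCoupling.pullbackEqAt_verticalPart (hχd m hm) (hΦd _ hn) (hm₁.congr_of_eventuallyEq hΦφ) hm₂ hm₃ ?_
  intro α α' β β' α₀ β₀ hα hβ hα₀ hβ₀
  -- `f 1 = π ∘ Φ 1`, and `f 0 = π` near the zero section
  have hker1 : ∀ v, (PoissonCoupling.projDiff EB (Φ 1 (χ 1 m)) ∘ₗ (mfderiv I I (Φ 1) (χ 1 m)).toLinearMap) v = 0 ↔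
      PoissonCoupling.mapDiff I EB f 1 (χ 1 m) v = 0 := by
    intro v
    have h2 := (HasMFDerivAt.comp (χ 1 m) (g := π F V)
      (hπ.mdifferentiable (by simp) (Φ 1 (χ 1 m))).hasMFDerivAt (hΦd _ hn).hasMFDerivAt).mfderiv
    exact Eq.congr_left (congrArg (fun A => A v) h2).symm
  have hker0 : ∀ v, PoissonCoupling.projDiff EB m v = 0 ↔ PoissonCoupling.mapDiff I EB f 0 m v = 0 := by
    intro v
    have h2 : f 0 =ᶠ[𝓝 m] π F V := by
      filter_upwards [hN₀.mem_nhds (hNN₀ hm)] with n hn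
      change (Φ 0 n).proj = n.proj
      rw [hΦ0 n hn]
    exact Eq.congr_left (congrArg (fun A : EB × F →L[ℝ] EB => A v) h2.mfderiv_eq.symm)
  exact hχeval m hm α α' β β' α₀ β₀ (hα.congr_ker hker1) (hβ.congr_ker hker1)
    (hα₀.congr_ker hker0) (hβ₀.congr_ker hker0)
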